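/- Let $d\ge 2$, $m\ge 1$ be integers. A bounded Lipschitz domain is a nonempty, bounded, connected open set that near each of its boundary points is, up to a rotation, the set above the graph of a Lipschitz function. Let $\Omega\subset\mathbb R^d$ be a bounded Lipschitz domain, let $Y=(-\tfrac12,\tfrac12)^d$, and let $\omega\subset Y$ be a bounded Lipschitz domain with $\mathrm{dist}(\omega,\partial Y)>0$ and $Y\setminus\overline{\omega}$ connected. Fix $\kappa>0$. For $\varepsilon\in(0,1)$ and $\mathbf n\in\mathbb Z^d$ put $\omega_\varepsilon^{\mathbf n}=\varepsilon(\mathbf n+\omega)$, $$\mathcal I_\varepsilon=\{\mathbf n\in\mathbb Z^d:\ \omega_\varepsilon^{\mathbf n}\subset\Omega,\ \mathrm{dist}(\omega_\varepsilon^{\mathbf n},\partial\Omega)>\kappa\varepsilon\},\qquad D_\varepsilon=\bigcup_{\mathbf n\in\mathcal I_\varepsilon}\omega_\varepsilon^{\mathbf n},\qquad \Omega_\varepsilon=\Omega\setminus\overline{D_\varepsilon},$$ and for $\delta\in(0,\infty)$ let $\Lambda_{\varepsilon,\delta}=\delta\,\mathbf 1_{D_\varepsilon}+\mathbf 1_{\Omega_\varepsilon}$.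 Let $\mu>0$ and $M\in\mathbb R$, and let $A=(a_{ij}^{\alpha\beta})$, $1\le i,j\le d$, $1\le\alpha,\beta\le m$, be a measurable, $\mathbb Z^d$-periodic real coefficient tensor on $\mathbb R^d$ with $$\mu|\xi|^2\le a_{ij}^{\alpha\beta}(y)\,\xi_i^\alpha\xi_j^\beta\le\mu^{-1}|\xi|^2\quad\text{and}\quad |a_{ij}^{\alpha\beta}(y)|\le M\qquad\text{for all } y\in\mathbb R^d,\ \xi\in\mathbb R^{dm}.$$ (If $a_{ij}^{\alpha\beta}=a_{ji}^{\beta\alpha}$, the second condition follows from the first with $M=\mu^{-1}$.) For $f\in L^2(\Omega;\mathbb R^m)$ and $g\in H^{1/2}(\partial\Omega;\mathbb R^m)$, let $u\in H^1(\Omega;\mathbb R^m)$ be the weak solution of $$-\mathrm{div}\big(\Lambda_{\varepsilon,\delta}(x)A(x/\varepsilon)\nabla u\big)=f\ \text{ in }\Omega,\qquad u=g\ \text{ on }\partial\Omega, \tag{1}$$ tested against all of $H^1_0(\Omega;\mathbb R^m)$. Here $H^{1/2}(\partial\Omega;\mathbb R^m)$ is the space of traces of $H^1(\Omega;\mathbb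 R^m)$, that is, $H^1(\Omega;\mathbb R^m)/H^1_0(\Omega;\mathbb R^m)$, with the trace norm $\|g\|_{H^{1/2}(\partial\Omega)}=\inf\{\|G\|_{H^1(\Omega)}: G=g\text{ on }\partial\Omega\}$. Then there is a constant $C>0$, depending only on $d,m,\kappa,\mu,M,\Omega$ and $\omega$ (in particular not on $\varepsilon$, $\delta$, $f$, $g$, and on $A$ only through $\mu$ and $M$), such that for all $\varepsilon\in(0,1)$: (i) if $\delta\in(0,1]$, then $$\|u\|_{H^1(\Omega)}\le C\big(\|f\|_{L^2(\Omega)}+\varepsilon\delta^{-1}\|f\|_{L^2(D_\varepsilon)}+\|g\|_{H^{1/2}(\partial\Omega)}\big);$$ (ii) if $\delta>1$, then $\|u\|_{H^1(\Omega)}\le C\big(\|f\|_{L^2(\Omega)}+\|g\|_{H^{1/2}(\partial\Omega)}\big)$; (iii) if $\delta\in(0,1]$ and $u$ solves (1) with the right-hand side $f$ replaced by $f_{\varepsilon,\delta}$, where $f_{\varepsilon,\delta}=f$ for $\delta\ge1$ and $f_{\varepsilon,\delta}=\Lambda_{\varepsilon,\delta}f$ for $\delta<1$, then $\|u\|_{H^1(\Omega)}\le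 C\big(\|f\|_{L^2(\Omega)}+\|g\|_{H^{1/2}(\partial\Omega)}\big)$. -/

import Mathlib

open MeasureTheory
open scoped ENNReal

noncomputable section

namespace HighContrast

/-- `d`-dimensional Euclidean space. -/
abbrev E (d : ℕ) : Type := EuclideanSpace ℝ (Fin d)

/-- Gradients of `ℝ^m`-valued maps on `ℝ^d`: the entry `(j, β)` stands for `∂_j u^β`.
The norm is the Euclidean norm of `ℝ^{dm}`. -/
abbrev Grad (d m : ℕ) : Type := EuclideanSpace ℝ (Fin d × Fin m)

/-! ### Sobolev spaces -/

/-- `φ` is a smooth function with compact support contained in `U`. -/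
def IsTestFunction {d : ℕ} {F : Type*} [NormedAddCommGroup F] [NormedSpace ℝ F]
    (U : Set (E d)) (φ : E d → F) : Prop :=
  ContDiff ℝ ((⊤ : ℕ∞) : WithTop ℕ∞) φ ∧ HasCompactSupport φ ∧ tsupport φ ⊆ U

/-- The partial derivative `∂_j φ`. -/
def partialDeriv {d : ℕ} (j : Fin d) (φ : E d → ℝ) (x : E d) : ℝ :=
  fderiv ℝ φ x (EuclideanSpace.single j 1)

/-- `Du` is the weak gradient of `u` in `U`. -/
def IsWeakGradient {d m : ℕ} (U : Set (E d)) (u : E d → E m) (Du : E d → Grad d m) : Prop :=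
  ∀ φ : E d → ℝ, IsTestFunction U φ → ∀ (j : Fin d) (β : Fin m),
    ∫ x in U, u x β * partialDeriv j φ x = - ∫ x in U, Du x (j, β) * φ x

/-- Pairs `(u, Du)` in `L²(U; ℝ^m) × L²(U; ℝ^{dm})`, with the Hilbert norm
`(‖u‖² + ‖Du‖²)^{1/2}`. -/
abbrev L2Pair (d m : ℕ) (U : Set (E d)) : Type :=
  WithLp 2 (Lp (E m) 2 (volume.restrict U) × Lp (Grad d m) 2 (volume.restrict U))

theorem integrable_coord_mul {d : ℕ} {ι : Type*} [Fintype ι] {U : Set (E d)}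
    (w : Lp (EuclideanSpace ℝ ι) 2 (volume.restrict U)) (i : ι) {ψ : E d → ℝ}
    (hc : Continuous ψ) (hs : HasCompactSupport ψ) :
    Integrable (fun x => w x i * ψ x) (volume.restrict U) := by
  have h1 : MemLp (fun x => w x i) 2 (volume.restrict U) :=
    (EuclideanSpace.proj (𝕜 := ℝ) i).comp_memLp' (Lp.memLp w)
  have h2 : MemLp ψ 2 (volume.restrict U) := hc.memLp_of_hasCompactSupport hs
  exact h1.integrable_mul h2

theorem IsTestFunction.continuous_partialDeriv {d : ℕ} {U : Set (E d)} {φ : E d → ℝ}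
    (h : IsTestFunction U φ) (j : Fin d) : Continuous (partialDeriv j φ) :=
  (h.1.continuous_fderiv (by simp)).clm_apply continuous_const

theorem IsTestFunction.hasCompactSupport_partialDeriv {d : ℕ} {U : Set (E d)} {φ : E d → ℝ}
    (h : IsTestFunction U φ) (j : Fin d) : HasCompactSupport (partialDeriv j φ) :=
  h.2.1.fderiv_apply (𝕜 := ℝ) (EuclideanSpace.single j 1)

/-- The Sobolev space `H¹(U; ℝ^m)`: the square integrable `u` with a square integrable weak
gradient, each stored together with its weak gradient. -/
def H1 {d : ℕ} (m : ℕ) (U : Set (E d)) : Submodule ℝ (L2Pair d m U) where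
  carrier := {p | IsWeakGradient U p.fst p.snd}
  zero_mem' := by
    intro φ _ j β
    have h1 : ∫ x in U, (0 : Lp (E m) 2 (volume.restrict U)) x β * partialDeriv j φ x = 0 := by
      refine integral_eq_zero_of_ae ?_
      filter_upwards [Lp.coeFn_zero (E m) 2 (volume.restrict U)] with x hx
      rw [hx]
      simp
    have h2 : ∫ x in U, (0 : Lp (Grad d m) 2 (volume.restrict U)) x (j, β) * φ x = 0 := by
      refine integral_eq_zero_of_ae ?_
      filter_upwards [Lp.coeFn_zero (Grad d m) 2 (volume.restrict U)] with x hx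
      rw [hx]
      simp
    exact h1.trans (by rw [← neg_zero, ← h2]; rfl)
  add_mem' := by
    intro p q hp hq φ hφ j β
    have h1 : ∫ x in U, (p + q).fst x β * partialDeriv j φ x =
        (∫ x in U, p.fst x β * partialDeriv j φ x) + ∫ x in U, q.fst x β * partialDeriv j φ x := by
      rw [← integral_add
        (integrable_coord_mul _ β (hφ.continuous_partialDeriv j)
          (hφ.hasCompactSupport_partialDeriv j))
        (integrable_coord_mul _ β (hφ.continuous_partialDeriv j)
          (hφ.hasCompactSupport_partialDeriv j))]
      refine integral_congr_ae ?_
      filter_upwards [Lp.coeFn_add p.fst q.fst] with x hx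
      rw [WithLp.add_fst, hx]
      simp [add_mul]
    have h2 : ∫ x in U, (p + q).snd x (j, β) * φ x =
        (∫ x in U, p.snd x (j, β) * φ x) + ∫ x in U, q.snd x (j, β) * φ x := by
      rw [← integral_add
        (integrable_coord_mul _ (j, β) hφ.1.continuous hφ.2.1)
        (integrable_coord_mul _ (j, β) hφ.1.continuous hφ.2.1)]
      refine integral_congr_ae ?_
      filter_upwards [Lp.coeFn_add p.snd q.snd] with x hx
      rw [WithLp.add_snd, hx]
      simp [add_mul]
    rw [h1, h2, hp φ hφ j β, hq φ hφ j β]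
    ring
  smul_mem' := by
    intro c p hp φ hφ j β
    have h1 : ∫ x in U, (c • p).fst x β * partialDeriv j φ x =
        c * ∫ x in U, p.fst x β * partialDeriv j φ x := by
      rw [← integral_const_mul]
      refine integral_congr_ae ?_
      filter_upwards [Lp.coeFn_smul c p.fst] with x hx
      simp [hx, mul_assoc]
    have h2 : ∫ x in U, (c • p).snd x (j, β) * φ x =
        c * ∫ x in U, p.snd x (j, β) * φ x := by
      rw [← integral_const_mul]
      refine integral_congr_ae ?_
      filter_upwards [Lp.coeFn_smul c p.snd] with x hx
      simp [hx, mul_assoc]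
    rw [h1, h2, hp φ hφ j β]
    ring

/-- A representative of the function `u` itself. -/
def H1.fn {d m : ℕ} {U : Set (E d)} (u : H1 m U) : E d → E m := u.1.fst

/-- A representative of the weak gradient of `u`. -/
def H1.grad {d m : ℕ} {U : Set (E d)} (u : H1 m U) : E d → Grad d m := u.1.snd

/-- `H¹₀(U; ℝ^m)`: the closure of the test functions in `H¹(U; ℝ^m)`. -/
def H10 {d : ℕ} (m : ℕ) (U : Set (E d)) : Submodule ℝ (H1 m U) :=
  (Submodule.span ℝ {v : H1 m U | ∃ φ : E d → E m, IsTestFunction U φ ∧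
    H1.fn v =ᵐ[volume.restrict U] φ}).topologicalClosure

/-- `H^{1/2}(∂U; ℝ^m)`, the space of boundary values of `H¹(U; ℝ^m)`. Two functions of `H¹(U; ℝ^m)`
have the same trace on `∂U` exactly when they differ by an element of `H¹₀(U; ℝ^m)`, and the norm
is the trace norm `‖g‖ = inf {‖G‖_{H¹(U)} : G = g on ∂U}`, that is, Mathlib's quotient norm. -/
abbrev HHalf {d : ℕ} (m : ℕ) (U : Set (E d)) : Type := H1 m U ⧸ H10 m U

/-- The trace of `u ∈ H¹(U; ℝ^m)` on `∂U`. -/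
def trace {d m : ℕ} {U : Set (E d)} (u : H1 m U) : HHalf m U := (H10 m U).mkQ u

/-! ### Geometry -/

/-- Near each boundary point, and after a rotation, `U` is the set above the graph of a Lipschitz
function. Here `e` is the vertical direction, `y - ⟪e, y⟫ e` the horizontal part of `y`, and only
the values of `γ` on the hyperplane orthogonal to `e` matter. -/
def HasLipschitzBoundary {d : ℕ} (U : Set (E d)) : Prop :=
  ∀ x ∈ frontier U, ∃ (e : E d) (γ : E d → ℝ) (K : NNReal) (r : ℝ),
    ‖e‖ = 1 ∧ LipschitzWith K γ ∧ 0 < r ∧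
      ∀ y ∈ Metric.ball x r, y ∈ U ↔ γ (y - (inner ℝ e y : ℝ) • e) < inner ℝ e y

/-- A bounded Lipschitz domain (nonempty, open and connected). -/
structure IsBoundedLipschitzDomain {d : ℕ} (U : Set (E d)) : Prop where
  isOpen : IsOpen U
  isConnected : IsConnected U
  isBounded : Bornology.IsBounded U
  lipschitz : HasLipschitzBoundary U

/-- The distance between two sets. -/
def setDist {d : ℕ} (S T : Set (E d)) : ℝ≥0∞ := ⨅ x ∈ S, ⨅ y ∈ T, edist x y

/-- The open unit cell `Y = (-1/2, 1/2)^d`. -/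
def unitCell (d : ℕ) : Set (E d) := {y | ∀ i, -(1 / 2 : ℝ) < y i ∧ y i < 1 / 2}

/-- The model inclusion: a Lipschitz domain at positive distance from the boundary of the unit
cell, surrounded by a connected background. -/
structure IsInclusion {d : ℕ} (ω : Set (E d)) : Prop where
  domain : IsBoundedLipschitzDomain ω
  subset : ω ⊆ unitCell d
  dist_pos : 0 < setDist ω (frontier (unitCell d))
  connected_compl : IsConnected (unitCell d \ closure ω)

/-- The integer vector `n`, as a point of `ℝ^d`. -/
def latticePoint {d : ℕ} (n : Fin d → ℤ) : E d := WithLp.toLp 2 (fun i => (n i : ℝ))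

/-- `ω_ε^n = ε (n + ω)`. -/
def cellInclusion {d : ℕ} (ω : Set (E d)) (ε : ℝ) (n : Fin d → ℤ) : Set (E d) :=
  (fun y => ε • (latticePoint n + y)) '' ω

/-- The index set `I_ε` of the inclusions kept in `Ω`. -/
def indexSet {d : ℕ} (Ω ω : Set (E d)) (κ ε : ℝ) : Set (Fin d → ℤ) :=
  {n | cellInclusion ω ε n ⊆ Ω ∧
    ENNReal.ofReal (κ * ε) < setDist (cellInclusion ω ε n) (frontier Ω)}

/-- The union `D_ε` of the inclusions. -/
def inclusions {d : ℕ} (Ω ω : Set (E d)) (κ ε : ℝ) : Set (E d) :=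
  ⋃ n ∈ indexSet Ω ω κ ε, cellInclusion ω ε n

/-- The background `Ω_ε = Ω \ closure D_ε`. -/
def background {d : ℕ} (Ω ω : Set (E d)) (κ ε : ℝ) : Set (E d) :=
  Ω \ closure (inclusions Ω ω κ ε)

/-- The contrast function `Λ_{ε,δ} = δ 1_{D_ε} + 1_{Ω_ε}`. -/
def contrast {d : ℕ} (Ω ω : Set (E d)) (κ ε δ : ℝ) (x : E d) : ℝ :=
  δ * (inclusions Ω ω κ ε).indicator (fun _ => (1 : ℝ)) x +
    (background Ω ω κ ε).indicator (fun _ => (1 : ℝ)) x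

/-! ### The coefficients and the Dirichlet problem -/

/-- Coefficient tensors: `A y i j α β` is `a_{ij}^{αβ}(y)`. -/
abbrev Coeff (d m : ℕ) : Type := E d → Fin d → Fin d → Fin m → Fin m → ℝ

/-- The form `a_{ij}^{αβ}(y) ξ_j^β η_i^α`. -/
def Coeff.form {d m : ℕ} (A : Coeff d m) (y : E d) (ξ η : Grad d m) : ℝ :=
  ∑ i, ∑ j, ∑ α, ∑ β, A y i j α β * ξ (j, β) * η (i, α)

/-- Strong ellipticity with constant `μ`. -/
def Coeff.IsElliptic {d m : ℕ} (A : Coeff d m) (μ : ℝ) : Prop :=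
  ∀ (y : E d) (ξ : Grad d m), μ * ‖ξ‖ ^ 2 ≤ A.form y ξ ξ ∧ A.form y ξ ξ ≤ μ⁻¹ * ‖ξ‖ ^ 2

/-- Periodicity with respect to the integer lattice. -/
def Coeff.IsPeriodic {d m : ℕ} (A : Coeff d m) : Prop :=
  ∀ (y : E d) (n : Fin d → ℤ), A (y + latticePoint n) = A y

/-- All entries of `A` are measurable functions. -/
def Coeff.IsMeasurable {d m : ℕ} (A : Coeff d m) : Prop :=
  ∀ i j α β, Measurable (fun y => A y i j α β)

/-- All entries of `A` are bounded by `M` in absolute value. -/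
def Coeff.IsBoundedBy {d m : ℕ} (A : Coeff d m) (M : ℝ) : Prop :=
  ∀ y i j α β, |A y i j α β| ≤ M

/-- `u ∈ H¹(Ω; ℝ^m)` is a weak solution of `-div (Λ_{ε,δ} A(x/ε) ∇u) = f` in `Ω`, `u = g` on
`∂Ω`. -/
def IsWeakSolution {d m : ℕ} (Ω ω : Set (E d)) (κ : ℝ) (A : Coeff d m) (ε δ : ℝ)
    (f : E d → E m) (g : HHalf m Ω) (u : H1 m Ω) : Prop :=
  trace u = g ∧ ∀ v ∈ H10 m Ω,
    ∫ x in Ω, contrast Ω ω κ ε δ x * A.form (ε⁻¹ • x) (H1.grad u x) (H1.grad v x) =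
      ∫ x in Ω, inner ℝ (f x) (H1.fn v x)

/-- The norm of `L²(S; ℝ^m)`. -/
def l2Norm {d m : ℕ} (S : Set (E d)) (f : E d → E m) : ℝ :=
  (eLpNorm f 2 (volume.restrict S)).toReal

/-- The modified source `f_{ε,δ}`: equal to `f` for `δ ≥ 1` and to `Λ_{ε,δ} f` for `δ < 1`. -/
def modifiedSource {d m : ℕ} (Ω ω : Set (E d)) (κ ε δ : ℝ) (f : E d → E m) (x : E d) : E m :=
  if 1 ≤ δ then f x else contrast Ω ω κ ε δ x • f x

end HighContrast

end

open MeasureTheory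
open scoped ENNReal

namespace HighContrast

open Metric Set Filter Topology ContinuousLinearMap


/-! The equation is tested with u - G, where G is any H¹ function with trace g. Ellipticity and
Young's inequality bound the weighted energy ∫ Λ|∇(u - G)|² by f and ∫ Λ|∇G|² (`energy_le`,
`enorm_sq_solution_le`). Friedrichs' inequality then gives the H¹ norm, provided that the weighted
energy controls the unweighted one and that ∫ Λ|∇G|² is bounded uniformly in δ. Each proviso fails
at one end of the range of δ.

For δ ≤ 1 the second proviso is clear, and the gradient inside D_ε has to be recovered from outside.
On one inclusion S, u is compared with an extension of its outside values whose energy in S is at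
most C times the energy of u in a layer around S (`IsInclusion.exists_inner_correction`). The
difference vanishes outside S and is an admissible test function. The weight is the constant δ on S,
so it cancels between the energies; Friedrichs' inequality on S supplies a factor ε, and the source
enters as ε δ⁻¹ ‖f‖ in L²(S) (`exists_inner_estimate`). The layers lie in disjoint cells, so the
squares add up. In (iii) the source carries a factor δ on D_ε, which cancels δ⁻¹.

For δ > 1 the first proviso is clear, and G is changed instead: some V in H¹₀ has the gradient of G
on D_ε up to a small error (`exists_outer_corrector`), built in each cell as a cutoff times G - c.
Then G - V has the trace of G and almost no gradient where the weight is large.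

Both cell constructions are scale invariant, so they are made once, for ω. The extension folds a
function across the Lipschitz boundary in charts and glues the pieces by a partition of unity. Only
gradients are controlled, so the local Poincaré constants of all charts must be one vector c; this
follows by chaining along ∂ω (`exists_common_const`), which requires ∂ω to be connected. The closure
of ω and Y ∖ ω are connected, closed in Y, cover Y and meet in ∂ω; since Y is simply connected, it
is unicoherent (`IsPreconnected.inter_of_simplyConnected`).

Functions in H¹ are approximated by mollification on compact subsets of Ω only. The corrections are
compactly supported Lipschitz functions, which belong to H¹₀ (`exists_H10_of_lipschitz`), and the
approximation error η is sent to 0 in the final inequalities. -/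

theorem ennreal_add_sq_le (a b : ℝ≥0∞) : (a + b) ^ 2 ≤ 2 * a ^ 2 + 2 * b ^ 2 := by
  have h := ENNReal.rpow_add_le_mul_rpow_add_rpow a b (p := 2) (by norm_num)
  norm_num at h
  rwa [mul_add] at h

theorem enorm_sub_sq_le {F : Type*} [SeminormedAddCommGroup F] (a b : F) :
    ‖a - b‖ₑ ^ 2 ≤ 2 * ‖a‖ₑ ^ 2 + 2 * ‖b‖ₑ ^ 2 :=
  (pow_le_pow_left' enorm_sub_le 2).trans (ennreal_add_sq_le _ _)

theorem enorm_add_sq_le {F : Type*} [NormedAddCommGroup F] (a b : F) : ‖a + b‖ₑ ^ 2 ≤ 2 * ‖a‖ₑ ^ 2 + 2 * ‖b‖ₑ ^ 2 :=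
  (pow_le_pow_left' (enorm_add_le a b) 2).trans (ennreal_add_sq_le _ _)

/-- Cauchy-Schwarz with a weight. -/
theorem lintegral_weight_mul_sq_le {α : Type*} [MeasurableSpace α] {μ : Measure α}
    {w h : α → ℝ≥0∞} (hw : AEMeasurable w μ) (hh : AEMeasurable h μ) :
    (∫⁻ x, w x * h x ∂μ) ^ 2 ≤ (∫⁻ x, w x ∂μ) * ∫⁻ x, w x * h x ^ 2 ∂μ := by
  have hw2 : ∀ x, w x ^ (1 / 2 : ℝ) * w x ^ (1 / 2 : ℝ) = w x := fun x => by
    rw [← ENNReal.rpow_add_of_nonneg _ _ (by norm_num) (by norm_num)]; norm_num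
  have key := ENNReal.lintegral_mul_le_Lp_mul_Lq μ Real.HolderConjugate.two_two
    (hw.pow_const (1 / 2 : ℝ)) ((hw.pow_const (1 / 2 : ℝ)).mul hh)
  have e1 : ∀ x, w x ^ (1 / 2 : ℝ) * (w x ^ (1 / 2 : ℝ) * h x) = w x * h x := fun x => by
    rw [← mul_assoc, hw2]
  have e2 : ∀ x, (w x ^ (1 / 2 : ℝ)) ^ (2 : ℝ) = w x := fun x => by
    rw [← ENNReal.rpow_mul]; norm_num
  have e3 : ∀ x, (w x ^ (1 / 2 : ℝ) * h x) ^ (2 : ℝ) = w x * h x ^ 2 := fun x => by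
    rw [ENNReal.mul_rpow_of_nonneg _ _ (by norm_num), e2, ENNReal.rpow_two]
  simp only [Pi.mul_apply, e1, e2, e3] at key
  calc _ ≤ _ := pow_le_pow_left' key 2
    _ = _ := by
      rw [mul_pow, ← ENNReal.rpow_natCast, ← ENNReal.rpow_natCast, ← ENNReal.rpow_mul,
        ← ENNReal.rpow_mul]
      norm_num

/-! ### Mollification and its convergence in L². -/

section Mollification

variable {d : ℕ} {F : Type*} [NormedAddCommGroup F] [NormedSpace ℝ F]

/-- The mollification of `g` by the normalized bump function `ρ`. -/
noncomputable def mollify (ρ : ContDiffBump (0 : E d)) (g : E d → F) : E d → F :=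
  convolution (ρ.normed volume) g (lsmul ℝ ℝ) volume

theorem mollify_apply (ρ : ContDiffBump (0 : E d)) (g : E d → F) (x : E d) :
    mollify ρ g x = ∫ t, ρ.normed volume t • g (x - t) := rfl

theorem integrable_normed_smul (ρ : ContDiffBump (0 : E d)) {g : E d → F}
    (hg : LocallyIntegrable g volume) (x : E d) :
    Integrable (fun t => ρ.normed volume t • g (x - t)) volume :=
  HasCompactSupport.convolutionExists_left (μ := volume) (lsmul ℝ ℝ)
    (ρ.hasCompactSupport_normed (μ := volume)) ρ.continuous_normed hg x

theorem mollify_sub (ρ : ContDiffBump (0 : E d)) {g : E d → F}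
    (hg : LocallyIntegrable g volume) (x : E d) [CompleteSpace F] :
    mollify ρ g x - g x = ∫ t, ρ.normed volume t • (g (x - t) - g x) := by
  have h2 : Integrable (fun t => ρ.normed volume t • g x) volume :=
    (ρ.integrable_normed).smul_const _
  simp_rw [smul_sub]
  rw [integral_sub (integrable_normed_smul ρ hg x) h2, integral_smul_const, ρ.integral_normed,
    one_smul, mollify_apply]

theorem lintegral_normed (ρ : ContDiffBump (0 : E d)) :
    ∫⁻ t, ENNReal.ofReal (ρ.normed volume t) = 1 := by
  rw [← ofReal_integral_eq_lintegral_ofReal ρ.integrable_normed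
    (ae_of_all _ fun t => ρ.nonneg_normed t), ρ.integral_normed, ENNReal.ofReal_one]

/-- Jensen's inequality for the probability density `ρ.normed volume`: Cauchy–Schwarz with this
weight, whose total mass is 1. -/
theorem enorm_integral_normed_smul_sq_le (ρ : ContDiffBump (0 : E d)) {h : E d → F}
    (hh : AEStronglyMeasurable h volume) :
    ‖∫ t, ρ.normed volume t • h t‖ₑ ^ 2 ≤
      ∫⁻ t, ENNReal.ofReal (ρ.normed volume t) * ‖h t‖ₑ ^ 2 := by
  have h1 : ‖∫ t, ρ.normed volume t • h t‖ₑ ≤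
      ∫⁻ t, ENNReal.ofReal (ρ.normed volume t) * ‖h t‖ₑ := by
    refine (enorm_integral_le_lintegral_enorm _).trans (le_of_eq ?_)
    refine lintegral_congr fun t => ?_
    rw [enorm_smul, Real.enorm_of_nonneg (ρ.nonneg_normed t)]
  refine (pow_le_pow_left' h1 2).trans ((lintegral_weight_mul_sq_le
    (ρ.continuous_normed.measurable.ennreal_ofReal.aemeasurable) hh.enorm).trans ?_)
  rw [lintegral_normed, one_mul]

omit [NormedSpace ℝ F] in
-- Continuity of translations in L², read off from the continuous action of `(E d)ᵈᵃᵃ` on `Lp`.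
theorem exists_translation_small {g : E d → F} (hg : MemLp g 2 volume) {η : ℝ≥0∞} (hη : η ≠ 0) :
    ∃ h > 0, ∀ t : E d, ‖t‖ < h → ∫⁻ x, ‖g (x - t) - g x‖ₑ ^ 2 ≤ η := by
  have : Fact ((2 : ℝ≥0∞) ≠ ∞) := ⟨by simp⟩
  have hc : Continuous fun t : E d => (DomAddAct.mk t) +ᵥ (hg.toLp g) := by
    have : Continuous fun t : E d => (DomAddAct.mk t : (E d)ᵈᵃᵃ) := DomAddAct.continuous_mk
    exact this.vadd continuous_const
  have hη' : η ^ (1 / 2 : ℝ) ≠ 0 := by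
    simp [ENNReal.rpow_eq_zero_iff, hη]
  have ht := hc.tendsto 0
  rw [EMetric.tendsto_nhds] at ht
  obtain ⟨h, h0, H⟩ := Metric.eventually_nhds_iff.1 (ht _ (pos_iff_ne_zero.2 hη'))
  refine ⟨h, h0, fun t hlt => ?_⟩
  have h1 := (H (y := -t) (by simpa using hlt)).le
  have e0 : (DomAddAct.mk (0 : E d)) +ᵥ (hg.toLp g) = hg.toLp g := by
    rw [DomAddAct.mk_zero, zero_vadd]
  rw [e0, DomAddAct.mk_vadd_toLp, Lp.edist_toLp_toLp, eLpNorm_eq_lintegral_rpow_enorm_toReal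
    (by norm_num) (by norm_num)] at h1
  have h2 := (ENNReal.rpow_le_rpow_iff (z := 1 / 2) (by norm_num)).1
    (by simpa using h1)
  refine le_trans (le_of_eq (lintegral_congr fun x => ?_)) h2
  rw [neg_add_eq_sub]

/-- By Jensen and Tonelli the squared mollification error is at most an average of squared
translation errors over shifts shorter than `ρ.rOut`. The bound holds for every small `ρ`, so that
one `ρ` can serve a function and its gradient at once. -/
theorem exists_mollify_close [CompleteSpace F] {g : E d → F} (hg : MemLp g 2 volume) {η : ℝ≥0∞}
    (hη : η ≠ 0) :
    ∃ h > 0, ∀ ρ : ContDiffBump (0 : E d), ρ.rOut < h →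
      ∫⁻ x, ‖mollify ρ g x - g x‖ₑ ^ 2 ≤ η := by
  obtain ⟨h, h0, H⟩ := exists_translation_small hg hη
  refine ⟨h, h0, fun ρ hρ => ?_⟩
  have hloc : LocallyIntegrable g volume := hg.locallyIntegrable (by norm_num)
  have hm : AEStronglyMeasurable (fun p : E d × E d => g (p.1 - p.2) - g p.1)
      (volume.prod volume) :=
    (hg.1.comp_quasiMeasurePreserving (quasiMeasurePreserving_sub _ _)).sub hg.1.comp_fst
  have hm' : AEMeasurable (fun p : E d × E d =>
      ENNReal.ofReal (ρ.normed volume p.2) * ‖g (p.1 - p.2) - g p.1‖ₑ ^ 2)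
      (volume.prod volume) :=
    ((ρ.continuous_normed.measurable.ennreal_ofReal.comp measurable_snd).aemeasurable).mul
      (hm.enorm.pow_const 2)
  calc ∫⁻ x, ‖mollify ρ g x - g x‖ₑ ^ 2
      ≤ ∫⁻ x, ∫⁻ t, ENNReal.ofReal (ρ.normed volume t) * ‖g (x - t) - g x‖ₑ ^ 2 := by
        refine lintegral_mono_ae ?_
        filter_upwards [hm.prodMk_left] with x hx
        rw [mollify_sub ρ hloc]
        exact enorm_integral_normed_smul_sq_le ρ hx
    _ = ∫⁻ t, ∫⁻ x, ENNReal.ofReal (ρ.normed volume t) * ‖g (x - t) - g x‖ₑ ^ 2 :=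
        lintegral_lintegral_swap hm'
    _ ≤ ∫⁻ t, ENNReal.ofReal (ρ.normed volume t) * η := by
        refine lintegral_mono fun t => ?_
        rw [lintegral_const_mul']
        · by_cases ht : ‖t‖ < h
          · gcongr; exact H t ht
          · have : ρ.normed volume t = 0 := by
              rw [← Function.notMem_support, ρ.support_normed_eq, mem_ball_zero_iff]
              linarith
            simp [this]
        · exact ENNReal.ofReal_ne_top
    _ = η := by
        rw [lintegral_mul_const _ ρ.continuous_normed.measurable.ennreal_ofReal,
          lintegral_normed, one_mul]

end Mollification

/-! ### Weak gradients, mollification and Lipschitz functions. -/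

section Gradient

variable {d m : ℕ}

/-- The entries `(j, β) ↦ ∂_j u^β` of a derivative, as a vector of `ℝ^{dm}`. -/
noncomputable def gradOf (d m : ℕ) : (E d →L[ℝ] E m) →L[ℝ] Grad d m :=
  LinearMap.toContinuousLinearMap
    { toFun := fun L => WithLp.toLp 2 fun p => L (EuclideanSpace.single p.1 1) p.2
      map_add' := fun L L' => by ext p; simp
      map_smul' := fun c L => by ext p; simp }

theorem gradOf_apply (L : E d →L[ℝ] E m) (j : Fin d) (β : Fin m) :
    gradOf d m L (j, β) = L (EuclideanSpace.single j 1) β := rfl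

theorem gradOf_injective : Function.Injective (gradOf d m) := by
  intro L L' h
  refine ContinuousLinearMap.coe_injective ((EuclideanSpace.basisFun (Fin d) ℝ).toBasis.ext
    fun j => ?_)
  ext β
  have := congrArg (fun v : Grad d m => v (j, β)) h
  simpa [gradOf_apply] using this

/-- The operator norm and the Euclidean norm of a gradient are comparable. -/
theorem exists_gradOf_bounds (d m : ℕ) : ∃ c : ℝ, 1 ≤ c ∧ ∀ L : E d →L[ℝ] E m,
    ‖gradOf d m L‖ ≤ c * ‖L‖ ∧ ‖L‖ ≤ c * ‖gradOf d m L‖ := by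
  obtain ⟨K, _, hK⟩ := (gradOf d m : (E d →L[ℝ] E m) →ₗ[ℝ] Grad d m).exists_antilipschitzWith
    (LinearMap.ker_eq_bot.2 gradOf_injective)
  refine ⟨max 1 (max ‖gradOf d m‖ K), le_max_left _ _, fun L => ⟨?_, ?_⟩⟩
  · refine ((gradOf d m).le_opNorm L).trans ?_
    gcongr
    exact (le_max_left _ _).trans (le_max_right _ _)
  · have := hK.le_mul_norm (map_zero (gradOf d m)) L
    refine this.trans ?_
    gcongr
    · exact (le_max_right _ _).trans (le_max_right _ _)
    · rfl

/-- The classical gradient. -/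
noncomputable def gradVec (u : E d → E m) (x : E d) : Grad d m := gradOf d m (fderiv ℝ u x)

/-- Inserting this function into the definition of the weak gradient computes the gradient of the
mollification at `x`; the closed ball must lie in `U` for it to be admissible. -/
theorem isTestFunction_reflect_normed (ρ : ContDiffBump (0 : E d)) {U : Set (E d)} {x : E d}
    (hx : closedBall x ρ.rOut ⊆ U) : IsTestFunction U fun y => ρ.normed volume (x - y) := by
  have hts : tsupport (fun y => ρ.normed volume (x - y)) ⊆ closedBall x ρ.rOut := by
    refine closure_minimal (fun y hy => ?_) isClosed_closedBall
    have : x - y ∈ Function.support (ρ.normed volume) := hy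
    rw [ρ.support_normed_eq, mem_ball_zero_iff] at this
    rw [mem_closedBall', dist_eq_norm]
    exact this.le
  refine ⟨ρ.contDiff_normed.comp (contDiff_const.sub contDiff_id), ?_, hts.trans hx⟩
  exact (isCompact_closedBall x ρ.rOut).of_isClosed_subset (isClosed_tsupport _) hts

theorem hasFDerivAt_mollify {F : Type*} [NormedAddCommGroup F] [NormedSpace ℝ F]
    (ρ : ContDiffBump (0 : E d)) {g : E d → F}
    (hg : LocallyIntegrable g volume) (x : E d) :
    HasFDerivAt (mollify ρ g) (convolution (fderiv ℝ (ρ.normed volume)) g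
      ((lsmul ℝ ℝ).precompL (E d)) volume x) x :=
  HasCompactSupport.hasFDerivAt_convolution_left (μ := volume) (lsmul ℝ ℝ)
    (ρ.hasCompactSupport_normed (μ := volume)) ρ.contDiff_normed hg x

theorem contDiff_mollify {F : Type*} [NormedAddCommGroup F] [NormedSpace ℝ F]
    (ρ : ContDiffBump (0 : E d)) {g : E d → F}
    (hg : LocallyIntegrable g volume) :
    ContDiff ℝ ((⊤ : ℕ∞) : WithTop ℕ∞) (mollify ρ g) :=
  HasCompactSupport.contDiff_convolution_left (μ := volume) (lsmul ℝ ℝ)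
    (ρ.hasCompactSupport_normed (μ := volume)) ρ.contDiff_normed hg

theorem fderiv_mollify_apply {F : Type*} [NormedAddCommGroup F] [NormedSpace ℝ F]
    [CompleteSpace F] (ρ : ContDiffBump (0 : E d)) {g : E d → F}
    (hg : LocallyIntegrable g volume) (x v : E d) :
    fderiv ℝ (mollify ρ g) x v = ∫ t, fderiv ℝ (ρ.normed volume) t v • g (x - t) := by
  have hi : ConvolutionExistsAt (fderiv ℝ (ρ.normed volume)) g x
      ((lsmul ℝ ℝ : ℝ →L[ℝ] F →L[ℝ] F).precompL (E d)) volume :=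
    HasCompactSupport.convolutionExists_left (μ := volume) _
      ((ρ.hasCompactSupport_normed (μ := volume)).fderiv (𝕜 := ℝ))
      ((ρ.contDiff_normed (n := 1)).continuous_fderiv (by norm_num)) hg x
  rw [(hasFDerivAt_mollify ρ hg x).fderiv]
  exact ContinuousLinearMap.integral_apply hi.integrable v

theorem integrable_fderiv_normed_smul {F : Type*} [NormedAddCommGroup F] [NormedSpace ℝ F]
    (ρ : ContDiffBump (0 : E d)) {g : E d → F}
    (hg : LocallyIntegrable g volume) (x v : E d) :
    Integrable (fun t => fderiv ℝ (ρ.normed volume) t v • g (x - t)) volume :=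
  HasCompactSupport.convolutionExists_left (μ := volume) (lsmul ℝ ℝ)
    ((ρ.hasCompactSupport_normed (μ := volume)).fderiv_apply (𝕜 := ℝ) v)
    (((ρ.contDiff_normed (n := 1)).continuous_fderiv (by norm_num)).clm_apply continuous_const) hg x

/-- The gradient of a mollification is the mollification of the weak gradient. -/
theorem gradVec_mollify (ρ : ContDiffBump (0 : E d)) {U : Set (E d)} (hU : MeasurableSet U)
    {u : E d → E m} {Du : E d → Grad d m} (h : IsWeakGradient U u Du)
    (hu : LocallyIntegrable (U.indicator u) volume)
    (hDu : LocallyIntegrable (U.indicator Du) volume) {x : E d} (hx : closedBall x ρ.rOut ⊆ U) :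
    gradVec (mollify ρ (U.indicator u)) x = mollify ρ (U.indicator Du) x := by
  ext ⟨j, β⟩
  set e : E d := EuclideanSpace.single j 1
  have h1 : gradVec (mollify ρ (U.indicator u)) x (j, β) =
      ∫ y in U, u y β * fderiv ℝ (ρ.normed volume) (x - y) e := by
    rw [gradVec, gradOf_apply, fderiv_mollify_apply ρ hu]
    have := (EuclideanSpace.proj (𝕜 := ℝ) β).integral_comp_comm
      (integrable_fderiv_normed_smul ρ hu x e)
    refine this.symm.trans ?_
    rw [← integral_sub_left_eq_self _ volume x, ← integral_indicator hU]
    refine integral_congr_ae (ae_of_all _ fun y => ?_)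
    by_cases hy : y ∈ U <;> simp [hy, mul_comm]
  have h2 : mollify ρ (U.indicator Du) x (j, β) =
      ∫ y in U, Du y (j, β) * ρ.normed volume (x - y) := by
    rw [mollify_apply]
    have := (EuclideanSpace.proj (𝕜 := ℝ) (j, β)).integral_comp_comm
      (integrable_normed_smul ρ hDu x)
    refine this.symm.trans ?_
    rw [← integral_sub_left_eq_self _ volume x, ← integral_indicator hU]
    refine integral_congr_ae (ae_of_all _ fun y => ?_)
    by_cases hy : y ∈ U <;> simp [hy, mul_comm]
  have h3 := h _ (isTestFunction_reflect_normed ρ hx) j β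
  -- The reflection y ↦ x - y produces a sign, which cancels the sign in the definition of the weak
  -- gradient.
  have h4 : ∀ y, partialDeriv j (fun y => ρ.normed volume (x - y)) y =
      - fderiv ℝ (ρ.normed volume) (x - y) e := fun y => by
    have hd : DifferentiableAt ℝ (ρ.normed volume) (x - y) :=
      (ρ.contDiff_normed (n := 1)).differentiable (by norm_num) _
    have h5 := hd.hasFDerivAt.comp y ((hasFDerivAt_id y).const_sub x)
    have h6 : fderiv ℝ (fun y => ρ.normed volume (x - y)) y =
      (fderiv ℝ (ρ.normed volume) (x - y)).comp (-ContinuousLinearMap.id ℝ (E d)) := h5.fderiv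
    rw [partialDeriv, h6]
    simp [e]
  simp_rw [h4, mul_neg, integral_neg, neg_inj] at h3
  rw [h1, h2, h3]

theorem exists_bump (d : ℕ) {h : ℝ} (hh : 0 < h) : ∃ ρ : ContDiffBump (0 : E d), ρ.rOut < h :=
  ⟨⟨h / 4, h / 2, by positivity, by linarith⟩, by simp; linarith⟩

/-- Interior approximation of a weakly differentiable function by smooth ones. -/
theorem IsWeakGradient.exists_smooth_approx {U : Set (E d)} (hU : IsOpen U)
    {u : E d → E m} {Du : E d → Grad d m} (h : IsWeakGradient U u Du)
    (hu : MemLp u 2 (volume.restrict U)) (hDu : MemLp Du 2 (volume.restrict U))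
    {K : Set (E d)} (hK : IsCompact K) (hKU : K ⊆ U) {η : ℝ≥0∞} (hη : η ≠ 0) :
    ∃ w : E d → E m, ContDiff ℝ ((⊤ : ℕ∞) : WithTop ℕ∞) w ∧
      (Bornology.IsBounded U → HasCompactSupport w) ∧
      ∫⁻ x in K, ‖w x - u x‖ₑ ^ 2 ≤ η ∧ ∫⁻ x in K, ‖gradVec w x - Du x‖ₑ ^ 2 ≤ η := by
  have hu' : MemLp (U.indicator u) 2 volume := (memLp_indicator_iff_restrict hU.measurableSet).2 hu
  have hDu' : MemLp (U.indicator Du) 2 volume :=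
    (memLp_indicator_iff_restrict hU.measurableSet).2 hDu
  obtain ⟨h1, h10, H1⟩ := exists_mollify_close hu' hη
  obtain ⟨h2, h20, H2⟩ := exists_mollify_close hDu' hη
  -- Balls of radius r around points of K stay in U, so on K the mollified zero extension does not
  -- see the jump at the boundary of U.
  obtain ⟨r, r0, hr⟩ := hK.exists_cthickening_subset_open hU hKU
  obtain ⟨ρ, hρ⟩ := exists_bump d (lt_min (lt_min h10 h20) r0)
  have hlu := hu'.locallyIntegrable (by norm_num)
  have hlD := hDu'.locallyIntegrable (by norm_num)
  refine ⟨mollify ρ (U.indicator u), contDiff_mollify ρ hlu, fun hb => ?_, ?_, ?_⟩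
  · refine HasCompactSupport.convolution _ (ρ.hasCompactSupport_normed (μ := volume)) ?_
    exact HasCompactSupport.intro hb.isCompact_closure fun x hx =>
      indicator_of_notMem (fun h => hx (subset_closure h)) _
  · refine le_trans ?_ (H1 ρ (hρ.trans_le ((min_le_left _ _).trans (min_le_left _ _))))
    refine le_trans (setLIntegral_mono' hK.measurableSet fun x hx => ?_)
      (setLIntegral_le_lintegral K _)
    rw [indicator_of_mem (hKU hx)]
  · refine le_trans ?_ (H2 ρ (hρ.trans_le ((min_le_left _ _).trans (min_le_right _ _))))
    refine le_trans (setLIntegral_mono' hK.measurableSet fun x hx => ?_)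
      (setLIntegral_le_lintegral K _)
    rw [gradVec_mollify ρ hU.measurableSet h hlu hlD, indicator_of_mem (hKU hx)]
    refine (closedBall_subset_cthickening hx _).trans
      ((cthickening_mono ?_ K).trans hr)
    exact (hρ.trans_le (min_le_right _ _)).le

/-- A Lipschitz function has its a.e. gradient as weak gradient. -/
theorem isWeakGradient_of_lipschitz {u : E d → E m} {C : NNReal} (hu : LipschitzWith C u)
    {U : Set (E d)} : IsWeakGradient U u (gradVec u) := by
  intro φ hφ j β
  set e : E d := EuclideanSpace.single j 1
  have hφd : Differentiable ℝ φ := hφ.1.differentiable (by simp)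
  obtain ⟨D, hD⟩ : ∃ D, LipschitzWith D φ :=
    ContDiff.lipschitzWith_of_hasCompactSupport hφ.2.1 hφ.1 (by simp)
  let P : E m →L[ℝ] ℝ := EuclideanSpace.proj β
  have hub : LipschitzWith (‖P‖₊ * C) (fun x => u x β) := P.lipschitz.comp hu
  -- Integration by parts for line derivatives of Lipschitz functions; by Rademacher's theorem these
  -- agree a.e. with the entries of `gradVec u`.
  have key := hub.integral_lineDeriv_mul_eq (μ := volume) hD hφ.2.1 e
  have hs : ∀ (F : E d → ℝ), Function.support F ⊆ U → ∫ x in U, F x = ∫ x, F x :=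
    fun F hF => setIntegral_eq_integral_of_forall_compl_eq_zero fun x hx => by
      by_contra h; exact hx (hF h)
  have hsφ : Function.support φ ⊆ U := (subset_tsupport φ).trans hφ.2.2
  rw [hs, hs]
  · have e1 : ∫ x, u x β * partialDeriv j φ x = - ∫ x, lineDeriv ℝ φ x (-e) * u x β := by
      rw [← integral_neg]
      refine integral_congr_ae (ae_of_all _ fun x => ?_)
      simp only [(hφd x).lineDeriv_eq_fderiv, partialDeriv, map_neg, e]
      ring
    rw [e1, ← key, neg_inj]
    refine integral_congr_ae ?_
    filter_upwards [hu.ae_differentiableAt] with x hx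
    have hx' : HasFDerivAt (fun x => u x β)
      (P.comp (fderiv ℝ u x)) x := P.hasFDerivAt.comp x hx.hasFDerivAt
    rw [hx'.differentiableAt.lineDeriv_eq_fderiv, hx'.fderiv, gradVec, gradOf_apply]
    rfl
  · intro x hx
    refine hsφ fun h => hx ?_
    simp [h]
  · intro x hx
    have : partialDeriv j φ x ≠ 0 := fun h => hx (by simp [h])
    exact hφ.2.2 (tsupport_fderiv_subset ℝ (subset_tsupport _ fun h => this (by
      simp [partialDeriv, h])))

end Gradient

/-! ### Elements of H¹ and H¹₀ given by concrete functions. -/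

section SobolevElements

variable {d m : ℕ}

theorem eLpNorm_two_sq {α F : Type*} [MeasurableSpace α] {μ : Measure α} [NormedAddCommGroup F]
    (f : α → F) : eLpNorm f 2 μ ^ 2 = ∫⁻ x, ‖f x‖ₑ ^ 2 ∂μ := by
  rw [eLpNorm_eq_lintegral_rpow_enorm_toReal (by norm_num) (by norm_num),
    ← ENNReal.rpow_natCast, ← ENNReal.rpow_mul]
  norm_num

theorem IsWeakGradient.congr {U : Set (E d)} {u u' : E d → E m} {Du Du' : E d → Grad d m}
    (h : IsWeakGradient U u Du) (hu : u =ᵐ[volume.restrict U] u')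
    (hD : Du =ᵐ[volume.restrict U] Du') : IsWeakGradient U u' Du' := by
  intro φ hφ j β
  have h1 : ∫ x in U, u x β * partialDeriv j φ x = ∫ x in U, u' x β * partialDeriv j φ x :=
    integral_congr_ae (by filter_upwards [hu] with x hx; rw [hx])
  have h2 : ∫ x in U, Du x (j, β) * φ x = ∫ x in U, Du' x (j, β) * φ x :=
    integral_congr_ae (by filter_upwards [hD] with x hx; rw [hx])
  rw [← h1, ← h2, h φ hφ j β]

/-- A weakly differentiable function gives an element of `H¹`. -/
theorem exists_H1_of_isWeakGradient {U : Set (E d)} {u : E d → E m} {Du : E d → Grad d m}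
    (h : IsWeakGradient U u Du) (hu : MemLp u 2 (volume.restrict U))
    (hDu : MemLp Du 2 (volume.restrict U)) :
    ∃ v : H1 m U, H1.fn v =ᵐ[volume.restrict U] u ∧ H1.grad v =ᵐ[volume.restrict U] Du :=
  ⟨⟨WithLp.toLp 2 (hu.toLp u, hDu.toLp Du),
    h.congr hu.coeFn_toLp.symm hDu.coeFn_toLp.symm⟩, hu.coeFn_toLp, hDu.coeFn_toLp⟩

theorem H1.memLp_fn {U : Set (E d)} (v : H1 m U) : MemLp (H1.fn v) 2 (volume.restrict U) :=
  Lp.memLp _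

theorem H1.memLp_grad {U : Set (E d)} (v : H1 m U) : MemLp (H1.grad v) 2 (volume.restrict U) :=
  Lp.memLp _

theorem H1.isWeakGradient {U : Set (E d)} (v : H1 m U) :
    IsWeakGradient U (H1.fn v) (H1.grad v) := v.2

theorem H1.fn_sub {U : Set (E d)} (v w : H1 m U) :
    H1.fn (v - w) =ᵐ[volume.restrict U] fun x => H1.fn v x - H1.fn w x :=
  Lp.coeFn_sub v.1.fst w.1.fst

theorem H1.grad_sub {U : Set (E d)} (v w : H1 m U) :
    H1.grad (v - w) =ᵐ[volume.restrict U] fun x => H1.grad v x - H1.grad w x :=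
  Lp.coeFn_sub v.1.snd w.1.snd

theorem H1.fn_add {U : Set (E d)} (v w : H1 m U) :
    H1.fn (v + w) =ᵐ[volume.restrict U] fun x => H1.fn v x + H1.fn w x :=
  Lp.coeFn_add v.1.fst w.1.fst

theorem H1.enorm_sq {U : Set (E d)} (v : H1 m U) :
    ‖v‖ₑ ^ 2 = (∫⁻ x in U, ‖H1.fn v x‖ₑ ^ 2) + ∫⁻ x in U, ‖H1.grad v x‖ₑ ^ 2 := by
  have h1 : ‖v.1.fst‖ₑ ^ 2 = ∫⁻ x in U, ‖H1.fn v x‖ₑ ^ 2 := by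
    rw [Lp.enorm_def, eLpNorm_two_sq]; rfl
  have h2 : ‖v.1.snd‖ₑ ^ 2 = ∫⁻ x in U, ‖H1.grad v x‖ₑ ^ 2 := by
    rw [Lp.enorm_def, eLpNorm_two_sq]; rfl
  rw [← h1, ← h2, ← ofReal_norm, ← ofReal_norm, ← ofReal_norm,
    ← ENNReal.ofReal_pow (norm_nonneg _), ← ENNReal.ofReal_pow (norm_nonneg _),
    ← ENNReal.ofReal_pow (norm_nonneg _), ← ENNReal.ofReal_add (by positivity) (by positivity),
    ← WithLp.prod_norm_sq_eq_of_L2]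
  rfl

/-- The weak gradient is unique. -/
theorem IsWeakGradient.unique {U : Set (E d)} (hU : IsOpen U) {u : E d → E m}
    {Du Du' : E d → Grad d m} (h : IsWeakGradient U u Du) (h' : IsWeakGradient U u Du')
    (hDu : MemLp Du 2 (volume.restrict U)) (hDu' : MemLp Du' 2 (volume.restrict U)) :
    Du =ᵐ[volume.restrict U] Du' := by
  have key : ∀ p : Fin d × Fin m, ∀ᵐ x ∂volume.restrict U, Du x p - Du' x p = 0 := by
    rintro ⟨j, β⟩
    have hm : MemLp (fun x => Du x (j, β)) 2 (volume.restrict U) :=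
      (EuclideanSpace.proj (𝕜 := ℝ) (j, β)).comp_memLp' hDu
    have hm' : MemLp (fun x => Du' x (j, β)) 2 (volume.restrict U) :=
      (EuclideanSpace.proj (𝕜 := ℝ) (j, β)).comp_memLp' hDu'
    have hl : LocallyIntegrableOn (fun x => Du x (j, β) - Du' x (j, β)) U volume :=
      locallyIntegrableOn_of_locallyIntegrable_restrict
        ((hm.sub hm').locallyIntegrable (by norm_num))
    rw [ae_restrict_iff' hU.measurableSet]
    refine hU.ae_eq_zero_of_integral_contDiff_smul_eq_zero hl fun φ h1 h2 h3 => ?_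
    have hφ : IsTestFunction U φ := ⟨h1, h2, h3⟩
    have hφm : MemLp φ 2 (volume.restrict U) := h1.continuous.memLp_of_hasCompactSupport h2
    have e := (h φ hφ j β).symm.trans (h' φ hφ j β)
    have e2 : ∫ x, φ x • (Du x (j, β) - Du' x (j, β)) =
        ∫ x in U, φ x • (Du x (j, β) - Du' x (j, β)) := by
      refine (setIntegral_eq_integral_of_forall_compl_eq_zero fun x hx => ?_).symm
      rw [image_eq_zero_of_notMem_tsupport fun h => hx (h3 h), zero_smul]
    rw [e2]
    simp only [smul_eq_mul, mul_comm (φ _), sub_mul]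
    have e3 := integral_sub (hm.integrable_mul hφm) (hm'.integrable_mul hφm)
    simp only [Pi.mul_apply] at e3
    rw [e3]
    linarith
  have := ae_all_iff.2 key
  filter_upwards [this] with x hx
  ext p
  linarith [hx p]

theorem measurable_gradVec (u : E d → E m) : Measurable (gradVec u) :=
  (gradOf d m).continuous.measurable.comp (measurable_fderiv ℝ u)

theorem gradVec_eq_zero_of_notMem_tsupport {u : E d → E m} {x : E d} (hx : x ∉ tsupport u) :
    gradVec u x = 0 := by
  have : fderiv ℝ u x = 0 := by
    by_contra h
    exact hx (tsupport_fderiv_subset ℝ (subset_tsupport _ h))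
  rw [gradVec, this, map_zero]

theorem memLp_gradVec_of_lipschitz {u : E d → E m} {C : NNReal} (hu : LipschitzWith C u)
    (hc : HasCompactSupport u) : MemLp (gradVec u) 2 (volume : Measure (E d)) := by
  have hb : ∀ x, ‖gradVec u x‖ ≤ ‖gradOf d m‖ * C := fun x =>
    ((gradOf d m).le_opNorm _).trans (by gcongr; exact norm_fderiv_le_of_lipschitz ℝ hu)
  have : MemLp (gradVec u) 2 (volume.restrict (tsupport u)) := by
    have : IsFiniteMeasure (volume.restrict (tsupport u)) := ⟨by
      rw [Measure.restrict_apply_univ]; exact hc.measure_lt_top⟩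
    exact MemLp.of_bound (measurable_gradVec u).aestronglyMeasurable _ (ae_of_all _ hb)
  rw [← memLp_indicator_iff_restrict (isClosed_tsupport u).measurableSet] at this
  refine this.ae_eq (ae_of_all _ fun x => ?_)
  by_cases hx : x ∈ tsupport u
  · simp [hx]
  · simp [hx, gradVec_eq_zero_of_notMem_tsupport hx]

theorem mollify_gradVec {u : E d → E m} {C : NNReal} (hu : LipschitzWith C u)
    (hc : HasCompactSupport u) (ρ : ContDiffBump (0 : E d)) (x : E d) :
    gradVec (mollify ρ u) x = mollify ρ (gradVec u) x := by
  have h := gradVec_mollify ρ (MeasurableSet.univ) (isWeakGradient_of_lipschitz hu (U := univ))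
    (x := x) (by simpa using hu.continuous.locallyIntegrable)
    (by simpa using (memLp_gradVec_of_lipschitz hu hc).locallyIntegrable (by norm_num))
    (subset_univ _)
  simpa using h

theorem tsupport_mollify_subset {F : Type*} [NormedAddCommGroup F] [NormedSpace ℝ F]
    (ρ : ContDiffBump (0 : E d)) (u : E d → F) :
    tsupport (mollify ρ u) ⊆ cthickening ρ.rOut (tsupport u) := by
  refine closure_minimal (fun x hx => ?_) isClosed_cthickening
  by_contra h
  refine hx ?_
  rw [mollify_apply]
  refine integral_eq_zero_of_ae (ae_of_all _ fun t => ?_)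
  by_cases ht : ‖t‖ < ρ.rOut
  · have : u (x - t) = 0 := by
      by_contra h'
      refine h (mem_cthickening_of_dist_le x (x - t) _ _ (subset_tsupport _ h') ?_)
      simpa [dist_eq_norm] using ht.le
    simp [this]
  · have : ρ.normed volume t = 0 := by
      rw [← Function.notMem_support, ρ.support_normed_eq, mem_ball_zero_iff]
      exact ht
    simp [this]

/-- Lipschitz functions with compact support in `U` belong to `H¹₀(U)`. -/
theorem exists_H10_of_lipschitz {U : Set (E d)} (hU : IsOpen U) {φ : E d → E m} {C : NNReal}
    (hφ : LipschitzWith C φ) (hc : HasCompactSupport φ) (hs : tsupport φ ⊆ U) :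
    ∃ v ∈ H10 m U, H1.fn v =ᵐ[volume.restrict U] φ ∧
      H1.grad v =ᵐ[volume.restrict U] gradVec φ := by
  have hφ2 : MemLp φ 2 (volume : Measure (E d)) := hφ.continuous.memLp_of_hasCompactSupport hc
  have hg2 := memLp_gradVec_of_lipschitz hφ hc
  obtain ⟨v, hv1, hv2⟩ := exists_H1_of_isWeakGradient (isWeakGradient_of_lipschitz hφ (U := U))
    (hφ2.restrict U) (hg2.restrict U)
  refine ⟨v, ?_, hv1, hv2⟩
  rw [H10, ← SetLike.mem_coe, Submodule.topologicalClosure_coe, EMetric.mem_closure_iff]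
  intro ε hε
  obtain ⟨η, hη0, hη⟩ : ∃ η : ℝ≥0∞, η ≠ 0 ∧ η + η < ε ^ 2 := by
    obtain ⟨η, h1, h2⟩ := ENNReal.lt_iff_exists_nnreal_btwn.1
      (pos_iff_ne_zero.2 (pow_ne_zero 2 hε.ne') : 0 < ε ^ 2)
    refine ⟨η / 2, ?_, ?_⟩
    · simpa using h1.ne'
    · rwa [ENNReal.add_halves]
  obtain ⟨h1, h10, H1⟩ := exists_mollify_close hφ2 hη0
  obtain ⟨h2, h20, H2⟩ := exists_mollify_close hg2 hη0
  obtain ⟨r, r0, hr⟩ := (IsCompact.exists_cthickening_subset_open hc hU hs :)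
  obtain ⟨ρ, hρ⟩ := exists_bump d (lt_min (lt_min h10 h20) r0)
  have hts : tsupport (mollify ρ φ) ⊆ cthickening r (tsupport φ) :=
    (tsupport_mollify_subset ρ φ).trans
      (cthickening_mono (hρ.trans_le (min_le_right _ _)).le _)
  have hcw : HasCompactSupport (mollify ρ φ) :=
    -- The mollification is a test function in U, because the thickened support of φ still lies in
    -- U.
    (IsCompact.cthickening hc).of_isClosed_subset (isClosed_tsupport _) hts
  have hsm := contDiff_mollify ρ hφ.continuous.locallyIntegrable (g := φ)
  obtain ⟨D, hD⟩ := ContDiff.lipschitzWith_of_hasCompactSupport hcw hsm (by simp)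
  obtain ⟨w, hw1, hw2⟩ := exists_H1_of_isWeakGradient (isWeakGradient_of_lipschitz hD (U := U))
    ((hsm.continuous.memLp_of_hasCompactSupport hcw).restrict U)
    ((memLp_gradVec_of_lipschitz hD hcw).restrict U)
  refine ⟨w, Submodule.subset_span ⟨_, ⟨hsm, hcw, hts.trans hr⟩, hw1⟩, ?_⟩
  rw [edist_comm, edist_eq_enorm_sub]
  refine lt_of_pow_lt_pow_left' 2 (lt_of_le_of_lt ?_ hη)
  rw [HighContrast.H1.enorm_sq]
  refine add_le_add ?_ ?_
  · refine le_trans ?_ (H1 ρ (hρ.trans_le ((min_le_left _ _).trans (min_le_left _ _))))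
    refine le_trans (lintegral_mono_ae ?_) (setLIntegral_le_lintegral U _)
    filter_upwards [HighContrast.H1.fn_sub w v, hv1, hw1] with x h1 h2 h3
    rw [h1, h2, h3]
  · refine le_trans ?_ (H2 ρ (hρ.trans_le ((min_le_left _ _).trans (min_le_right _ _))))
    refine le_trans (lintegral_mono_ae ?_) (setLIntegral_le_lintegral U _)
    filter_upwards [HighContrast.H1.grad_sub w v, hv2, hw2] with x h1 h2 h3
    rw [h1, h2, h3, mollify_gradVec hφ hc]

end SobolevElements

/-! ### Friedrichs' inequality. -/

section Friedrichs

variable {d m : ℕ}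

theorem lipschitzWith_norm_sq {u : E d → E m} {C B : NNReal} (hu : LipschitzWith C u)
    (hB : ∀ x, ‖u x‖ ≤ B) : LipschitzWith (2 * B * C) fun x => ‖u x‖ ^ 2 := by
  refine LipschitzWith.of_dist_le_mul fun x y => ?_
  have h1 : |‖u x‖ - ‖u y‖| ≤ C * dist x y :=
    (abs_norm_sub_norm_le _ _).trans (by rw [← dist_eq_norm]; exact hu.dist_le_mul x y)
  rw [Real.dist_eq, sq_sub_sq, abs_mul, abs_of_nonneg (by positivity)]
  calc (‖u x‖ + ‖u y‖) * |‖u x‖ - ‖u y‖| ≤ (B + B) * (C * dist x y) := by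
        gcongr <;> exact hB _
    _ = _ := by push_cast; ring

/-- Friedrichs' inequality for compactly supported Lipschitz functions. -/
theorem lintegral_norm_sq_le_of_lipschitz (hd : 0 < d) {u : E d → E m} {C : NNReal}
    (hu : LipschitzWith C u) {x₀ : E d} {R : ℝ} (hs : ∀ x, x ∉ closedBall x₀ R → u x = 0) :
    ∫⁻ x, ‖u x‖ₑ ^ 2 ≤ ENNReal.ofReal (4 * R ^ 2) * ∫⁻ x, ‖fderiv ℝ u x‖ₑ ^ 2 := by
  have hts : tsupport u ⊆ closedBall x₀ R := closure_minimal (fun x hx => by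
    by_contra h; exact hx (hs x h)) isClosed_closedBall
  have hc : HasCompactSupport u :=
    (isCompact_closedBall x₀ R).of_isClosed_subset (isClosed_tsupport _) hts
  obtain ⟨B, hB⟩ : ∃ B : NNReal, ∀ x, ‖u x‖ ≤ B := by
    obtain ⟨B, hB⟩ := hu.continuous.bounded_above_of_compact_support hc
    exact ⟨⟨B, (norm_nonneg _).trans (hB x₀)⟩, hB⟩
  let e : E d := EuclideanSpace.single ⟨0, hd⟩ 1
  have he : ‖e‖ = 1 := by simp [e]
  -- A linear function with derivative 1 along e and modulus at most R on the ball. Integrating |u|²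
  -- = (∂ₑf)|u|² by parts moves the derivative onto |u|².
  let f : E d → ℝ := fun x => inner ℝ e (x - x₀)
  have hfd : ∀ x, HasFDerivAt f (innerSL ℝ e) x := fun x =>
    ((innerSL ℝ e).hasFDerivAt.comp x ((hasFDerivAt_id x).sub_const x₀))
  have hf : LipschitzWith 1 f := by
    refine LipschitzWith.of_dist_le_mul fun x y => ?_
    rw [Real.dist_eq, ← inner_sub_right, sub_sub_sub_cancel_right, dist_eq_norm, NNReal.coe_one,
      one_mul]
    exact (abs_real_inner_le_norm _ _).trans (by rw [he, one_mul])
  have hg := lipschitzWith_norm_sq hu hB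
  have hgc : HasCompactSupport fun x => ‖u x‖ ^ 2 := hc.norm.comp_left (g := fun t => t ^ 2) (by simp)
  have hfR : ∀ x ∈ closedBall x₀ R, |f x| ≤ R := fun x hx => by
    refine (abs_real_inner_le_norm _ _).trans ?_
    rw [he, one_mul, ← dist_eq_norm]; exact hx
  have key := hf.integral_lineDeriv_mul_eq (μ := volume) hg hgc e
  have hI1 : Integrable (fun x => ‖u x‖ ^ 2) volume :=
    hg.continuous.integrable_of_hasCompactSupport hgc
  have hI2 : Integrable (fun x => ‖fderiv ℝ u x‖ ^ 2) volume := by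
    have h0 : ∀ x, x ∉ closedBall x₀ R → ‖fderiv ℝ u x‖ ^ 2 = 0 := fun x hx => by
      have : fderiv ℝ u x = 0 := by
        by_contra h
        exact hx (hts (tsupport_fderiv_subset ℝ (subset_tsupport _ h)))
      simp [this]
    rw [← integrableOn_iff_integrable_of_support_subset (s := closedBall x₀ R)
      (fun x hx => by by_contra h; exact hx (h0 x h))]
    refine IntegrableOn.of_bound measure_closedBall_lt_top
      ((measurable_fderiv ℝ u).norm.pow_const 2).aestronglyMeasurable (C ^ 2)
      (ae_of_all _ fun x => ?_)
    rw [Real.norm_of_nonneg (by positivity)]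
    gcongr
    exact norm_fderiv_le_of_lipschitz ℝ hu
  -- Young's inequality 2R|u||Du| ≤ ½|u|² + 2R²|Du|²; absorbing ½|u|² yields the factor 4R².
  have hle : ∫ x, ‖u x‖ ^ 2 ≤ ∫ x, ((1 / 2) * ‖u x‖ ^ 2 + 2 * R ^ 2 * ‖fderiv ℝ u x‖ ^ 2) := by
    have e1 : ∀ x, lineDeriv ℝ f x e * ‖u x‖ ^ 2 = ‖u x‖ ^ 2 := fun x => by
      rw [(hfd x).differentiableAt.lineDeriv_eq_fderiv, (hfd x).fderiv, innerSL_apply_apply,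
        real_inner_self_eq_norm_sq, he]
      ring
    simp_rw [e1] at key
    rw [key]
    have hG : Integrable (fun x => (1 / 2) * ‖u x‖ ^ 2 + 2 * R ^ 2 * ‖fderiv ℝ u x‖ ^ 2) volume :=
      (hI1.const_mul _).add (hI2.const_mul _)
    by_cases hF : Integrable (fun x => lineDeriv ℝ (fun x => ‖u x‖ ^ 2) x (-e) * f x) volume
    · refine integral_mono_ae hF hG ?_
      filter_upwards [hu.ae_differentiableAt] with x hx
      have h1 : HasFDerivAt (fun x => ‖u x‖ ^ 2) (2 • (innerSL ℝ (u x)).comp (fderiv ℝ u x)) x :=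
        hx.hasFDerivAt.norm_sq
      rw [h1.differentiableAt.lineDeriv_eq_fderiv, h1.fderiv]
      by_cases hxR : x ∈ closedBall x₀ R
      · have h2 : |(2 • (innerSL ℝ (u x)).comp (fderiv ℝ u x)) (-e)| ≤
            2 * (‖u x‖ * ‖fderiv ℝ u x‖) := by
          simp only [map_neg, nsmul_eq_mul, abs_neg, FunLike.coe_smul, Pi.smul_apply, comp_apply,
            innerSL_apply_apply, Nat.cast_ofNat, abs_mul, abs_two]
          gcongr
          refine (abs_real_inner_le_norm _ _).trans ?_
          gcongr
          simpa [he] using (fderiv ℝ u x).le_opNorm e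
        refine (le_abs_self _).trans ?_
        rw [abs_mul]
        calc _ ≤ 2 * (‖u x‖ * ‖fderiv ℝ u x‖) * R := by
              gcongr
              exact hfR x hxR
          _ ≤ _ := by nlinarith [sq_nonneg (‖u x‖ - 2 * (R * ‖fderiv ℝ u x‖))]
      · have : (2 • (innerSL ℝ (u x)).comp (fderiv ℝ u x)) (-e) = 0 := by
          simp [hs x hxR]
        rw [this, zero_mul]
        positivity
    -- A non-integrable integrand has integral 0 by convention, and the right-hand side is
    -- nonnegative.
    · rw [integral_undef hF]
      exact integral_nonneg fun x => by positivity
  rw [integral_add (hI1.const_mul _) (hI2.const_mul _), integral_const_mul,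
    integral_const_mul] at hle
  have hle' : ∫ x, ‖u x‖ ^ 2 ≤ 4 * R ^ 2 * ∫ x, ‖fderiv ℝ u x‖ ^ 2 := by linarith
  have c1 : ∀ x, ‖u x‖ₑ ^ 2 = ENNReal.ofReal (‖u x‖ ^ 2) := fun x => by
    rw [← ofReal_norm, ENNReal.ofReal_pow (norm_nonneg _)]
  have c2 : ∀ x, ‖fderiv ℝ u x‖ₑ ^ 2 = ENNReal.ofReal (‖fderiv ℝ u x‖ ^ 2) := fun x => by
    rw [← ofReal_norm, ENNReal.ofReal_pow (norm_nonneg _)]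
  simp_rw [c1, c2]
  rw [← ofReal_integral_eq_lintegral_ofReal hI1 (ae_of_all _ fun x => by positivity),
    ← ofReal_integral_eq_lintegral_ofReal hI2 (ae_of_all _ fun x => by positivity),
    ← ENNReal.ofReal_mul (by positivity)]
  exact ENNReal.ofReal_le_ofReal hle'

theorem IsTestFunction.exists_lipschitz {U : Set (E d)} {φ : E d → E m}
    (h : IsTestFunction U φ) : ∃ C, LipschitzWith C φ :=
  ContDiff.lipschitzWith_of_hasCompactSupport h.2.1 h.1 (by simp)

/-- Friedrichs' inequality in `H¹₀` of a bounded open set. -/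
theorem exists_friedrichs_H10 (hd : 0 < d) (m : ℕ) {U : Set (E d)} (hU : IsOpen U)
    (hb : Bornology.IsBounded U) : ∃ C : ℝ, 0 < C ∧ ∀ v ∈ H10 m U,
      ∫⁻ x in U, ‖H1.fn v x‖ₑ ^ 2 ≤ ENNReal.ofReal C * ∫⁻ x in U, ‖H1.grad v x‖ₑ ^ 2 := by
  obtain ⟨c, hc1, hc⟩ := exists_gradOf_bounds d m
  obtain ⟨R, R0, hR⟩ := hb.subset_closedBall_lt 0 0
  have hC0 : 0 < 4 * R ^ 2 * c ^ 2 := by positivity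
  refine ⟨4 * R ^ 2 * c ^ 2, hC0, fun v hv => ?_⟩
  -- In terms of norms the inequality is a closed condition on H¹, so it passes from the span of the
  -- test functions to its closure.
  have hnorm : ∀ v : H1 m U, (∫⁻ x in U, ‖H1.fn v x‖ₑ ^ 2 ≤
      ENNReal.ofReal (4 * R ^ 2 * c ^ 2) * ∫⁻ x in U, ‖H1.grad v x‖ₑ ^ 2) ↔
      ‖v.1.fst‖ ≤ (2 * R * c) * ‖v.1.snd‖ := fun v => by
    have h1 : ∫⁻ x in U, ‖H1.fn v x‖ₑ ^ 2 = ENNReal.ofReal (‖v.1.fst‖ ^ 2) := by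
      rw [ENNReal.ofReal_pow (norm_nonneg _), ofReal_norm, Lp.enorm_def, eLpNorm_two_sq]; rfl
    have h2 : ∫⁻ x in U, ‖H1.grad v x‖ₑ ^ 2 = ENNReal.ofReal (‖v.1.snd‖ ^ 2) := by
      rw [ENNReal.ofReal_pow (norm_nonneg _), ofReal_norm, Lp.enorm_def, eLpNorm_two_sq]; rfl
    rw [h1, h2, ← ENNReal.ofReal_mul hC0.le, ENNReal.ofReal_le_ofReal_iff (by positivity),
      show 4 * R ^ 2 * c ^ 2 * ‖v.1.snd‖ ^ 2 = (2 * R * c * ‖v.1.snd‖) ^ 2 by ring,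
      pow_le_pow_iff_left₀ (by positivity) (by positivity) two_ne_zero]
  rw [hnorm]
  refine closure_minimal (t := {v : H1 m U | ‖v.1.fst‖ ≤ (2 * R * c) * ‖v.1.snd‖}) ?_ ?_ hv
  · intro v hv
    -- Test functions form a vector space, so every element of the span is itself represented by
    -- one.
    have hφ : ∃ φ : E d → E m, IsTestFunction U φ ∧ H1.fn v =ᵐ[volume.restrict U] φ := by
      refine Submodule.span_induction (p := fun v _ => ∃ φ : E d → E m, IsTestFunction U φ ∧
        H1.fn v =ᵐ[volume.restrict U] φ) (fun v h => h) ?_ ?_ ?_ hv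
      · refine ⟨fun _ => 0, ⟨contDiff_const, HasCompactSupport.zero, ?_⟩, Lp.coeFn_zero _ _ _⟩
        simp [tsupport]
      · rintro v w - - ⟨φ, ⟨a1, a2, a3⟩, h1⟩ ⟨ψ, ⟨b1, b2, b3⟩, h2⟩
        refine ⟨φ + ψ, ⟨a1.add b1, a2.add b2, (tsupport_add φ ψ).trans (union_subset a3 b3)⟩, ?_⟩
        filter_upwards [H1.fn_add v w, h1, h2] with x e1 e2 e3
        rw [e1, e2, e3, Pi.add_apply]
      · rintro a v - ⟨φ, ⟨a1, a2, a3⟩, h1⟩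
        refine ⟨fun x => a • φ x, ⟨a1.const_smul a, a2.smul_left (f := fun _ => a),
          (tsupport_smul_subset_right (fun _ => a) φ).trans a3⟩, ?_⟩
        have : H1.fn (a • v) =ᵐ[volume.restrict U] fun x => a • H1.fn v x :=
          Lp.coeFn_smul a v.1.fst
        filter_upwards [this, h1] with x e1 e2
        rw [e1, e2]
    obtain ⟨φ, hφ, hv'⟩ := hφ
    obtain ⟨D, hD⟩ := hφ.exists_lipschitz
    have hg : H1.grad v =ᵐ[volume.restrict U] gradVec φ :=
      IsWeakGradient.unique hU ((H1.isWeakGradient v).congr hv' (ae_eq_refl _))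
        (isWeakGradient_of_lipschitz hD) (H1.memLp_grad v)
        ((memLp_gradVec_of_lipschitz hD hφ.2.1).restrict U)
    change ‖v.1.fst‖ ≤ (2 * R * c) * ‖v.1.snd‖
    rw [← hnorm]
    have hz : ∀ x, x ∉ U → φ x = 0 := fun x hx =>
      image_eq_zero_of_notMem_tsupport fun h => hx (hφ.2.2 h)
    calc ∫⁻ x in U, ‖H1.fn v x‖ₑ ^ 2 = ∫⁻ x in U, ‖φ x‖ₑ ^ 2 :=
          lintegral_congr_ae (by filter_upwards [hv'] with x h; rw [h])
      _ ≤ ∫⁻ x, ‖φ x‖ₑ ^ 2 := setLIntegral_le_lintegral _ _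
      _ ≤ ENNReal.ofReal (4 * R ^ 2) * ∫⁻ x, ‖fderiv ℝ φ x‖ₑ ^ 2 :=
          lintegral_norm_sq_le_of_lipschitz hd hD fun x hx => hz x fun h => hx (hR h)
      _ = ENNReal.ofReal (4 * R ^ 2) * ∫⁻ x in U, ‖fderiv ℝ φ x‖ₑ ^ 2 := by
          rw [setLIntegral_eq_of_support_subset]
          intro x hx
          refine hφ.2.2 (tsupport_fderiv_subset ℝ (subset_tsupport _ fun h => hx ?_))
          simp only [h, ← ofReal_norm, norm_zero, ENNReal.ofReal_zero]
          norm_num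
      _ ≤ ENNReal.ofReal (4 * R ^ 2) * ∫⁻ x in U, ENNReal.ofReal (c ^ 2) * ‖gradVec φ x‖ₑ ^ 2 := by
          gcongr with x
          rw [ENNReal.ofReal_pow (by positivity), ← mul_pow]
          refine pow_le_pow_left' ?_ 2
          rw [← ofReal_norm, ← ofReal_norm, ← ENNReal.ofReal_mul (by positivity)]
          exact ENNReal.ofReal_le_ofReal (hc _).2
      _ = _ := by
          rw [lintegral_const_mul' _ _ ENNReal.ofReal_ne_top, ← mul_assoc,
            ← ENNReal.ofReal_mul (by positivity)]
          congr 1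
          exact lintegral_congr_ae (by filter_upwards [hg] with x h; rw [h])
  · have hc1 : Continuous fun v : H1 m U => v.1.fst :=
      (WithLp.continuous_fst _ _ _).comp continuous_subtype_val
    have hc2 : Continuous fun v : H1 m U => v.1.snd :=
      (WithLp.continuous_snd _ _ _).comp continuous_subtype_val
    exact isClosed_le hc1.norm (continuous_const.mul hc2.norm)

end Friedrichs

/-! ### Poincaré's inequality on balls. -/

section Poincare

variable {d m : ℕ}

theorem lintegral_comp_add_smul {f : E d → ℝ≥0∞} (hf : Measurable f) (a : E d) {t : ℝ}
    (ht : t ≠ 0) : ∫⁻ x, f (a + t • x) = ENNReal.ofReal |(t ^ d)⁻¹| * ∫⁻ x, f x := by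
  have h1 : ∫⁻ x, f (a + t • x) = ∫⁻ y, f (a + y) ∂(Measure.map (t • ·) (volume : Measure (E d))) :=
    (lintegral_map (hf.comp (measurable_const_add a)) (measurable_const_smul t)).symm
  rw [h1, Measure.map_addHaar_smul _ ht, lintegral_smul_measure, lintegral_add_left_eq_self f a,
    finrank_euclideanSpace_fin]
  rfl

/-- The fundamental theorem of calculus on the segment from y to x, followed by Cauchy–Schwarz in t.
-/
theorem enorm_sub_sq_le_lintegral {w : E d → E m} (hw : ContDiff ℝ 1 w) (x y : E d) :
    ‖w x - w y‖ₑ ^ 2 ≤ ‖x - y‖ₑ ^ 2 *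
      ∫⁻ t in Ioc (0 : ℝ) 1, ‖fderiv ℝ w (y + t • (x - y))‖ₑ ^ 2 := by
  have hc : Continuous fun t : ℝ => fderiv ℝ w (y + t • (x - y)) :=
    (hw.continuous_fderiv (by norm_num)).comp (by fun_prop)
  have hd : ∀ t ∈ uIcc (0 : ℝ) 1, HasDerivAt (fun t : ℝ => w (y + t • (x - y)))
      (fderiv ℝ w (y + t • (x - y)) (x - y)) t := fun t _ => by
    have h1 : HasDerivAt (fun t : ℝ => y + t • (x - y)) (x - y) t := by
      simpa using ((hasDerivAt_id t).smul_const (x - y)).const_add y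
    exact ((hw.differentiable (by norm_num)) _).hasFDerivAt.comp_hasDerivAt t h1
  have h2 := intervalIntegral.integral_eq_sub_of_hasDerivAt hd
    ((hc.clm_apply continuous_const).intervalIntegrable _ _)
  simp only [one_smul, add_sub_cancel, zero_smul, add_zero] at h2
  rw [← h2, intervalIntegral.integral_of_le zero_le_one]
  have h3 : ‖∫ t in Ioc (0 : ℝ) 1, fderiv ℝ w (y + t • (x - y)) (x - y)‖ₑ ≤
      ∫⁻ t in Ioc (0 : ℝ) 1, 1 * (‖fderiv ℝ w (y + t • (x - y))‖ₑ * ‖x - y‖ₑ) := by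
    refine (enorm_integral_le_lintegral_enorm _).trans (lintegral_mono fun t => ?_)
    rw [one_mul]
    exact ContinuousLinearMap.le_opENorm _ _
  refine (pow_le_pow_left' h3 2).trans ((lintegral_weight_mul_sq_le aemeasurable_const
    ((hc.enorm.measurable.mul_const _).aemeasurable)).trans ?_)
  simp only [one_mul, mul_pow]
  rw [lintegral_mul_const _ (hc.enorm.measurable.pow_const 2)]
  simp [mul_comm]

/-- Poincaré's inequality on a convex set for smooth functions, in double integral form. -/
theorem lintegral_lintegral_sub_sq_le {w : E d → E m} (hw : ContDiff ℝ 1 w) {B : Set (E d)}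
    (hB : Convex ℝ B) (hBm : MeasurableSet B) {D : ℝ}
    (hD : ∀ x ∈ B, ∀ y ∈ B, ‖x - y‖ ≤ D) :
    ∫⁻ x in B, ∫⁻ y in B, ‖w x - w y‖ₑ ^ 2 ≤
      ENNReal.ofReal (D ^ 2 * 2 ^ d) * volume B * ∫⁻ x in B, ‖fderiv ℝ w x‖ₑ ^ 2 := by
  set g : E d → ℝ≥0∞ := B.indicator fun x => ‖fderiv ℝ w x‖ₑ ^ 2 with hg
  have hcf : Continuous fun x => ‖fderiv ℝ w x‖ₑ ^ 2 :=
    (ENNReal.continuous_pow 2).comp (hw.continuous_fderiv (by norm_num)).enorm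
  have hgm : Measurable g := hcf.measurable.indicator hBm
  have hgi : ∫⁻ x, g x = ∫⁻ x in B, ‖fderiv ℝ w x‖ₑ ^ 2 := lintegral_indicator hBm _
  -- At the point tx + (1 - t)y one of the two coefficients is at least 1/2. Integrating first in
  -- the corresponding variable costs a Jacobian factor of at most 2^d, uniformly in t.
  have hone : ∀ t ∈ Ioc (0 : ℝ) 1, ∫⁻ x in B, ∫⁻ y in B, g (y + t • (x - y)) ≤
      ENNReal.ofReal (2 ^ d) * volume B * ∫⁻ x, g x := by
    have hh : ∀ s : ℝ, 1 / 2 ≤ s → ∀ a : E d, ∫⁻ x in B, g (a + s • x) ≤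
        ENNReal.ofReal (2 ^ d) * ∫⁻ x, g x := fun s hs a => by
      have hs0 : 0 < s := by linarith
      refine (setLIntegral_le_lintegral _ _).trans ?_
      rw [lintegral_comp_add_smul hgm a hs0.ne']
      gcongr
      rw [abs_of_pos (by positivity), ← inv_pow]
      gcongr
      rw [inv_le_comm₀ hs0 two_pos]
      linarith
    intro t ht
    by_cases h : 1 / 2 ≤ t
    · rw [lintegral_lintegral_swap]
      · calc ∫⁻ y in B, ∫⁻ x in B, g (y + t • (x - y))
            ≤ ∫⁻ y in B, ENNReal.ofReal (2 ^ d) * ∫⁻ x, g x := by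
              refine lintegral_mono fun y => ?_
              refine le_trans (le_of_eq (lintegral_congr fun x => ?_)) (hh t h (y - t • y))
              congr 1; module
          _ = _ := by rw [setLIntegral_const]; ring
      · exact (hgm.comp (by fun_prop)).aemeasurable
    · calc ∫⁻ x in B, ∫⁻ y in B, g (y + t • (x - y))
            ≤ ∫⁻ x in B, ENNReal.ofReal (2 ^ d) * ∫⁻ x, g x := by
              refine lintegral_mono fun x => ?_
              refine le_trans (le_of_eq (lintegral_congr fun y => ?_))
                (hh (1 - t) (by linarith) (t • x))
              congr 1; module
          _ = _ := by rw [setLIntegral_const]; ring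
  calc ∫⁻ x in B, ∫⁻ y in B, ‖w x - w y‖ₑ ^ 2
      ≤ ∫⁻ x in B, ∫⁻ y in B, ENNReal.ofReal (D ^ 2) *
          ∫⁻ t in Ioc (0 : ℝ) 1, g (y + t • (x - y)) := by
        refine setLIntegral_mono' hBm fun x hx => setLIntegral_mono' hBm fun y hy => ?_
        refine (enorm_sub_sq_le_lintegral hw x y).trans ?_
        gcongr ?_ * ?_
        · rw [← ofReal_norm, ← ENNReal.ofReal_pow (norm_nonneg _)]
          exact ENNReal.ofReal_le_ofReal (by gcongr; exact hD x hx y hy)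
        · refine setLIntegral_mono' measurableSet_Ioc fun t ht => ?_
          have : y + t • (x - y) ∈ B := by
            have := hB hy hx (a := 1 - t) (b := t) (by linarith [ht.2]) ht.1.le (by ring)
            convert this using 1; module
          rw [hg, indicator_of_mem this]
    _ = ENNReal.ofReal (D ^ 2) * ∫⁻ t in Ioc (0 : ℝ) 1, ∫⁻ x in B, ∫⁻ y in B,
          g (y + t • (x - y)) := by
        have hm3 : Measurable fun p : (E d × ℝ) × E d => g (p.2 + p.1.2 • (p.1.1 - p.2)) :=
          hgm.comp (by fun_prop)
        have hm4 : Measurable fun p : (E d × E d) × ℝ => g (p.1.2 + p.2 • (p.1.1 - p.1.2)) :=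
          hgm.comp (by fun_prop)
        have hm5 : Measurable fun p : E d × E d =>
            ∫⁻ t in Ioc (0 : ℝ) 1, g (p.2 + t • (p.1 - p.2)) := hm4.lintegral_prod_right'
        have hm6 : Measurable fun p : E d × ℝ => ∫⁻ y in B, g (y + p.2 • (p.1 - y)) :=
          hm3.lintegral_prod_right'
        rw [← lintegral_lintegral_swap (μ := volume.restrict B)
          (f := fun x t => ∫⁻ y in B, g (y + t • (x - y))) hm6.aemeasurable,
          ← lintegral_const_mul _ hm6.lintegral_prod_right']
        refine lintegral_congr fun x => ?_
        rw [lintegral_const_mul _ (f := fun y => ∫⁻ t in Ioc (0 : ℝ) 1, g (y + t • (x - y)))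
          (hm5.comp (measurable_const.prodMk measurable_id))]
        congr 1
        rw [lintegral_lintegral_swap]
        exact (hgm.comp (by fun_prop)).aemeasurable
    _ ≤ ENNReal.ofReal (D ^ 2) * ∫⁻ t in Ioc (0 : ℝ) 1,
          ENNReal.ofReal (2 ^ d) * volume B * ∫⁻ x, g x := by
        exact mul_le_mul' le_rfl (setLIntegral_mono' measurableSet_Ioc hone)
    _ = _ := by
        rw [setLIntegral_const, Real.volume_Ioc, hgi, ENNReal.ofReal_mul (by positivity)]
        simp
        ring

/-- The device by which approximation errors η are removed. K must be finite but may depend on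
everything except η. -/
theorem ennreal_le_of_forall_le_add_mul {a b K : ℝ≥0∞} (hK : K ≠ ∞)
    (h : ∀ η : ℝ≥0∞, η ≠ 0 → η ≠ ∞ → a ≤ b + K * η) : a ≤ b := by
  refine ENNReal.le_of_forall_pos_le_add fun ε hε _ => ?_
  have hK1 : K + 1 ≠ ∞ := by simpa using hK
  refine (h (ε / (K + 1)) ?_ ?_).trans ?_
  · exact ENNReal.div_ne_zero.2 ⟨by simpa using hε.ne', hK1⟩
  · exact ENNReal.div_ne_top (by simp) (by simp)
  · gcongr
    calc K * (ε / (K + 1)) ≤ (K + 1) * (ε / (K + 1)) := by gcongr; exact le_self_add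
      _ = ε := ENNReal.mul_div_cancel (by simp) hK1

theorem exists_enorm_bounds (d m : ℕ) : ∃ c : ℝ≥0∞, c ≠ 0 ∧ c ≠ ∞ ∧ ∀ L : E d →L[ℝ] E m,
    ‖gradOf d m L‖ₑ ^ 2 ≤ c * ‖L‖ₑ ^ 2 ∧ ‖L‖ₑ ^ 2 ≤ c * ‖gradOf d m L‖ₑ ^ 2 := by
  obtain ⟨c, hc1, hc⟩ := exists_gradOf_bounds d m
  have hc0 : 0 ≤ c := by linarith
  refine ⟨ENNReal.ofReal (c ^ 2), by simp; positivity, by simp, fun L => ?_⟩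
  simp only [← ofReal_norm]
  rw [← ENNReal.ofReal_pow (norm_nonneg _), ← ENNReal.ofReal_pow (norm_nonneg _),
    ← ENNReal.ofReal_mul (by positivity), ← ENNReal.ofReal_mul (by positivity), ← mul_pow,
    ← mul_pow]
  exact ⟨ENNReal.ofReal_le_ofReal (by gcongr; exact (hc L).1),
    ENNReal.ofReal_le_ofReal (by gcongr; exact (hc L).2)⟩

theorem memLp_two_of_continuous {F : Type*} [NormedAddCommGroup F] {u : E d → F}
    (hu : Continuous u) (x₀ : E d) (r : ℝ) : MemLp u 2 (volume.restrict (ball x₀ r)) := by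
  obtain ⟨B, hB⟩ := (isCompact_closedBall x₀ r).exists_bound_of_continuousOn hu.continuousOn
  have : IsFiniteMeasure (volume.restrict (ball x₀ r)) := ⟨by
    rw [Measure.restrict_apply_univ]; exact measure_ball_lt_top⟩
  refine MemLp.of_bound hu.aestronglyMeasurable B ?_
  exact (ae_restrict_iff' measurableSet_ball).2 (ae_of_all _ fun x hx =>
    hB x (ball_subset_closedBall hx))

theorem memLp_two_gradVec {u : E d → E m} {C : NNReal} (hu : LipschitzWith C u)
    (x₀ : E d) (r : ℝ) : MemLp (gradVec u) 2 (volume.restrict (ball x₀ r)) := by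
  have : IsFiniteMeasure (volume.restrict (ball x₀ r)) := ⟨by
    rw [Measure.restrict_apply_univ]; exact measure_ball_lt_top⟩
  refine MemLp.of_bound (measurable_gradVec u).aestronglyMeasurable (‖gradOf d m‖ * C)
    (ae_of_all _ fun x => ?_)
  exact ((gradOf d m).le_opNorm _).trans (by gcongr; exact norm_fderiv_le_of_lipschitz ℝ hu)

/-- The difference w x - w y is routed through w' x and w' y. This transfers the double-integral
Poincaré inequality from a smooth approximation w' to w; the two error terms are equal by symmetry
and give 8 = 4 + 4. -/
theorem lintegral_lintegral_sub_sq_le_add {w w' : E d → E m} (hmw : Measurable w)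
    (hmw' : Measurable w') (B : Set (E d)) :
    ∫⁻ x in B, ∫⁻ y in B, ‖w x - w y‖ₑ ^ 2 ≤ 8 * volume B * (∫⁻ x in B, ‖w' x - w x‖ₑ ^ 2) +
      4 * (∫⁻ x in B, ∫⁻ y in B, ‖w' x - w' y‖ₑ ^ 2) := by
  have m1 : Measurable fun x => ‖w' x - w x‖ₑ ^ 2 := (hmw'.sub hmw).enorm.pow_const 2
  have m2 : Measurable fun p : E d × E d => ‖w' p.1 - w' p.2‖ₑ ^ 2 :=
    ((hmw'.comp measurable_fst).sub (hmw'.comp measurable_snd)).enorm.pow_const 2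
  have m3 : ∀ x, Measurable fun y => ‖w' x - w' y‖ₑ ^ 2 := fun x =>
    (measurable_const.sub hmw').enorm.pow_const 2
  have m4 : Measurable fun x => ∫⁻ y in B, ‖w' x - w' y‖ₑ ^ 2 := m2.lintegral_prod_right'
  set J := ∫⁻ x in B, ‖w' x - w x‖ₑ ^ 2 with hJ
  have hp : ∀ x y, ‖w x - w y‖ₑ ^ 2 ≤ 4 * ‖w' x - w x‖ₑ ^ 2 + 4 * ‖w' x - w' y‖ₑ ^ 2 +
      4 * ‖w' y - w y‖ₑ ^ 2 := fun x y => by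
    have e1 := enorm_sub_sq_le ((w' x - w' y) + (w' y - w y)) (w' x - w x)
    have e2 := enorm_add_sq_le (w' x - w' y) (w' y - w y)
    have e3 : w' x - w' y + (w' y - w y) - (w' x - w x) = w x - w y := by abel
    rw [e3] at e1
    calc _ ≤ _ := e1
      _ ≤ 2 * (2 * ‖w' x - w' y‖ₑ ^ 2 + 2 * ‖w' y - w y‖ₑ ^ 2) + 4 * ‖w' x - w x‖ₑ ^ 2 := by
          gcongr
          norm_num
      _ = _ := by ring
  have e : ∀ x, ∫⁻ y in B, ‖w x - w y‖ₑ ^ 2 ≤ 4 * volume B * ‖w' x - w x‖ₑ ^ 2 +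
      4 * (∫⁻ y in B, ‖w' x - w' y‖ₑ ^ 2) + 4 * J := fun x => by
    refine (lintegral_mono fun y => hp x y).trans (le_of_eq ?_)
    rw [lintegral_add_right _ (m1.const_mul _), lintegral_add_left measurable_const,
      lintegral_const_mul _ m1, lintegral_const_mul _ (m3 x), setLIntegral_const, ← hJ]
    ring
  refine (lintegral_mono fun x => e x).trans (le_of_eq ?_)
  rw [lintegral_add_right _ measurable_const, lintegral_add_left (m1.const_mul _),
    lintegral_const_mul _ m1, lintegral_const_mul _ m4, setLIntegral_const, ← hJ]
  ring

/-- Poincaré's inequality for Lipschitz functions on a ball. -/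
theorem exists_poincare_ball (m : ℕ) (x₀ : E d) {r : ℝ} (hr : 0 < r) :
    ∃ C : ℝ≥0∞, C ≠ ∞ ∧ ∀ (w : E d → E m) (L : NNReal), LipschitzWith L w → ∃ c : E m,
      ∫⁻ x in ball x₀ r, ‖w x - c‖ₑ ^ 2 ≤ C * ∫⁻ x in ball x₀ r, ‖fderiv ℝ w x‖ₑ ^ 2 := by
  obtain ⟨k, k0, kt, hk⟩ := exists_enorm_bounds d m
  set B := ball x₀ r with hBdef
  set V := volume B with hV
  have hVt : V ≠ ∞ := measure_ball_lt_top.ne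
  have hV0 : V ≠ 0 := (measure_ball_pos _ _ hr).ne'
  set P := ENNReal.ofReal ((2 * r) ^ 2 * 2 ^ d) * V with hP
  have hPt : P ≠ ∞ := ENNReal.mul_ne_top ENNReal.ofReal_ne_top hVt
  refine ⟨V⁻¹ * (8 * P * k * k), ?_, fun w L hw => ?_⟩
  · finiteness
  have hmw : Measurable w := hw.continuous.measurable
  have hmg : Measurable fun x => ‖fderiv ℝ w x‖ₑ ^ 2 := (measurable_fderiv ℝ w).enorm.pow_const 2
  have hI : ∫⁻ x in B, ∫⁻ y in B, ‖w x - w y‖ₑ ^ 2 ≤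
      8 * P * k * k * ∫⁻ x in B, ‖fderiv ℝ w x‖ₑ ^ 2 := by
    refine ennreal_le_of_forall_le_add_mul (K := 8 * V + 8 * P * k) (by finiteness)
      fun η η0 _ => ?_
    -- Approximation takes place in the ball of twice the radius, where the closed ball of radius r
    -- is a compact subset.
    obtain ⟨w', hs, -, h1, h2⟩ := IsWeakGradient.exists_smooth_approx isOpen_ball
      (isWeakGradient_of_lipschitz hw (U := ball x₀ (2 * r)))
      (memLp_two_of_continuous hw.continuous _ _) (memLp_two_gradVec hw _ _)
      (isCompact_closedBall x₀ r) (closedBall_subset_ball (by linarith)) η0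
    have hmw' : Measurable w' := hs.continuous.measurable
    have hBK : B ⊆ closedBall x₀ r := ball_subset_closedBall
    have h1' := (lintegral_mono_set hBK).trans h1
    have h2' := (lintegral_mono_set hBK).trans h2
    have h3 := lintegral_lintegral_sub_sq_le (hs.of_le (by simp)) (convex_ball x₀ r)
      measurableSet_ball (D := 2 * r) (fun x hx y hy => by
        rw [← dist_eq_norm]
        exact (dist_triangle_right x y x₀).trans (by
          rw [mem_ball] at hx hy; linarith))
    have h4 : ∫⁻ x in B, ‖fderiv ℝ w' x‖ₑ ^ 2 ≤
        2 * k * η + 2 * k * k * ∫⁻ x in B, ‖fderiv ℝ w x‖ₑ ^ 2 := by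
      calc ∫⁻ x in B, ‖fderiv ℝ w' x‖ₑ ^ 2
          ≤ ∫⁻ x in B, (2 * k * ‖gradVec w' x - gradVec w x‖ₑ ^ 2 +
            2 * k * k * ‖fderiv ℝ w x‖ₑ ^ 2) := by
            refine lintegral_mono fun x => ?_
            have e := enorm_add_sq_le (gradVec w' x - gradVec w x) (gradVec w x)
            rw [sub_add_cancel] at e
            calc _ ≤ k * ‖gradVec w' x‖ₑ ^ 2 := (hk _).2
              _ ≤ k * (2 * ‖gradVec w' x - gradVec w x‖ₑ ^ 2 +
                  2 * (k * ‖fderiv ℝ w x‖ₑ ^ 2)) := by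
                  gcongr
                  exact e.trans (by gcongr; exact (hk _).1)
              _ = _ := by ring
        _ = 2 * k * (∫⁻ x in B, ‖gradVec w' x - gradVec w x‖ₑ ^ 2) +
            2 * k * k * ∫⁻ x in B, ‖fderiv ℝ w x‖ₑ ^ 2 := by
            have m1 : Measurable fun x => ‖gradVec w' x - gradVec w x‖ₑ ^ 2 :=
              ((measurable_gradVec w').sub (measurable_gradVec w)).enorm.pow_const 2
            rw [lintegral_add_right _ (hmg.const_mul _), lintegral_const_mul _ hmg,
              lintegral_const_mul _ m1]
        _ ≤ _ := by gcongr
    calc ∫⁻ x in B, ∫⁻ y in B, ‖w x - w y‖ₑ ^ 2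
        ≤ 8 * V * (∫⁻ x in B, ‖w' x - w x‖ₑ ^ 2) +
          4 * (∫⁻ x in B, ∫⁻ y in B, ‖w' x - w' y‖ₑ ^ 2) :=
          lintegral_lintegral_sub_sq_le_add hmw hmw' B
      _ ≤ 8 * V * η + 4 * (P * (2 * k * η + 2 * k * k * ∫⁻ x in B, ‖fderiv ℝ w x‖ₑ ^ 2)) := by
          gcongr
          exact h3.trans (by gcongr)
      _ = _ := by ring
  have hm : Measurable fun y => ∫⁻ x in B, ‖w x - w y‖ₑ ^ 2 :=
    Measurable.lintegral_prod_left' (f := fun p : E d × E d => ‖w p.1 - w p.2‖ₑ ^ 2)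
      (((hmw.comp measurable_fst).sub (hmw.comp measurable_snd)).enorm.pow_const 2)
  -- Some y has inner integral at most the average over the ball; the value w y is the constant, and
  -- averaging accounts for V⁻¹.
  obtain ⟨y, -, hy⟩ := exists_le_setLAverage (μ := volume) (s := B) hV0 hVt hm.aemeasurable
  refine ⟨w y, hy.trans ?_⟩
  rw [setLAverage_eq, ENNReal.div_eq_inv_mul, mul_assoc]
  gcongr
  refine le_trans (le_of_eq ?_) hI
  refine lintegral_congr fun x => lintegral_congr fun y => ?_
  rw [enorm_sub_rev]

end Poincare

/-! ### Unicoherence of simply connected spaces. -/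

section Unicoherence

/-- On A the continuous function g/(2π) takes values in the discrete set of integers. -/
theorem exists_const_of_circle_exp_eq_one {X : Type*} [TopologicalSpace X] {A : Set X}
    (hA : IsPreconnected A) {g : X → ℝ} (hg : ContinuousOn g A)
    (h1 : ∀ x ∈ A, Circle.exp (g x) = 1) : ∀ x ∈ A, ∀ y ∈ A, g x = g y := by
  have hT : DiscreteTopology (range ((↑) : ℤ → ℝ)) :=
    Int.isClosedEmbedding_coe_real.isEmbedding.toHomeomorph.symm.isEmbedding.discreteTopology
  obtain ⟨c, -, hc⟩ := hA.eqOn_const_of_mapsTo (f := fun x => g x / (2 * Real.pi))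
    (T := range ((↑) : ℤ → ℝ)) ⟨hT⟩ (hg.div_const _) (fun x hx => by
      obtain ⟨n, hn⟩ := Circle.exp_eq_one.1 (h1 x hx)
      exact ⟨n, by
        change (n : ℝ) = g x / (2 * Real.pi)
        rw [hn]; field_simp⟩) (range_nonempty _)
  intro x hx y hy
  have := (hc hx).trans (hc hy).symm
  have hpi := Real.pi_pos
  field_simp at this
  exact this

/-- Simply connected spaces are unicoherent. -/
theorem IsPreconnected.inter_of_simplyConnected {X : Type*} [TopologicalSpace X]
    [SimplyConnectedSpace X] [LocallyPathConnectedSpace X] [NormalSpace X] {A B : Set X}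
    (hA : IsPreconnected A) (hB : IsPreconnected B) (hAc : IsClosed A) (hBc : IsClosed B)
    (hAB : A ∪ B = univ) : IsPreconnected (A ∩ B) := by
  rw [isPreconnected_closed_iff]
  rintro t t' ht ht' hsub ⟨x, hx, hxt⟩ ⟨x', hx', hxt'⟩
  by_contra hne
  have hdisj : Disjoint (A ∩ B ∩ t) (A ∩ B ∩ t') := by
    rw [Set.disjoint_left]
    exact fun y hy hy' => hne ⟨y, hy.1, hy.2, hy'.2⟩
  -- A Urysohn function separates the two pieces of a supposed splitting of A ∩ B.
  obtain ⟨a, ha0, ha1, -⟩ := exists_continuous_zero_one_of_isClosed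
    ((hAc.inter hBc).inter ht) ((hAc.inter hBc).inter ht') hdisj
  classical
  have hz : ∀ y ∈ A ∩ B, Circle.exp (2 * Real.pi * a y) = 1 := fun y hy => by
    rcases hsub hy with h | h
    · rw [ha0 ⟨hy, h⟩]; simp
    · rw [ha1 ⟨hy, h⟩]; simp
  -- Both formulas give 1 on A ∩ B, where a is 0 or 1, so f is a continuous map to the circle.
  let f : X → Circle := fun y => if y ∈ A then Circle.exp (2 * Real.pi * a y) else 1
  have hfA : ∀ y ∈ A, f y = Circle.exp (2 * Real.pi * a y) := fun y hy => if_pos hy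
  have hfB : ∀ y ∈ B, f y = 1 := fun y hy => by
    by_cases h : y ∈ A
    · rw [hfA y h, hz y ⟨h, hy⟩]
    · exact if_neg h
  have hf : Continuous f := by
    rw [← continuousOn_univ, ← hAB]
    refine ContinuousOn.union_of_isClosed ?_ ?_ hAc hBc
    · refine ContinuousOn.congr (Continuous.continuousOn ?_) hfA
      exact Circle.exp.continuous.comp (continuous_const.mul a.continuous)
    · exact continuousOn_const.congr hfB
  obtain ⟨e₀, he₀⟩ : ∃ t, Circle.exp t = f x := ⟨_, Circle.exp_arg (f x)⟩
  -- Simple connectedness gives a real lift g of f. Then g - 2πa is constant on A and g is constant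
  -- on B; comparing x, where a = 0, with x', where a = 1, gives 2π = 0.
  obtain ⟨g, ⟨-, hg⟩, -⟩ := Circle.isCoveringMap_exp.existsUnique_continuousMap_lifts
    ⟨f, hf⟩ x e₀ he₀
  have hg' : ∀ y, Circle.exp (g y) = f y := fun y => congrFun hg y
  have hcA := exists_const_of_circle_exp_eq_one hA (g := fun y => g y - 2 * Real.pi * a y)
    (by fun_prop) (fun y hy => by rw [Circle.exp_sub, hg', hfA y hy, div_self']) x hx.1 x' hx'.1
  have hcB := exists_const_of_circle_exp_eq_one hB (g := fun y => g y)
    (by fun_prop) (fun y hy => by rw [hg', hfB y hy]) x hx.2 x' hx'.2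
  have e0 : a x = 0 := ha0 ⟨hx, hxt⟩
  have e1 : a x' = 1 := ha1 ⟨hx', hxt'⟩
  simp only [e0, e1] at hcA hcB
  have := Real.pi_pos
  linarith

end Unicoherence

/-! ### Lipschitz boundaries: null measure, exterior points, connectedness. -/

section LipschitzBoundary

variable {d : ℕ}

/-- The projection onto the hyperplane orthogonal to the unit vector `e`. -/
noncomputable def horiz (e y : E d) : E d := y - (inner ℝ e y : ℝ) • e

theorem horiz_add_smul {e : E d} (he : ‖e‖ = 1) (y : E d) (t : ℝ) :
    horiz e (y + t • e) = horiz e y := by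
  simp only [horiz, inner_add_right, inner_smul_right, real_inner_self_eq_norm_sq, he]
  module

theorem inner_add_smul_unit {e : E d} (he : ‖e‖ = 1) (y : E d) (t : ℝ) :
    (inner ℝ e (y + t • e) : ℝ) = inner ℝ e y + t := by
  simp only [inner_add_right, inner_smul_right, real_inner_self_eq_norm_sq, he]
  ring

theorem continuous_horiz (e : E d) : Continuous (horiz e) := by
  unfold horiz; fun_prop

/-- The translates of the graph along e are uncountably many disjoint sets of equal measure, and
only countably many of them can have positive measure. -/
theorem volume_graph_eq_zero {e : E d} (he : ‖e‖ = 1) {γ : E d → ℝ} (hγ : Continuous γ) :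
    volume {y : E d | γ (horiz e y) = inner ℝ e y} = 0 := by
  set S : ℝ → Set (E d) := fun t => {y : E d | γ (horiz e y) + t = inner ℝ e y} with hS
  have hm : ∀ t, MeasurableSet (S t) := fun t =>
    (isClosed_eq ((hγ.comp (continuous_horiz e)).add continuous_const)
      (by fun_prop)).measurableSet
  have hd : Pairwise (Function.onFun Disjoint S) := fun s t hst => by
    rw [Function.onFun, Set.disjoint_left]
    intro y h1 h2
    have h1' : γ (horiz e y) + s = inner ℝ e y := h1
    have h2' : γ (horiz e y) + t = inner ℝ e y := h2
    exact hst (by linarith)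
  have hv : ∀ t, volume (S t) = volume (S 0) := fun t => by
    have : S 0 = (fun y => y + t • e) ⁻¹' S t := by
      ext y
      change γ (horiz e y) + 0 = inner ℝ e y ↔
        γ (horiz e (y + t • e)) + t = inner ℝ e (y + t • e)
      rw [horiz_add_smul he, inner_add_smul_unit he, add_zero, add_left_inj]
    rw [this, measure_preimage_add_right]
  have hc := Measure.countable_meas_pos_of_disjoint_iUnion (μ := volume) hm hd
  have h0 : volume (S 0) = 0 := by
    by_contra h
    have : {t : ℝ | 0 < volume (S t)} = univ := by
      ext t
      simp only [hv, mem_univ, iff_true]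
      exact pos_iff_ne_zero.2 h
    rw [this] at hc
    exact not_countable_univ hc
  simpa [hS] using h0

/-- A local graph description of the boundary, with the chart ball inside a given set. -/
structure IsGraphChart (U : Set (E d)) (x e : E d) (γ : E d → ℝ) (K : NNReal) (r : ℝ) : Prop where
  norm_eq : ‖e‖ = 1
  lip : LipschitzWith K γ
  pos : 0 < r
  mem_iff : ∀ y ∈ ball x r, y ∈ U ↔ γ (horiz e y) < inner ℝ e y

theorem HasLipschitzBoundary.exists_chart {U : Set (E d)} (h : HasLipschitzBoundary U) {x : E d}
    (hx : x ∈ frontier U) : ∃ e γ K r, IsGraphChart U x e γ K r := by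
  obtain ⟨e, γ, K, r, h1, h2, h3, h4⟩ := h x hx
  exact ⟨e, γ, K, r, h1, h2, h3, h4⟩

theorem IsGraphChart.mono {U : Set (E d)} {x e : E d} {γ : E d → ℝ} {K : NNReal} {r r' : ℝ}
    (h : IsGraphChart U x e γ K r) (h0 : 0 < r') (hr : r' ≤ r) : IsGraphChart U x e γ K r' :=
  ⟨h.1, h.2, h0, fun y hy => h.4 y (ball_subset_ball hr hy)⟩

/-- The points of the chart strictly below the graph form an open set that misses U. -/
theorem IsGraphChart.notMem_closure {U : Set (E d)} {x e : E d} {γ : E d → ℝ} {K : NNReal}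
    {r : ℝ} (h : IsGraphChart U x e γ K r) {y : E d} (hy : y ∈ ball x r)
    (hlt : (inner ℝ e y : ℝ) < γ (horiz e y)) : y ∉ closure U := by
  rw [mem_closure_iff_nhds]
  push Not
  refine ⟨ball x r ∩ {z | (inner ℝ e z : ℝ) < γ (horiz e z)}, ?_, ?_⟩
  · refine (isOpen_ball.inter (isOpen_lt (by fun_prop)
      (h.lip.continuous.comp (continuous_horiz e)))).mem_nhds ⟨hy, hlt⟩
  · rw [← Set.not_nonempty_iff_eq_empty]
    rintro ⟨z, ⟨hz1, hz2⟩, hz3⟩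
    exact lt_asymm hz2 ((h.mem_iff z hz1).1 hz3)

theorem IsGraphChart.eq_of_mem_frontier {U : Set (E d)} (hU : IsOpen U) {x e : E d}
    {γ : E d → ℝ} {K : NNReal} {r : ℝ} (h : IsGraphChart U x e γ K r) {y : E d}
    (hy : y ∈ ball x r) (hf : y ∈ frontier U) : γ (horiz e y) = inner ℝ e y := by
  refine le_antisymm ?_ ?_
  · by_contra hlt
    exact h.notMem_closure hy (not_le.1 hlt) hf.1
  · by_contra hlt
    have := (h.mem_iff y hy).2 (not_le.1 hlt)
    rw [hU.frontier_eq] at hf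
    exact hf.2 this

/-- Needed because Λ vanishes on the boundary of D_ε: it equals δ or 1 only almost everywhere in Ω.
-/
theorem volume_frontier_eq_zero {U : Set (E d)} (hU : IsOpen U) (h : HasLipschitzBoundary U) :
    volume (frontier U) = 0 := by
  refine measure_null_of_locally_null _ fun x hx => ?_
  obtain ⟨e, γ, K, r, hc⟩ := h.exists_chart hx
  refine ⟨ball x r ∩ frontier U, ?_, ?_⟩
  · exact inter_mem (mem_nhdsWithin_of_mem_nhds (ball_mem_nhds x hc.pos)) self_mem_nhdsWithin
  · refine measure_mono_null (fun y hy => ?_) (volume_graph_eq_zero hc.norm_eq hc.lip.continuous)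
    exact hc.eq_of_mem_frontier hU hy.1 hy.2

/-- Boundary points of a Lipschitz domain are limits of exterior points. -/
theorem mem_closure_compl_closure {U : Set (E d)} (hU : IsOpen U) (h : HasLipschitzBoundary U)
    {x : E d} (hx : x ∈ frontier U) : x ∈ closure (closure U)ᶜ := by
  obtain ⟨e, γ, K, r, hc⟩ := h.exists_chart hx
  have hxe := hc.eq_of_mem_frontier hU (mem_ball_self hc.pos) hx
  rw [Metric.mem_closure_iff]
  intro s hs
  set t := min (s / 2) (r / 2)
  have ht : 0 < t := lt_min (by linarith) (by linarith [hc.pos])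
  have hdist : dist x (x + (-t) • e) = t := by
    rw [dist_eq_norm, sub_add_cancel_left, norm_neg, norm_smul, hc.norm_eq, mul_one, norm_neg,
      Real.norm_of_nonneg ht.le]
  refine ⟨x + (-t) • e, hc.notMem_closure ?_ ?_, ?_⟩
  · rw [mem_ball', hdist]
    exact (min_le_right _ _).trans_lt (by linarith [hc.pos])
  · rw [horiz_add_smul hc.norm_eq, inner_add_smul_unit hc.norm_eq, hxe]
    linarith
  · rw [hdist]
    exact (min_le_left _ _).trans_lt (by linarith)

theorem setDist_le {S T : Set (E d)} {x y : E d} (hx : x ∈ S) (hy : y ∈ T) :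
    setDist S T ≤ edist x y := iInf₂_le_of_le x hx (iInf₂_le y hy)

theorem isOpen_unitCell (d : ℕ) : IsOpen (unitCell d) := by
  have : unitCell d = ⋂ i, {y : E d | -(1 / 2 : ℝ) < y i} ∩ {y : E d | y i < 1 / 2} := by
    ext y; simp [unitCell]
  rw [this]
  refine isOpen_iInter_of_finite fun i => (isOpen_lt ?_ ?_).inter (isOpen_lt ?_ ?_) <;> fun_prop

theorem convex_unitCell (d : ℕ) : Convex ℝ (unitCell d) := by
  intro x hx y hy a b ha hb hab i
  have h1 := convex_Ioo (-(1 / 2 : ℝ)) (1 / 2) (x := x i) (y := y i)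
    ⟨(hx i).1, (hx i).2⟩ ⟨(hy i).1, (hy i).2⟩ ha hb hab
  simpa using h1

theorem notMem_closure_of_setDist_pos {S T : Set (E d)} (h : 0 < setDist S T) {x : E d}
    (hx : x ∈ T) : x ∉ closure S := fun hc => by
  obtain ⟨y, hy, hlt⟩ := EMetric.mem_closure_iff.1 hc _ h
  rw [edist_comm] at hlt
  exact absurd (setDist_le hy hx) (not_le.2 hlt)

theorem IsInclusion.closure_subset {ω : Set (E d)} (h : IsInclusion ω) :
    closure ω ⊆ unitCell d := by
  intro x hx
  by_contra hn
  refine notMem_closure_of_setDist_pos h.dist_pos (x := x) ?_ hx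
  rw [(isOpen_unitCell d).frontier_eq]
  exact ⟨closure_mono h.subset hx, hn⟩

/-- The boundary of an inclusion is connected. -/
theorem IsInclusion.isPreconnected_frontier {ω : Set (E d)} (h : IsInclusion ω) :
    IsPreconnected (frontier ω) := by
  have hsub := h.closure_subset
  have ho := h.domain.isOpen
  obtain ⟨y₀, hy₀⟩ := h.connected_compl.nonempty
  have : ContractibleSpace (unitCell d) :=
    (convex_unitCell d).contractibleSpace ⟨y₀, hy₀.1⟩
  have : LocallyPathConnectedSpace (unitCell d) := (isOpen_unitCell d).locallyPathConnectedSpace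
  -- Unicoherence is applied inside the contractible space Y to closure ω and Y ∖ ω, whose
  -- intersection is ∂ω.
  let A : Set (unitCell d) := (↑) ⁻¹' closure ω
  let B : Set (unitCell d) := (↑) ⁻¹' ωᶜ
  have hind : Topology.IsInducing ((↑) : unitCell d → E d) := Topology.IsInducing.subtypeVal
  have hA : IsPreconnected A := by
    rw [← hind.isPreconnected_image, Subtype.image_preimage_coe, inter_eq_right.2 hsub]
    exact h.domain.isConnected.isPreconnected.closure
  have hB : IsPreconnected B := by
    rw [← hind.isPreconnected_image, Subtype.image_preimage_coe]
    -- Y ∖ ω lies between the connected set Y ∖ closure ω and its closure, since boundary points are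
    -- limits of exterior points.
    refine h.connected_compl.isPreconnected.subset_closure ?_ ?_
    · exact fun y hy => ⟨hy.1, fun h => hy.2 (subset_closure h)⟩
    · rintro y ⟨hy, hyω⟩
      by_cases hc : y ∈ closure ω
      · have hf : y ∈ frontier ω := by rw [ho.frontier_eq]; exact ⟨hc, hyω⟩
        have := mem_closure_compl_closure ho h.domain.lipschitz hf
        rw [sdiff_eq]
        exact (isOpen_unitCell d).inter_closure ⟨hy, this⟩
      · exact subset_closure ⟨hy, hc⟩
  have hAB := IsPreconnected.inter_of_simplyConnected hA hB
    (isClosed_closure.preimage continuous_subtype_val)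
    (ho.isClosed_compl.preimage continuous_subtype_val) (by
      ext y
      simp only [A, B, mem_union, mem_preimage, mem_compl_iff, mem_univ, iff_true]
      by_cases hy : (y : E d) ∈ ω
      · exact Or.inl (subset_closure hy)
      · exact Or.inr hy)
  have e : ((↑) : unitCell d → E d) '' (A ∩ B) = frontier ω := by
    rw [← preimage_inter, Subtype.image_preimage_coe, ho.frontier_eq, sdiff_eq]
    exact inter_eq_right.2 (inter_subset_left.trans hsub)
  rw [← e]
  exact hAB.image _ continuous_subtype_val.continuousOn

end LipschitzBoundary

/-! ### Chaining local Poincaré inequalities along a connected set. -/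

section Chain

variable {d m : ℕ} {𝒰 : Type*}

theorem enorm_sub_sq_mul_le {w : E d → E m} (hw : Measurable w) (S : Set (E d)) (c c' : E m) :
    ‖c - c'‖ₑ ^ 2 * volume S ≤
      2 * (∫⁻ x in S, ‖w x - c‖ₑ ^ 2) + 2 * ∫⁻ x in S, ‖w x - c'‖ₑ ^ 2 := by
  have m1 : ∀ c : E m, Measurable fun x => ‖w x - c‖ₑ ^ 2 := fun c =>
    (hw.sub_const c).enorm.pow_const 2
  rw [← setLIntegral_const, ← lintegral_const_mul _ (m1 c), ← lintegral_const_mul _ (m1 c'),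
    ← lintegral_add_left ((m1 c).const_mul _)]
  refine lintegral_mono fun x => ?_
  have := enorm_sub_sq_le (w x - c') (w x - c)
  rw [sub_sub_sub_cancel_left] at this
  rw [add_comm]
  exact this

theorem lintegral_sub_sq_le_shift {w : E d → E m} (hw : Measurable w) (S : Set (E d)) (c c' : E m) :
    ∫⁻ x in S, ‖w x - c'‖ₑ ^ 2 ≤
      2 * (∫⁻ x in S, ‖w x - c‖ₑ ^ 2) + 2 * (‖c - c'‖ₑ ^ 2 * volume S) := by
  have m1 : Measurable fun x => ‖w x - c‖ₑ ^ 2 := (hw.sub_const c).enorm.pow_const 2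
  rw [← setLIntegral_const, ← lintegral_const_mul _ m1, ← lintegral_const_mul _ measurable_const,
    ← lintegral_add_left (m1.const_mul _)]
  refine lintegral_mono fun x => ?_
  have := enorm_add_sq_le (w x - c) (c - c')
  rwa [sub_add_sub_cancel] at this

/-- If `w` is close to `c` on `S` and to `c'` on `S`, then a function close to `c'` on `A` is
close to `c` on `A`. -/
theorem exists_const_transfer {en : 𝒰 → ℝ≥0∞} {w w₂ : 𝒰 → E d → E m}
    (hw : ∀ u, Measurable (w u)) (hw₂ : ∀ u, Measurable (w₂ u)) {S A : Set (E d)}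
    (hS0 : volume S ≠ 0) (hSt : volume S ≠ ∞) (hA : volume A ≠ ∞) {C₁ C₂ : ℝ≥0∞} (h1 : C₁ ≠ ∞)
    (h2 : C₂ ≠ ∞) : ∃ C : ℝ≥0∞, C ≠ ∞ ∧ ∀ u (c c' : E m),
      ∫⁻ x in S, ‖w u x - c‖ₑ ^ 2 ≤ C₁ * en u → ∫⁻ x in S, ‖w u x - c'‖ₑ ^ 2 ≤ C₂ * en u →
      ∫⁻ x in A, ‖w₂ u x - c'‖ₑ ^ 2 ≤ C₂ * en u → ∫⁻ x in A, ‖w₂ u x - c‖ₑ ^ 2 ≤ C * en u := by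
  refine ⟨2 * C₂ + 2 * ((volume S)⁻¹ * (2 * C₁ + 2 * C₂) * volume A), by finiteness,
    fun u c c' e1 e2 e3 => ?_⟩
  have k1 : ‖c - c'‖ₑ ^ 2 * volume S ≤ (2 * C₁ + 2 * C₂) * en u := by
    refine (enorm_sub_sq_mul_le (hw u) S c c').trans ?_
    calc _ ≤ 2 * (C₁ * en u) + 2 * (C₂ * en u) := by gcongr
      _ = _ := by ring
  have k2 : ‖c - c'‖ₑ ^ 2 ≤ (volume S)⁻¹ * ((2 * C₁ + 2 * C₂) * en u) := by
    rw [← ENNReal.div_eq_inv_mul]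
    exact (ENNReal.le_div_iff_mul_le (Or.inl hS0) (Or.inl hSt)).2 k1
  have k3 := lintegral_sub_sq_le_shift (hw₂ u) A c' c
  rw [enorm_sub_rev] at k3
  calc _ ≤ _ := k3
    _ ≤ 2 * (C₂ * en u) + 2 * ((volume S)⁻¹ * ((2 * C₁ + 2 * C₂) * en u) * volume A) := by gcongr
    _ = _ := by ring

/-- Local Poincaré inequalities along a connected set hold with a common constant. -/
theorem exists_common_const {K : Set (E d)} (hK : IsPreconnected K) {en : 𝒰 → ℝ≥0∞}
    {W : E d → 𝒰 → E d → E m} (hW : ∀ x ∈ K, ∀ u, Measurable (W x u)) {B : E d → Set (E d)}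
    (hB0 : ∀ x ∈ K, volume (B x) ≠ 0) (hBt : ∀ x ∈ K, volume (B x) ≠ ∞)
    (hloc : ∀ x ∈ K, ∃ C : ℝ≥0∞, C ≠ ∞ ∧ ∀ u, ∃ c : E m,
      ∫⁻ z in B x, ‖W x u z - c‖ₑ ^ 2 ≤ C * en u)
    (hover : ∀ x ∈ K, ∀ᶠ y in 𝓝[K] x, ∃ S ⊆ B x ∩ B y, MeasurableSet S ∧ volume S ≠ 0 ∧
      ∀ u, ∀ z ∈ S, W x u z = W y u z) (t : Finset (E d)) (ht : ↑t ⊆ K) :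
    ∃ C : ℝ≥0∞, C ≠ ∞ ∧ ∀ u, ∃ c : E m, ∀ x ∈ t,
      ∫⁻ z in B x, ‖W x u z - c‖ₑ ^ 2 ≤ C * en u := by
  -- P says that one vector c serves both balls, with a bound uniform in u. It holds for nearby
  -- points by the overlap S, and it is symmetric and transitive, so it holds throughout the
  -- preconnected set K. The function may vary with the ball; only agreement on S is needed.
  let P : E d → E d → Prop := fun x y => ∃ C : ℝ≥0∞, C ≠ ∞ ∧ ∀ u, ∃ c : E m,
    ∫⁻ z in B x, ‖W x u z - c‖ₑ ^ 2 ≤ C * en u ∧ ∫⁻ z in B y, ‖W y u z - c‖ₑ ^ 2 ≤ C * en u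
  have hP : ∀ x ∈ K, ∀ y ∈ K, P x y := by
    intro x hx y hy
    refine hK.induction₂ P ?_ ?_ ?_ hx hy
    · intro x hx
      filter_upwards [hover x hx, self_mem_nhdsWithin] with y ⟨S, hS, hSm, hS0, hSW⟩ hy
      obtain ⟨C₁, h1, H1⟩ := hloc x hx
      obtain ⟨C₂, h2, H2⟩ := hloc y hy
      have hSt : volume S ≠ ∞ := ((measure_mono (hS.trans inter_subset_left)).trans_lt
        (hBt x hx).lt_top).ne
      obtain ⟨C, hC, H⟩ := exists_const_transfer (en := en) (hW y hy) (hW y hy) hS0 hSt (hBt y hy)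
        h1 h2
      refine ⟨max C₁ C, (max_lt h1.lt_top hC.lt_top).ne, fun u => ?_⟩
      obtain ⟨c, hc⟩ := H1 u
      obtain ⟨c', hc'⟩ := H2 u
      have e1 : ∫⁻ z in S, ‖W y u z - c‖ₑ ^ 2 ≤ C₁ * en u := by
        refine le_trans (le_of_eq ?_) ((lintegral_mono_set (hS.trans inter_subset_left)).trans hc)
        exact setLIntegral_congr_fun hSm fun z hz => by simp only [hSW u z hz]
      exact ⟨c, hc.trans (by gcongr; exact le_max_left _ _),
        (H u c c' e1 ((lintegral_mono_set (hS.trans inter_subset_right)).trans hc') hc').trans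
          (by gcongr; exact le_max_right _ _)⟩
    · rintro x y z hx hy hz ⟨C₁, h1, H1⟩ ⟨C₂, h2, H2⟩
      obtain ⟨C, hC, H⟩ := exists_const_transfer (en := en) (hW y hy) (hW z hz) (hB0 y hy)
        (hBt y hy) (hBt z hz) h1 h2
      refine ⟨max C₁ C, (max_lt h1.lt_top hC.lt_top).ne, fun u => ?_⟩
      obtain ⟨c, hc1, hc2⟩ := H1 u
      obtain ⟨c', hc1', hc2'⟩ := H2 u
      exact ⟨c, hc1.trans (by gcongr; exact le_max_left _ _),
        (H u c c' hc2 hc1' hc2').trans (by gcongr; exact le_max_right _ _)⟩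
    · rintro x y - - ⟨C, hC, H⟩
      refine ⟨C, hC, fun u => ?_⟩
      obtain ⟨c, h1, h2⟩ := H u
      exact ⟨c, h2, h1⟩
  rcases t.eq_empty_or_nonempty with rfl | ⟨x₀, hx₀⟩
  · exact ⟨0, by simp, fun u => ⟨0, by simp⟩⟩
  have hx₀K := ht hx₀
  obtain ⟨C₁, h1, H1⟩ := hloc x₀ hx₀K
  -- P provides a vector that depends on x. By transfer, any vector good at x₀ is good at every x,
  -- so the one chosen at x₀ serves the whole finite set.
  have key : ∀ x ∈ K, ∃ C : ℝ≥0∞, C ≠ ∞ ∧ ∀ u (c : E m),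
      ∫⁻ z in B x₀, ‖W x₀ u z - c‖ₑ ^ 2 ≤ C₁ * en u →
      ∫⁻ z in B x, ‖W x u z - c‖ₑ ^ 2 ≤ C * en u := by
    intro x hx
    obtain ⟨C₂, h2, H2⟩ := hP x₀ hx₀K x hx
    obtain ⟨C, hC, H⟩ := exists_const_transfer (en := en) (hW x₀ hx₀K) (hW x hx) (hB0 x₀ hx₀K)
      (hBt x₀ hx₀K) (hBt x hx) h1 h2
    refine ⟨C, hC, fun u c hc => ?_⟩
    obtain ⟨c', e1, e2⟩ := H2 u
    exact H u c c' hc e1 e2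
  choose! C hC HC using key
  refine ⟨∑ x ∈ t, C x, (ENNReal.sum_lt_top.2 fun x hx => (hC x (ht hx)).lt_top).ne, fun u => ?_⟩
  obtain ⟨c, hc⟩ := H1 u
  refine ⟨c, fun x hx => (HC x (ht hx) u c hc).trans ?_⟩
  gcongr
  exact Finset.single_le_sum (f := C) (fun _ _ => zero_le) hx

end Chain

/-! ### Reflection and folding across a Lipschitz graph. -/

section Reflection

variable {d m : ℕ}

/-- The reflection across the graph of `γ` in the direction `e`. -/
noncomputable def graphReflect (e : E d) (γ : E d → ℝ) (y : E d) : E d :=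
  y + ((γ (horiz e y) - inner ℝ e y) + (γ (horiz e y) - inner ℝ e y)) • e

/-- The map folding the region above the graph of `γ` onto the region below. -/
noncomputable def graphFold (e : E d) (γ : E d → ℝ) (y : E d) : E d :=
  y + min 0 ((γ (horiz e y) - inner ℝ e y) + (γ (horiz e y) - inner ℝ e y)) • e

theorem exists_lipschitz_height (e : E d) {γ : E d → ℝ} {K : NNReal} (hγ : LipschitzWith K γ) :
    ∃ L, LipschitzWith L fun y : E d =>
      (γ (horiz e y) - inner ℝ e y) + (γ (horiz e y) - inner ℝ e y) := by
  have h1 : LipschitzWith _ (fun y : E d => (ContinuousLinearMap.id ℝ (E d) -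
      (innerSL ℝ e).smulRight e) y) := ContinuousLinearMap.lipschitz _
  have h2 : LipschitzWith _ (fun y : E d => innerSL ℝ e y) := ContinuousLinearMap.lipschitz _
  have h3 := (hγ.comp h1).sub h2
  exact ⟨_, h3.add h3⟩

theorem exists_lipschitz_graphReflect (e : E d) {γ : E d → ℝ} {K : NNReal}
    (hγ : LipschitzWith K γ) : ∃ L, LipschitzWith L (graphReflect e γ) := by
  obtain ⟨L, hL⟩ := exists_lipschitz_height e hγ
  exact ⟨_, LipschitzWith.id.add
    ((ContinuousLinearMap.lipschitz ((1 : ℝ →L[ℝ] ℝ).smulRight e)).comp hL)⟩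

theorem exists_lipschitz_graphFold (e : E d) {γ : E d → ℝ} {K : NNReal}
    (hγ : LipschitzWith K γ) : ∃ L, LipschitzWith L (graphFold e γ) := by
  obtain ⟨L, hL⟩ := exists_lipschitz_height e hγ
  exact ⟨_, LipschitzWith.id.add
    ((ContinuousLinearMap.lipschitz ((1 : ℝ →L[ℝ] ℝ).smulRight e)).comp (hL.const_min 0))⟩

theorem graphReflect_involutive {e : E d} (he : ‖e‖ = 1) (γ : E d → ℝ) :
    Function.Involutive (graphReflect e γ) := by
  intro y
  unfold graphReflect
  rw [horiz_add_smul he, inner_add_smul_unit he]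
  module

/-- For an involution the preimage is the image, and an L-Lipschitz map enlarges d-dimensional
Hausdorff measure, a multiple of which is Lebesgue measure, by at most L^d. No Jacobian is computed.
-/
theorem volume_preimage_le_of_involutive {R : E d → E d} {L : NNReal} (hR : LipschitzWith L R)
    (hi : Function.Involutive R) (S : Set (E d)) :
    volume (R ⁻¹' S) ≤ (L : ℝ≥0∞) ^ (d : ℝ) * volume S := by
  have hμ : (volume : Measure (E d)) = Measure.addHaarScalarFactor volume
      (Measure.hausdorffMeasure (Module.finrank ℝ (E d) : ℝ)) •
      Measure.hausdorffMeasure (Module.finrank ℝ (E d) : ℝ) :=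
    Measure.isAddLeftInvariant_eq_smul _ _
  rw [← Set.image_eq_preimage_of_inverse hi.leftInverse hi.rightInverse]
  have := hR.hausdorffMeasure_image_le (d := (Module.finrank ℝ (E d) : ℝ)) (by positivity) S
  rw [hμ, Measure.smul_apply, Measure.smul_apply, mul_smul_comm]
  have h3 : (L : ℝ≥0∞) ^ (d : ℝ) = (L : ℝ≥0∞) ^ (Module.finrank ℝ (E d) : ℝ) := by
    rw [finrank_euclideanSpace_fin]
  rw [h3]
  exact smul_le_smul_of_nonneg_left this zero_le

theorem lintegral_comp_le_of_involutive {R : E d → E d} {L : NNReal} (hR : LipschitzWith L R)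
    (hi : Function.Involutive R) {f : E d → ℝ≥0∞} (hf : Measurable f) :
    ∫⁻ y, f (R y) ≤ (L : ℝ≥0∞) ^ (d : ℝ) * ∫⁻ y, f y := by
  rw [← lintegral_map hf hR.continuous.measurable, ← smul_eq_mul, ← lintegral_smul_measure]
  refine lintegral_mono' (Measure.le_iff.2 fun S hS => ?_) le_rfl
  rw [Measure.map_apply hR.continuous.measurable hS]
  exact volume_preimage_le_of_involutive hR hi S

end Reflection

/-! ### Cutoffs, and extension in a boundary chart. -/

section Cutoff

variable {d m : ℕ}

theorem enorm_sum_sq_le {ι F : Type*} [NormedAddCommGroup F] (t : Finset ι) (v : ι → F) :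
    ‖∑ i ∈ t, v i‖ₑ ^ 2 ≤ t.card * ∑ i ∈ t, ‖v i‖ₑ ^ 2 := by
  have h1 : ‖∑ i ∈ t, v i‖ ^ 2 ≤ t.card * ∑ i ∈ t, ‖v i‖ ^ 2 :=
    (pow_le_pow_left₀ (norm_nonneg _) (norm_sum_le t v) 2).trans sq_sum_le_card_mul_sum_sq
  have h2 := ENNReal.ofReal_le_ofReal h1
  rw [ENNReal.ofReal_mul (by positivity), ENNReal.ofReal_sum_of_nonneg (fun _ _ => by positivity),
    ENNReal.ofReal_pow (norm_nonneg _), ofReal_norm, ENNReal.ofReal_natCast] at h2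
  simpa only [ENNReal.ofReal_pow (norm_nonneg _), ofReal_norm] using h2

/-- v may be unbounded: the difference is expanded around a point with ψ ≠ 0, so only the values of
v on the support of ψ enter. -/
theorem exists_lipschitz_smul {ψ : E d → ℝ} {v : E d → E m} {Lψ Lv : NNReal}
    (hψ : LipschitzWith Lψ ψ) (hc : HasCompactSupport ψ) (hv : LipschitzWith Lv v) :
    ∃ L, LipschitzWith L fun x => ψ x • v x := by
  obtain ⟨P, hP⟩ := hψ.continuous.bounded_above_of_compact_support hc
  obtain ⟨Q, hQ⟩ := (show IsCompact (tsupport ψ) from hc).exists_bound_of_continuousOn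
    hv.continuous.continuousOn
  have hP0 : 0 ≤ P := (norm_nonneg _).trans (hP 0)
  have key : ∀ x y, ψ x ≠ 0 → ‖ψ x • v x - ψ y • v y‖ ≤
      (Lψ * |Q| + P * Lv) * dist x y := fun x y hx => by
    have e : ψ x • v x - ψ y • v y = (ψ x - ψ y) • v x + ψ y • (v x - v y) := by
      module
    rw [e]
    refine (norm_add_le _ _).trans ?_
    rw [norm_smul, norm_smul, ← dist_eq_norm, ← dist_eq_norm]
    calc _ ≤ (Lψ * dist x y) * |Q| + P * (Lv * dist x y) := by
          gcongr
          · exact hψ.dist_le_mul x y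
          · exact (hQ x (subset_tsupport _ hx)).trans (le_abs_self _)
          · exact hP y
          · exact hv.dist_le_mul x y
      _ = _ := by ring
  refine ⟨(Lψ * |Q| + P * Lv).toNNReal, LipschitzWith.of_dist_le_mul fun x y => ?_⟩
  rw [dist_eq_norm, Real.coe_toNNReal _ (by positivity)]
  by_cases hx : ψ x = 0
  · by_cases hy : ψ y = 0
    · simp only [hx, hy, zero_smul, sub_zero, norm_zero]
      positivity
    · rw [norm_sub_rev, dist_comm]
      exact key y x hy
  · exact key x y hx

/-- Energy of a localized function. -/
theorem exists_lintegral_fderiv_smul_le {ψ : E d → ℝ}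
    (hψ : ContDiff ℝ ((⊤ : ℕ∞) : WithTop ℕ∞) ψ) (hc : HasCompactSupport ψ) {B : Set (E d)}
    (hB : tsupport ψ ⊆ B) : ∃ M : ℝ≥0∞, M ≠ ∞ ∧ ∀ (w : E d → E m) (L : NNReal),
      LipschitzWith L w → ∀ c : E m, (∃ L', LipschitzWith L' fun x => ψ x • (w x - c)) ∧
        ∫⁻ x, ‖fderiv ℝ (fun x => ψ x • (w x - c)) x‖ₑ ^ 2 ≤
          M * ((∫⁻ x in B, ‖fderiv ℝ w x‖ₑ ^ 2) + ∫⁻ x in B, ‖w x - c‖ₑ ^ 2) := by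
  obtain ⟨Lψ, hLψ⟩ := ContDiff.lipschitzWith_of_hasCompactSupport hc hψ (by simp)
  obtain ⟨P, hP⟩ := hLψ.continuous.bounded_above_of_compact_support hc
  have hP' : ∀ x, ‖ψ x‖ₑ ^ 2 ≤ ENNReal.ofReal P ^ 2 := fun x => by
    rw [← ofReal_norm]
    exact pow_le_pow_left' (ENNReal.ofReal_le_ofReal (hP x)) 2
  have hL' : ∀ x, ‖fderiv ℝ ψ x‖ₑ ^ 2 ≤ (Lψ : ℝ≥0∞) ^ 2 := fun x => by
    refine pow_le_pow_left' ?_ 2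
    rw [← ofReal_norm, ← ENNReal.ofReal_coe_nnreal]
    exact ENNReal.ofReal_le_ofReal (norm_fderiv_le_of_lipschitz ℝ hLψ)
  have hcB : MeasurableSet (tsupport ψ) := (isClosed_tsupport ψ).measurableSet
  refine ⟨2 * ENNReal.ofReal P ^ 2 + 2 * (Lψ : ℝ≥0∞) ^ 2, by finiteness, fun w L hw c => ?_⟩
  have hwc : LipschitzWith L fun x => w x - c := by
    simpa using hw.sub (LipschitzWith.const c)
  obtain ⟨L', hL''⟩ := exists_lipschitz_smul hLψ hc hwc
  refine ⟨⟨L', hL''⟩, ?_⟩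
  have m1 : Measurable fun x => ‖fderiv ℝ w x‖ₑ ^ 2 := (measurable_fderiv ℝ w).enorm.pow_const 2
  have hpt : ∀ᵐ x, ‖fderiv ℝ (fun x => ψ x • (w x - c)) x‖ₑ ^ 2 ≤
      (tsupport ψ).indicator (fun x => 2 * ENNReal.ofReal P ^ 2 * ‖fderiv ℝ w x‖ₑ ^ 2 +
        2 * (Lψ : ℝ≥0∞) ^ 2 * ‖w x - c‖ₑ ^ 2) x := by
    filter_upwards [hw.ae_differentiableAt] with x hx
    by_cases hxt : x ∈ tsupport ψ
    · rw [indicator_of_mem hxt]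
      have h1 := (hψ.differentiable (by simp) x).hasFDerivAt.fun_smul
        (hx.hasFDerivAt.sub_const c)
      rw [h1.fderiv]
      refine (enorm_add_sq_le _ _).trans ?_
      rw [enorm_smul, mul_pow]
      have h2 : ‖(fderiv ℝ ψ x).smulRight (w x - c)‖ₑ = ‖fderiv ℝ ψ x‖ₑ * ‖w x - c‖ₑ := by
        rw [← ofReal_norm, ← ofReal_norm, ← ofReal_norm, ← ENNReal.ofReal_mul (norm_nonneg _),
          ContinuousLinearMap.norm_smulRight_apply]
      rw [h2, mul_pow]
      calc _ ≤ 2 * (ENNReal.ofReal P ^ 2 * ‖fderiv ℝ w x‖ₑ ^ 2) +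
            2 * ((Lψ : ℝ≥0∞) ^ 2 * ‖w x - c‖ₑ ^ 2) := by
            exact add_le_add (mul_le_mul' le_rfl (mul_le_mul' (hP' x) le_rfl))
              (mul_le_mul' le_rfl (mul_le_mul' (hL' x) le_rfl))
        _ = _ := by ring
    · have : fderiv ℝ (fun x => ψ x • (w x - c)) x = 0 := by
        by_contra h
        exact hxt (tsupport_smul_subset_left ψ _ (tsupport_fderiv_subset ℝ (subset_tsupport _ h)))
      rw [this, ← ofReal_norm, norm_zero]
      simp
  calc _ ≤ _ := lintegral_mono_ae hpt
    _ = 2 * ENNReal.ofReal P ^ 2 * (∫⁻ x in tsupport ψ, ‖fderiv ℝ w x‖ₑ ^ 2) +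
        2 * (Lψ : ℝ≥0∞) ^ 2 * ∫⁻ x in tsupport ψ, ‖w x - c‖ₑ ^ 2 := by
        rw [lintegral_indicator hcB, lintegral_add_left (m1.const_mul _), lintegral_const_mul _ m1,
          lintegral_const_mul _ ((hwc.continuous.measurable).enorm.pow_const 2)]
    _ ≤ 2 * ENNReal.ofReal P ^ 2 * (∫⁻ x in B, ‖fderiv ℝ w x‖ₑ ^ 2) +
        2 * (Lψ : ℝ≥0∞) ^ 2 * ∫⁻ x in B, ‖w x - c‖ₑ ^ 2 := by
        gcongr
    _ ≤ (2 * ENNReal.ofReal P ^ 2 + 2 * (Lψ : ℝ≥0∞) ^ 2) * (∫⁻ x in B, ‖fderiv ℝ w x‖ₑ ^ 2) +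
        (2 * ENNReal.ofReal P ^ 2 + 2 * (Lψ : ℝ≥0∞) ^ 2) * ∫⁻ x in B, ‖w x - c‖ₑ ^ 2 := by
        gcongr
        · exact le_self_add
        · exact le_add_self
    _ = _ := by ring

/-- F need not be differentiable at x, so the chain rule is not available. Instead, u is k-Lipschitz
near F x for every k > |Du(F x)|, hence u ∘ F is locally kL-Lipschitz, and this bounds its
derivative. -/
theorem norm_fderiv_comp_le {u : E d → E m} {F : E d → E d} {L : NNReal}
    (hu : ContDiff ℝ 1 u) (hF : LipschitzWith L F) {x : E d}
    (hd : DifferentiableAt ℝ (fun y => u (F y)) x) :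
    ‖fderiv ℝ (fun y => u (F y)) x‖ ≤ L * ‖fderiv ℝ u (F x)‖ := by
  have hk : ∀ k : NNReal, ‖fderiv ℝ u (F x)‖₊ < k →
      ‖fderiv ℝ (fun y => u (F y)) x‖ ≤ L * k := fun k hk => by
    obtain ⟨s, hs, hLs⟩ := (hu.contDiffAt.hasStrictFDerivAt
      (by norm_num)).exists_lipschitzOnWith_of_nnnorm_lt k hk
    have h1 : LipschitzOnWith (k * L) (fun y => u (F y)) (F ⁻¹' s) :=
      hLs.comp hF.lipschitzOnWith (mapsTo_preimage F s)
    have := hd.hasFDerivAt.le_of_lipschitzOn (hF.continuous.continuousAt hs) h1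
    rw [mul_comm]
    exact_mod_cast this
  refine le_of_forall_pos_le_add fun ε hε => ?_
  have := hk (‖fderiv ℝ u (F x)‖₊ + (ε / (L + 1)).toNNReal)
    (lt_add_of_pos_right _ (Real.toNNReal_pos.2 (by positivity)))
  refine this.trans ?_
  rw [NNReal.coe_add, Real.coe_toNNReal _ (by positivity), coe_nnnorm, mul_add]
  gcongr
  rw [mul_div_assoc', div_le_iff₀ (by positivity)]
  nlinarith [L.coe_nonneg]

/-- In a boundary chart, folding extends functions from outside `U` with control of the energy. -/
theorem IsGraphChart.exists_fold (m : ℕ) {U : Set (E d)} (hU : IsOpen U) {x e : E d} {γ : E d → ℝ}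
    {K : NNReal} {r : ℝ} (h : IsGraphChart U x e γ K r) (hx : x ∈ frontier U) :
    ∃ (F : E d → E d) (L : NNReal) (s : ℝ) (C : ℝ≥0∞), LipschitzWith L F ∧ 0 < s ∧ C ≠ ∞ ∧
      (∀ y ∈ ball x s, y ∉ U → F y = y) ∧ ∀ (u : E d → E m) (Lu : NNReal), ContDiff ℝ 1 u →
        LipschitzWith Lu u → ∫⁻ y in ball x s, ‖fderiv ℝ (fun z => u (F z)) y‖ₑ ^ 2 ≤
          C * ∫⁻ y in ball x r \ U, ‖fderiv ℝ u y‖ₑ ^ 2 := by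
  obtain ⟨L, hL⟩ := exists_lipschitz_graphFold e h.lip
  obtain ⟨LR, hLR⟩ := exists_lipschitz_graphReflect e h.lip
  have hinv := graphReflect_involutive h.norm_eq γ
  have hxe := h.eq_of_mem_frontier hU (mem_ball_self h.pos) hx
  set F := graphFold e γ
  set R := graphReflect e γ
  -- F fixes x and is L-Lipschitz, so this radius keeps the image of the small ball within the chart
  -- ball.
  set s := r / (L + 1)
  have hs : 0 < s := div_pos h.pos (by positivity)
  have hsr : s ≤ r := div_le_self h.pos.le (by simp)
  have hFx : F x = x := by simp [F, graphFold, hxe]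
  have hFr : ∀ y ∈ ball x s, F y ∈ ball x r := fun y hy => by
    have h1 := hL.dist_le_mul y x
    rw [hFx] at h1
    rw [mem_ball] at hy ⊢
    calc dist (F y) x ≤ L * dist y x := h1
      _ ≤ L * s := by gcongr
      _ < (L + 1) * s := by nlinarith
      _ = r := by simp only [s]; field_simp
  have hout : ∀ y ∈ ball x s, y ∉ U → F y = y := fun y hy hyU => by
    have h1 : (inner ℝ e y : ℝ) ≤ γ (horiz e y) :=
      not_lt.1 fun h' => hyU ((h.mem_iff y (ball_subset_ball hsr hy)).2 h')
    simp only [F, graphFold]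
    rw [min_eq_left (by linarith), zero_smul, add_zero]
  have hin : ∀ y ∈ ball x s, y ∈ U → F y = R y ∧ F y ∉ U := fun y hy hyU => by
    have h1 := (h.mem_iff y (ball_subset_ball hsr hy)).1 hyU
    have h2 : F y = R y := by
      simp only [F, R, graphFold, graphReflect]
      rw [min_eq_right (by linarith)]
    refine ⟨h2, fun h3 => ?_⟩
    have h4 := (h.mem_iff _ (hFr y hy)).1 h3
    rw [h2] at h4
    simp only [R, graphReflect] at h4
    rw [horiz_add_smul h.norm_eq, inner_add_smul_unit h.norm_eq] at h4
    linarith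
  refine ⟨F, L, s, (L : ℝ≥0∞) ^ 2 * (1 + (LR : ℝ≥0∞) ^ (d : ℝ)), hL, hs, by finiteness,
    hout, fun u Lu hu hLu => ?_⟩
  set V := ball x r \ U
  have hV : MeasurableSet V := measurableSet_ball.diff hU.measurableSet
  set g : E d → ℝ≥0∞ := V.indicator fun y => ‖fderiv ℝ u y‖ₑ ^ 2 with hg
  have hgm : Measurable g := ((measurable_fderiv ℝ u).enorm.pow_const 2).indicator hV
  -- Outside U the fold is the identity, which gives the term g y; inside U it is the reflection to
  -- a point outside, which gives g (R y).
  have hpt : ∀ᵐ y, y ∈ ball x s → ‖fderiv ℝ (fun z => u (F z)) y‖ₑ ^ 2 ≤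
      (L : ℝ≥0∞) ^ 2 * (g y + g (R y)) := by
    filter_upwards [(hLu.comp hL).ae_differentiableAt] with y hd hy
    have h1 := norm_fderiv_comp_le hu hL hd
    have h2 : ‖fderiv ℝ (fun z => u (F z)) y‖ₑ ^ 2 ≤ (L : ℝ≥0∞) ^ 2 * ‖fderiv ℝ u (F y)‖ₑ ^ 2 := by
      rw [← mul_pow]
      refine pow_le_pow_left' ?_ 2
      rw [← ofReal_norm, ← ofReal_norm, ← ENNReal.ofReal_coe_nnreal,
        ← ENNReal.ofReal_mul (by positivity)]
      exact ENNReal.ofReal_le_ofReal h1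
    refine h2.trans ?_
    gcongr
    by_cases hyU : y ∈ U
    · obtain ⟨e1, e2⟩ := hin y hy hyU
      have h3 : R y ∈ V := by rw [← e1]; exact ⟨hFr y hy, e2⟩
      rw [hg, indicator_of_mem h3, ← e1]
      exact le_add_self
    · rw [hout y hy hyU, hg, indicator_of_mem (show y ∈ V from ⟨ball_subset_ball hsr hy, hyU⟩)]
      exact le_self_add
  calc _ ≤ ∫⁻ y in ball x s, (L : ℝ≥0∞) ^ 2 * (g y + g (R y)) :=
        lintegral_mono_ae ((ae_restrict_iff' measurableSet_ball).2 hpt)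
    _ ≤ ∫⁻ y, (L : ℝ≥0∞) ^ 2 * (g y + g (R y)) := setLIntegral_le_lintegral _ _
    _ = (L : ℝ≥0∞) ^ 2 * ((∫⁻ y, g y) + ∫⁻ y, g (R y)) := by
        rw [lintegral_const_mul' _ _ (by finiteness), lintegral_add_left hgm]
    _ ≤ (L : ℝ≥0∞) ^ 2 * ((∫⁻ y, g y) + (LR : ℝ≥0∞) ^ (d : ℝ) * ∫⁻ y, g y) := by
        gcongr
        exact lintegral_comp_le_of_involutive hLR hinv hgm
    _ = _ := by
        rw [hg, lintegral_indicator hV]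
        ring

end Cutoff

open scoped Manifold

/-! ### The two corrections for the model inclusion. -/

section UnitCell

variable {d : ℕ}

/-- The segment from x to y is connected, so it must cross the boundary of U. -/
theorem exists_dist_frontier_of_notMem {U : Set (E d)} (hU : IsOpen U) {x y : E d}
    (hx : x ∈ U) (hy : y ∉ U) : ∃ z ∈ frontier U, dist x z ≤ dist x y := by
  have hseg : IsPreconnected (segment ℝ x y) := (convex_segment x y).isPreconnected
  obtain ⟨z, hz, hzf⟩ : ∃ z ∈ segment ℝ x y, z ∈ frontier U := by
    by_contra! hne
    have hn : ∀ z ∈ segment ℝ x y, z ∉ U → z ∉ closure U := fun z hz hzU hzc =>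
      hne z hz (by rw [hU.frontier_eq]; exact ⟨hzc, hzU⟩)
    obtain ⟨z, -, hz1, hz2⟩ := hseg U (closure U)ᶜ hU isClosed_closure.isOpen_compl
      (fun z hz => by
        by_cases h : z ∈ U
        · exact Or.inl h
        · exact Or.inr (hn z hz h))
      ⟨x, left_mem_segment ℝ x y, hx⟩
      ⟨y, right_mem_segment ℝ x y, hn y (right_mem_segment ℝ x y) hy⟩
    exact hz2 (subset_closure hz1)
  refine ⟨z, hzf, ?_⟩
  have := dist_add_dist_of_mem_segment hz
  linarith [dist_nonneg (x := z) (y := y)]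

/-- A Lipschitz function vanishing on the boundary of `U` can be cut off outside `U`. -/
theorem LipschitzWith.indicator_of_frontier {F : Type*} [NormedAddCommGroup F] {U : Set (E d)}
    (hU : IsOpen U) {H : E d → F} {L : NNReal} (hH : LipschitzWith L H) (h0 : ∀ z ∈ frontier U, H z = 0) :
    LipschitzWith L (U.indicator H) := by
  have key : ∀ x y, x ∈ U → y ∉ U → ‖H x‖ ≤ L * dist x y := fun x y hx hy => by
    obtain ⟨z, hz, hzd⟩ := exists_dist_frontier_of_notMem hU hx hy
    have := hH.dist_le_mul x z
    rw [h0 z hz, dist_zero_right] at this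
    exact this.trans (by gcongr)
  refine LipschitzWith.of_dist_le_mul fun x y => ?_
  by_cases hx : x ∈ U <;> by_cases hy : y ∈ U
  · simpa [hx, hy] using hH.dist_le_mul x y
  · simpa [hx, hy] using key x y hx hy
  · simpa [hx, hy, dist_comm] using key y x hy hx
  · simp only [hx, hy, not_false_eq_true, indicator_of_notMem, dist_self]
    positivity

theorem exists_ball_subset {N : Set (E d)} (hN : IsOpen N) {x : E d} (hx : x ∈ N) :
    ∃ r > 0, ball x r ⊆ N := Metric.isOpen_iff.1 hN x hx

theorem exists_lipschitz_finset_sum {ι F : Type*} [NormedAddCommGroup F] {t : Finset ι}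
    {g : ι → E d → F} (h : ∀ i ∈ t, ∃ L, LipschitzWith L (g i)) :
    ∃ L, LipschitzWith L fun x => ∑ i ∈ t, g i x := by
  classical
  induction t using Finset.induction_on with
  | empty => exact ⟨0, by simp [LipschitzWith.const (0 : F)]⟩
  | insert a s ha ih =>
    obtain ⟨L, hL⟩ := ih fun i hi => h i (Finset.mem_insert_of_mem hi)
    obtain ⟨L', hL'⟩ := h a (Finset.mem_insert_self _ _)
    refine ⟨L' + L, ?_⟩
    simp_rw [Finset.sum_insert ha]
    exact hL'.add hL

/-- Change a function inside an inclusion so that its energy there is controlled by the energy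
outside. -/
theorem IsInclusion.exists_inner_correction (m : ℕ) {ω : Set (E d)} (hω : IsInclusion ω)
    {N : Set (E d)} (hN : IsOpen N) (hωN : closure ω ⊆ N) :
    ∃ C : ℝ≥0∞, C ≠ ∞ ∧ ∀ u : E d → E m, ContDiff ℝ ((⊤ : ℕ∞) : WithTop ℕ∞) u →
      HasCompactSupport u → ∃ (φ : E d → E m) (L : NNReal), LipschitzWith L φ ∧
        (∀ x ∉ ω, φ x = 0) ∧
        ∫⁻ x in ω, ‖fderiv ℝ (fun y => u y - φ y) x‖ₑ ^ 2 ≤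
          C * ∫⁻ x in N \ ω, ‖fderiv ℝ u x‖ₑ ^ 2 := by
  have ho := hω.domain.isOpen
  have hfc : IsCompact (frontier ω) :=
    (hω.domain.isBounded.isCompact_closure).of_isClosed_subset isClosed_frontier
      frontier_subset_closure
  -- Indexing the local estimates by all admissible u makes the chained constant uniform in u.
  let 𝒰 := {u : E d → E m // ContDiff ℝ ((⊤ : ℕ∞) : WithTop ℕ∞) u ∧ HasCompactSupport u}
  let en : 𝒰 → ℝ≥0∞ := fun u => ∫⁻ x in N \ ω, ‖fderiv ℝ u.1 x‖ₑ ^ 2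
  have hulip : ∀ u : 𝒰, ∃ L, LipschitzWith L u.1 := fun u =>
    ContDiff.lipschitzWith_of_hasCompactSupport u.2.2 u.2.1 (by simp)
  have hloc : ∀ x ∈ frontier ω, ∃ (F : E d → E d) (L : NNReal) (s : ℝ) (C : ℝ≥0∞),
      LipschitzWith L F ∧ 0 < s ∧ C ≠ ∞ ∧ (∀ y ∈ ball x s, y ∉ ω → F y = y) ∧ ∀ u : 𝒰,
        ∫⁻ y in ball x s, ‖fderiv ℝ (fun z => u.1 (F z)) y‖ₑ ^ 2 ≤ C * en u := fun x hx => by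
    obtain ⟨e, γ, K, r, hc⟩ := hω.domain.lipschitz.exists_chart hx
    obtain ⟨r', hr', hbN⟩ := exists_ball_subset hN (hωN (frontier_subset_closure hx))
    -- With the chart ball inside N, the folded function uses only energy of u in N ∖ ω.
    have hc' := hc.mono (r' := min r r') (lt_min hc.pos hr') (min_le_left _ _)
    obtain ⟨F, L, s, C, h1, h2, h3, h4, h5⟩ := hc'.exists_fold m ho hx
    refine ⟨F, L, s, C, h1, h2, h3, h4, fun u => ?_⟩
    obtain ⟨Lu, hLu⟩ := hulip u
    refine (h5 u.1 Lu (u.2.1.of_le (by simp)) hLu).trans ?_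
    exact mul_le_mul' le_rfl (lintegral_mono_set
      (sdiff_subset_sdiff_left ((ball_subset_ball (min_le_right _ _)).trans hbN)))
  choose! F L s C hF hs hC hFid hFen using hloc
  let W : E d → 𝒰 → E d → E m := fun x u z => u.1 (F x z)
  have hWlip : ∀ x ∈ frontier ω, ∀ u : 𝒰, ∃ L', LipschitzWith L' (W x u) := fun x hx u => by
    obtain ⟨Lu, hLu⟩ := hulip u
    exact ⟨_, hLu.comp (hF x hx)⟩
  have hpoin : ∀ x ∈ frontier ω, ∃ C' : ℝ≥0∞, C' ≠ ∞ ∧ ∀ u : 𝒰, ∃ c : E m,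
      ∫⁻ z in ball x (s x), ‖W x u z - c‖ₑ ^ 2 ≤ C' * en u := fun x hx => by
    obtain ⟨P, hP, hPo⟩ := exists_poincare_ball m x (hs x hx)
    refine ⟨P * C x, ENNReal.mul_ne_top hP (hC x hx), fun u => ?_⟩
    obtain ⟨L', hL'⟩ := hWlip x hx u
    obtain ⟨c, hc⟩ := hPo _ L' hL'
    refine ⟨c, hc.trans ?_⟩
    rw [mul_assoc]
    gcongr
    exact hFen x hx u
  obtain ⟨t, htc⟩ := hfc.elim_nhds_subcover' (fun x _ => ball x (s x))
    (fun x hx => ball_mem_nhds x (hs x hx))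
  classical
  let t' : Finset (E d) := t.image Subtype.val
  have ht'K : ∀ x ∈ t', x ∈ frontier ω := fun x hx => by
    obtain ⟨y, -, rfl⟩ := Finset.mem_image.1 hx
    exact y.2
  obtain ⟨Cp, hCp, hCommon⟩ := exists_common_const (m := m) hω.isPreconnected_frontier (en := en)
    (W := W) (B := fun x => ball x (s x))
    (fun x hx u => by
      obtain ⟨L', hL'⟩ := hWlip x hx u
      exact hL'.continuous.measurable)
    (fun x hx => (measure_ball_pos _ _ (hs x hx)).ne') (fun x _ => measure_ball_lt_top.ne) hpoin
    (fun x hx => by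
      have hb : ball x (s x) ∈ 𝓝[frontier ω] x :=
        mem_nhdsWithin_of_mem_nhds (ball_mem_nhds x (hs x hx))
      filter_upwards [hb, self_mem_nhdsWithin] with y hy hyf
      -- Two folds agree only outside ω, so the overlap must be taken there. It is nonempty because
      -- the boundary point y is a limit of exterior points.
      have hSo : IsOpen (ball x (s x) ∩ ball y (s y) ∩ (closure ω)ᶜ) :=
        (isOpen_ball.inter isOpen_ball).inter isClosed_closure.isOpen_compl
      refine ⟨_, inter_subset_left, hSo.measurableSet, ?_, ?_⟩
      · refine (hSo.measure_pos volume ?_).ne'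
        have h1 := (isOpen_ball.inter isOpen_ball).inter_closure
          (show y ∈ (ball x (s x) ∩ ball y (s y)) ∩ closure (closure ω)ᶜ from
            ⟨⟨hy, mem_ball_self (hs y hyf)⟩, mem_closure_compl_closure ho hω.domain.lipschitz hyf⟩)
        exact closure_nonempty_iff.1 ⟨y, h1⟩
      · rintro u z ⟨⟨h1, h2⟩, h3⟩
        have h4 : z ∉ ω := fun h => h3 (subset_closure h)
        change u.1 (F x z) = u.1 (F y z)
        rw [hFid x hx z h1 h4, hFid y hyf z h2 h4]) t' (fun x hx => ht'K x hx)
  obtain ⟨f, hf⟩ := SmoothPartitionOfUnity.exists_isSubordinate 𝓘(ℝ, E d)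
    (isClosed_frontier (s := ω)) (fun i : t' => ball (i : E d) (s i)) (fun i => isOpen_ball)
    (fun x hx => by
      obtain ⟨y, hy, hxy⟩ := mem_iUnion₂.1 (htc hx)
      exact mem_iUnion.2 ⟨⟨y, Finset.mem_image_of_mem _ hy⟩, hxy⟩)
  have hψs : ∀ i, ContDiff ℝ ((⊤ : ℕ∞) : WithTop ℕ∞) (f i) := fun i => (f i).contMDiff.contDiff
  have hψc : ∀ i, HasCompactSupport (f i) := fun i =>
    (isCompact_closedBall (i : E d) (s i)).of_isClosed_subset (isClosed_tsupport _)
      ((hf i).trans ball_subset_closedBall)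
  have hM := fun i => exists_lintegral_fderiv_smul_le (m := m) (hψs i) (hψc i) (hf i)
  choose M hMt hM using hM
  refine ⟨(Finset.univ : Finset t').card * ∑ i : t', M i * (C i + Cp), ?_, fun u hu huc => ?_⟩
  · refine ENNReal.mul_ne_top (by simp) (ENNReal.sum_lt_top.2 fun i _ => ?_).ne
    exact ENNReal.mul_lt_top (hMt i).lt_top
      (ENNReal.add_lt_top.2 ⟨(hC i (ht'K i i.2)).lt_top, hCp.lt_top⟩)
  let U : 𝒰 := ⟨u, hu, huc⟩
  obtain ⟨c, hc⟩ := hCommon U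
  let g : t' → E d → E m := fun i x => f i x • (W i U x - c)
  have hglip : ∀ i : t', ∃ L', LipschitzWith L' (g i) := fun i => by
    obtain ⟨L', hL'⟩ := hWlip i (ht'K i i.2) U
    exact (hM i _ L' hL' c).1
  have hgen : ∀ i : t', ∫⁻ x, ‖fderiv ℝ (g i) x‖ₑ ^ 2 ≤ M i * (C i + Cp) * en U := fun i => by
    obtain ⟨L', hL'⟩ := hWlip i (ht'K i i.2) U
    refine ((hM i _ L' hL' c).2).trans ?_
    rw [mul_assoc, add_mul]
    gcongr
    · exact hFen i (ht'K i i.2) U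
    · exact hc i i.2
  obtain ⟨LG, hLG⟩ := exists_lipschitz_finset_sum (t := Finset.univ) fun i _ => hglip i
  obtain ⟨Lu, hLu⟩ := hulip U
  -- On ∂ω every folded function equals u and the weights sum to 1, so H vanishes there and its
  -- cutoff to ω is Lipschitz. Taking φ = H on ω leaves u - φ = c + ∑ gᵢ, whose energy involves only
  -- values of u outside ω.
  set H : E d → E m := fun x => u x - c - ∑ i, g i x with hH
  have hHlip : ∃ L', LipschitzWith L' H :=
    ⟨_, (hLu.sub (LipschitzWith.const c)).sub hLG⟩
  obtain ⟨LH, hLH⟩ := hHlip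
  have hH0 : ∀ z ∈ frontier ω, H z = 0 := fun z hz => by
    have hzω : z ∉ ω := by rw [ho.frontier_eq] at hz; exact hz.2
    have h1 : ∀ i, g i z = f i z • (u z - c) := fun i => by
      by_cases h : f i z = 0
      · simp [g, h]
      · have : F i z = z := hFid i (ht'K i i.2) z (hf i (subset_tsupport _ h)) hzω
        simp only [g, W, U, this]
    have h2 : ∑ i, f i z = 1 := by
      rw [← finsum_eq_sum_of_fintype]; exact f.sum_eq_one hz
    simp only [hH, h1]
    rw [← Finset.sum_smul, h2, one_smul, sub_self]
  refine ⟨ω.indicator H, LH, LipschitzWith.indicator_of_frontier ho hLH hH0,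
    fun x hx => indicator_of_notMem hx _, ?_⟩
  have hdiff : ∀ᵐ x, ∀ i : t', DifferentiableAt ℝ (g i) x := by
    rw [ae_all_iff]
    intro i
    obtain ⟨L', hL'⟩ := hglip i
    exact hL'.ae_differentiableAt
  have hpt : ∀ᵐ x ∂(volume.restrict ω), ‖fderiv ℝ (fun y => u y - ω.indicator H y) x‖ₑ ^ 2 ≤
      (Finset.univ : Finset t').card * ∑ i, ‖fderiv ℝ (g i) x‖ₑ ^ 2 := by
    rw [ae_restrict_iff' ho.measurableSet]
    filter_upwards [hdiff] with x hx hxω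
    have h1 : (fun y => u y - ω.indicator H y) =ᶠ[𝓝 x] fun y => c + ∑ i, g i y := by
      filter_upwards [ho.mem_nhds hxω] with y hy
      rw [indicator_of_mem hy]
      change u y - (u y - c - ∑ i, g i y) = _
      rw [sub_sub, sub_sub_cancel]
    rw [h1.fderiv_eq, fderiv_const_add, fderiv_fun_sum fun i _ => hx i]
    exact enorm_sum_sq_le _ _
  have hmeas : ∀ i : t', Measurable fun x => ‖fderiv ℝ (g i) x‖ₑ ^ 2 := fun i =>
    (measurable_fderiv ℝ (g i)).enorm.pow_const 2
  calc _ ≤ _ := lintegral_mono_ae hpt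
    _ ≤ ∫⁻ x, (Finset.univ : Finset t').card * ∑ i, ‖fderiv ℝ (g i) x‖ₑ ^ 2 :=
        setLIntegral_le_lintegral _ _
    _ = (Finset.univ : Finset t').card * ∑ i, ∫⁻ x, ‖fderiv ℝ (g i) x‖ₑ ^ 2 := by
        rw [lintegral_const_mul _ (Finset.measurable_fun_sum _ fun i _ => hmeas i),
          lintegral_finsetSum _ fun i _ => hmeas i]
    _ ≤ (Finset.univ : Finset t').card * ∑ i : t', M i * (C i + Cp) * en U := by
        gcongr with i
        exact hgen i
    _ = _ := by rw [← Finset.sum_mul, mul_assoc]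

/-- Change a function near an inclusion so that only its gradient in the inclusion is kept. -/
theorem IsInclusion.exists_outer_correction (m : ℕ) {ω : Set (E d)} (hω : IsInclusion ω)
    {N : Set (E d)} (hN : IsOpen N) (hωN : closure ω ⊆ N) :
    ∃ C : ℝ≥0∞, C ≠ ∞ ∧ ∀ u : E d → E m, ContDiff ℝ ((⊤ : ℕ∞) : WithTop ℕ∞) u →
      HasCompactSupport u → ∃ (ψ : E d → E m) (L : NNReal), LipschitzWith L ψ ∧
        HasCompactSupport ψ ∧ tsupport ψ ⊆ N ∧
        (∀ x ∈ ω, fderiv ℝ ψ x = fderiv ℝ u x) ∧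
        ∫⁻ x, ‖fderiv ℝ ψ x‖ₑ ^ 2 ≤ C * ∫⁻ x in N, ‖fderiv ℝ u x‖ₑ ^ 2 := by
  have ho := hω.domain.isOpen
  have hK : IsCompact (closure ω) := hω.domain.isBounded.isCompact_closure
  let 𝒰 := {u : E d → E m // ContDiff ℝ ((⊤ : ℕ∞) : WithTop ℕ∞) u ∧ HasCompactSupport u}
  let en : 𝒰 → ℝ≥0∞ := fun u => ∫⁻ x in N, ‖fderiv ℝ u.1 x‖ₑ ^ 2
  have hulip : ∀ u : 𝒰, ∃ L, LipschitzWith L u.1 := fun u =>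
    ContDiff.lipschitzWith_of_hasCompactSupport u.2.2 u.2.1 (by simp)
  have hball : ∀ x ∈ closure ω, ∃ r > 0, ball x r ⊆ N := fun x hx =>
    exists_ball_subset hN (hωN hx)
  choose! s hs hsN using hball
  have hpoin : ∀ x ∈ closure ω, ∃ C' : ℝ≥0∞, C' ≠ ∞ ∧ ∀ u : 𝒰, ∃ c : E m,
      ∫⁻ z in ball x (s x), ‖u.1 z - c‖ₑ ^ 2 ≤ C' * en u := fun x hx => by
    obtain ⟨P, hP, hPo⟩ := exists_poincare_ball m x (hs x hx)
    refine ⟨P, hP, fun u => ?_⟩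
    obtain ⟨L', hL'⟩ := hulip u
    obtain ⟨c, hc⟩ := hPo _ L' hL'
    refine ⟨c, hc.trans ?_⟩
    exact mul_le_mul' le_rfl (lintegral_mono_set (hsN x hx))
  obtain ⟨t, htK, htc⟩ := hK.elim_nhds_subcover (fun x => ball x (s x))
    (fun x hx => ball_mem_nhds x (hs x hx))
  -- Nothing is folded here: the chain runs along the closure of ω with the same function on every
  -- ball.
  obtain ⟨Cp, hCp, hCommon⟩ := exists_common_const (m := m)
    hω.domain.isConnected.isPreconnected.closure (en := en)
    (W := fun _ u => u.1) (B := fun x => ball x (s x))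
    (fun x hx u => u.2.1.continuous.measurable)
    (fun x hx => (measure_ball_pos _ _ (hs x hx)).ne') (fun x _ => measure_ball_lt_top.ne) hpoin
    (fun x hx => by
      have hb : ball x (s x) ∈ 𝓝[closure ω] x :=
        mem_nhdsWithin_of_mem_nhds (ball_mem_nhds x (hs x hx))
      filter_upwards [hb, self_mem_nhdsWithin] with y hy hyf
      have hSo : IsOpen (ball x (s x) ∩ ball y (s y)) := isOpen_ball.inter isOpen_ball
      exact ⟨_, subset_rfl, hSo.measurableSet,
        (hSo.measure_pos volume ⟨y, hy, mem_ball_self (hs y hyf)⟩).ne', fun _ _ _ => rfl⟩)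
    t htK
  set V : Set (E d) := ⋃ x ∈ t, ball x (s x) with hV
  have hVo : IsOpen V := isOpen_biUnion fun _ _ => isOpen_ball
  have hVN : V ⊆ N := iUnion₂_subset fun x hx => hsN x (htK x hx)
  obtain ⟨δ, hδ, hδV⟩ := hK.exists_cthickening_subset_open hVo htc
  -- The correction is f (u - c): the cutoff f is 1 near closure ω, which keeps the gradient of u
  -- there, and Poincaré with the common c controls the cutoff term.
  obtain ⟨f, hf1, hf0, -⟩ := exists_contMDiffMap_one_nhds_of_subset_interior 
    (n := (⊤ : ℕ∞)) 𝓘(ℝ, E d) hK.isClosed (t := cthickening δ (closure ω))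
    ((self_subset_thickening hδ _).trans (isOpen_thickening.subset_interior_iff.2
      (thickening_subset_cthickening _ _)))
  have hfs : ContDiff ℝ ((⊤ : ℕ∞) : WithTop ℕ∞) f := f.contMDiff.contDiff
  have hft : tsupport f ⊆ cthickening δ (closure ω) := closure_minimal (fun x hx => by
    by_contra h; exact hx (hf0 x h)) isClosed_cthickening
  have hfc : HasCompactSupport f := hK.cthickening.of_isClosed_subset (isClosed_tsupport _) hft
  obtain ⟨M, hMt, hM⟩ := exists_lintegral_fderiv_smul_le (m := m) hfs hfc (hft.trans hδV)
  refine ⟨M * (1 + t.card * Cp), by finiteness, fun u hu huc => ?_⟩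
  let U : 𝒰 := ⟨u, hu, huc⟩
  obtain ⟨c, hc⟩ := hCommon U
  obtain ⟨Lu, hLu⟩ := hulip U
  obtain ⟨⟨L', hL'⟩, hen⟩ := hM u Lu hLu c
  have hsub : tsupport (fun x => f x • (u x - c)) ⊆ tsupport f := tsupport_smul_subset_left _ _
  refine ⟨_, L', hL', hfc.smul_right, hsub.trans (hft.trans (hδV.trans hVN)), fun x hx => ?_, ?_⟩
  · have h1 : ∀ᶠ y in 𝓝 x, f y = 1 :=
      (eventually_nhdsSet_iff_forall.1 hf1) x (subset_closure hx)
    have h2 : (fun x => f x • (u x - c)) =ᶠ[𝓝 x] fun x => u x - c := by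
      filter_upwards [h1] with y hy
      rw [hy, one_smul]
    rw [h2.fderiv_eq, fderiv_sub_const]
  · refine hen.trans ?_
    rw [mul_assoc, add_mul, one_mul]
    gcongr
    calc ∫⁻ x in V, ‖u x - c‖ₑ ^ 2 ≤ ∑ x ∈ t, ∫⁻ z in ball x (s x), ‖u z - c‖ₑ ^ 2 := by
          have hV' : V = ⋃ x : t, ball (x : E d) (s x) := by
            rw [hV]; exact biUnion_eq_iUnion (↑t) fun x _ => ball x (s x)
          rw [hV', ← Finset.sum_coe_sort]
          refine (lintegral_iUnion_le (fun x : t => ball (x : E d) (s x)) _).trans ?_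
          rw [tsum_fintype]
      _ ≤ ∑ x ∈ t, Cp * en U := Finset.sum_le_sum fun x hx => hc x hx
      _ = _ := by rw [Finset.sum_const, nsmul_eq_mul, mul_assoc]

end UnitCell

/-! ### Scaling to the cells of size ε. -/

section Cells

variable {d m : ℕ}

/-- The affine map of the unit cell onto the cell with index `n`. -/
noncomputable def cellMap (ε : ℝ) (n : Fin d → ℤ) (y : E d) : E d := ε • (latticePoint n + y)

/-- The inverse of `cellMap`. -/
noncomputable def cellMapInv (ε : ℝ) (n : Fin d → ℤ) (x : E d) : E d := ε⁻¹ • x - latticePoint n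

theorem cellMapInv_cellMap {ε : ℝ} (hε : 0 < ε) (n : Fin d → ℤ) (y : E d) :
    cellMapInv ε n (cellMap ε n y) = y := by
  rw [cellMapInv, cellMap, inv_smul_smul₀ hε.ne', add_sub_cancel_left]

theorem cellMap_cellMapInv {ε : ℝ} (hε : 0 < ε) (n : Fin d → ℤ) (x : E d) :
    cellMap ε n (cellMapInv ε n x) = x := by
  rw [cellMapInv, cellMap, add_sub_cancel, smul_inv_smul₀ hε.ne']

/-- `cellMap` as a homeomorphism. -/
noncomputable def cellHomeo {ε : ℝ} (hε : 0 < ε) (n : Fin d → ℤ) : E d ≃ₜ E d where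
  toFun := cellMap ε n
  invFun := cellMapInv ε n
  left_inv := cellMapInv_cellMap hε n
  right_inv := cellMap_cellMapInv hε n
  continuous_toFun := by unfold cellMap; fun_prop
  continuous_invFun := by unfold cellMapInv; fun_prop

theorem mem_cellInclusion {S : Set (E d)} {ε : ℝ} (hε : 0 < ε) {n : Fin d → ℤ} {x : E d} :
    x ∈ cellInclusion S ε n ↔ cellMapInv ε n x ∈ S := by
  constructor
  · rintro ⟨y, hy, rfl⟩
    exact (cellMapInv_cellMap hε n y).symm ▸ hy
  · exact fun h => ⟨_, h, cellMap_cellMapInv hε n x⟩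

theorem cellMap_mem_cellInclusion {S : Set (E d)} {ε : ℝ} (hε : 0 < ε) {n : Fin d → ℤ} {y : E d} :
    cellMap ε n y ∈ cellInclusion S ε n ↔ y ∈ S := by
  rw [mem_cellInclusion hε, cellMapInv_cellMap hε]

theorem isOpen_cellInclusion {S : Set (E d)} (hS : IsOpen S) {ε : ℝ} (hε : 0 < ε)
    (n : Fin d → ℤ) : IsOpen (cellInclusion S ε n) := (cellHomeo hε n).isOpen_image.2 hS

theorem isCompact_cellInclusion {S : Set (E d)} (hS : IsCompact S) {ε : ℝ} (hε : 0 < ε)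
    (n : Fin d → ℤ) : IsCompact (cellInclusion S ε n) :=
  hS.image (cellHomeo hε n).continuous

theorem closure_cellInclusion (S : Set (E d)) {ε : ℝ} (hε : 0 < ε) (n : Fin d → ℤ) :
    closure (cellInclusion S ε n) = cellInclusion (closure S) ε n :=
  ((cellHomeo hε n).image_closure S).symm

theorem dist_cellMap {ε : ℝ} (hε : 0 < ε) (n : Fin d → ℤ) (y z : E d) :
    dist (cellMap ε n y) (cellMap ε n z) = ε * dist y z := by
  rw [cellMap, cellMap, dist_smul₀, dist_add_left, Real.norm_of_nonneg hε.le]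

theorem disjoint_cellInclusion_unitCell {ε : ℝ} (hε : 0 < ε) {n n' : Fin d → ℤ} (h : n ≠ n') :
    Disjoint (cellInclusion (unitCell d) ε n) (cellInclusion (unitCell d) ε n') := by
  rw [Set.disjoint_left]
  intro x hx hx'
  rw [mem_cellInclusion hε] at hx hx'
  refine h (funext fun i => ?_)
  have h1 := hx i
  have h2 := hx' i
  simp only [cellMapInv, latticePoint, PiLp.sub_apply, PiLp.smul_apply, smul_eq_mul] at h1 h2
  have h3 : ((n i - n' i : ℤ) : ℝ) < 1 := by push_cast; linarith [h1.1, h2.2]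
  have h4 : ((n' i - n i : ℤ) : ℝ) < 1 := by push_cast; linarith [h1.2, h2.1]
  have h3' : n i - n' i < 1 := by exact_mod_cast h3
  have h4' : n' i - n i < 1 := by exact_mod_cast h4
  omega

theorem disjoint_cellInclusion {S S' : Set (E d)} (hS : S ⊆ unitCell d) (hS' : S' ⊆ unitCell d)
    {ε : ℝ} (hε : 0 < ε) {n n' : Fin d → ℤ} (h : n ≠ n') :
    Disjoint (cellInclusion S ε n) (cellInclusion S' ε n') :=
  (disjoint_cellInclusion_unitCell hε h).mono (image_mono hS) (image_mono hS')

/-- One factor k, depending on ε but not on n, S or f. It cancels in scale-invariant inequalities,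
so only k ≠ 0 and k ≠ ∞ are recorded. -/
theorem exists_scale_lintegral {ε : ℝ} (hε : 0 < ε) : ∃ k : ℝ≥0∞, k ≠ 0 ∧ k ≠ ∞ ∧
    ∀ (n : Fin d → ℤ) (S : Set (E d)), MeasurableSet S → ∀ f : E d → ℝ≥0∞, Measurable f →
      ∫⁻ y in S, f (cellMap ε n y) = k * ∫⁻ x in cellInclusion S ε n, f x := by
  refine ⟨ENNReal.ofReal |(ε ^ d)⁻¹|, by simp; positivity, by simp, fun n S hS f hf => ?_⟩
  have hSm : MeasurableSet (cellInclusion S ε n) :=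
    (cellHomeo hε n).measurableEmbedding.measurableSet_image.2 hS
  rw [← lintegral_indicator hS, ← lintegral_indicator hSm,
    ← lintegral_comp_add_smul (hf.indicator hSm) (ε • latticePoint n) hε.ne']
  refine lintegral_congr fun y => ?_
  have e : ε • latticePoint n + ε • y = cellMap ε n y := by rw [cellMap, smul_add]
  rw [e]
  by_cases hy : y ∈ S
  · rw [indicator_of_mem hy, indicator_of_mem ((cellMap_mem_cellInclusion hε).2 hy)]
  · rw [indicator_of_notMem hy,
      indicator_of_notMem (fun h => hy ((cellMap_mem_cellInclusion hε).1 h))]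

theorem fderiv_comp_cellMap (h : E d → E m) (ε : ℝ) (n : Fin d → ℤ) (y : E d) :
    fderiv ℝ (fun y => h (cellMap ε n y)) y = ε • fderiv ℝ h (cellMap ε n y) := by
  have h1 := fderiv_comp_add_left (𝕜 := ℝ) (f := fun z => h (ε • z)) (x := y) (latticePoint n)
  have h2 := fderiv_comp_smul (𝕜 := ℝ) (f := h) (x := latticePoint n + y) ε
  exact h1.trans h2

theorem lintegral_fderiv_comp_cellMap {ε : ℝ} {k : ℝ≥0∞}
    (hk : ∀ (n : Fin d → ℤ) (S : Set (E d)), MeasurableSet S → ∀ f : E d → ℝ≥0∞, Measurable f →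
      ∫⁻ y in S, f (cellMap ε n y) = k * ∫⁻ x in cellInclusion S ε n, f x)
    (h : E d → E m) (n : Fin d → ℤ) {S : Set (E d)} (hS : MeasurableSet S) :
    ∫⁻ y in S, ‖fderiv ℝ (fun y => h (cellMap ε n y)) y‖ₑ ^ 2 =
      (‖ε‖ₑ ^ 2 * k) * ∫⁻ x in cellInclusion S ε n, ‖fderiv ℝ h x‖ₑ ^ 2 := by
  have hm : Measurable fun x => ‖fderiv ℝ h x‖ₑ ^ 2 := (measurable_fderiv ℝ h).enorm.pow_const 2
  rw [mul_assoc, ← hk n S hS _ hm, ← lintegral_const_mul' _ _ (by finiteness)]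
  refine lintegral_congr fun y => ?_
  rw [fderiv_comp_cellMap, enorm_smul, mul_pow]

theorem exists_lipschitz_cellMapInv (ε : ℝ) (n : Fin d → ℤ) :
    ∃ L, LipschitzWith L (cellMapInv ε n) :=
  ⟨_, ((ContinuousLinearMap.lipschitz (ε⁻¹ • ContinuousLinearMap.id ℝ (E d)))).sub
    (LipschitzWith.const (latticePoint n))⟩

/-- Scaled version of the inner correction. -/
theorem IsInclusion.exists_inner_correction_cell (m : ℕ) {ω : Set (E d)} (hω : IsInclusion ω)
    {N : Set (E d)} (hN : IsOpen N) (hωN : closure ω ⊆ N) :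
    ∃ C : ℝ≥0∞, C ≠ ∞ ∧ ∀ (ε : ℝ), 0 < ε → ∀ (n : Fin d → ℤ) (u : E d → E m),
      ContDiff ℝ ((⊤ : ℕ∞) : WithTop ℕ∞) u → HasCompactSupport u →
      ∃ (φ : E d → E m) (L : NNReal), LipschitzWith L φ ∧ (∀ x ∉ cellInclusion ω ε n, φ x = 0) ∧
        ∫⁻ x in cellInclusion ω ε n, ‖fderiv ℝ (fun y => u y - φ y) x‖ₑ ^ 2 ≤
          C * ∫⁻ x in cellInclusion N ε n \ cellInclusion ω ε n, ‖fderiv ℝ u x‖ₑ ^ 2 := by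
  obtain ⟨C, hC, H⟩ := hω.exists_inner_correction m hN hωN
  refine ⟨C, hC, fun ε hε n u hu huc => ?_⟩
  obtain ⟨k, k0, kt, hk⟩ := exists_scale_lintegral (d := d) hε
  have hcs : ContDiff ℝ ((⊤ : ℕ∞) : WithTop ℕ∞) (cellMap ε n) :=
    (contDiff_const.add contDiff_id).const_smul ε
  obtain ⟨φ, L, hL, h0, hle⟩ := H (fun y => u (cellMap ε n y)) (hu.comp hcs)
    (huc.comp_homeomorph (cellHomeo hε n))
  obtain ⟨L', hL'⟩ := exists_lipschitz_cellMapInv ε n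
  refine ⟨fun x => φ (cellMapInv ε n x), _, hL.comp hL',
    fun x hx => h0 _ fun h => hx ((mem_cellInclusion hε).2 h), ?_⟩
  have hωm := hω.domain.isOpen.measurableSet
  have e1 := lintegral_fderiv_comp_cellMap hk (fun x => u x - φ (cellMapInv ε n x)) n hωm
  have e2 := lintegral_fderiv_comp_cellMap hk u n (hN.measurableSet.diff hωm)
  have e3 : cellInclusion (N \ ω) ε n = cellInclusion N ε n \ cellInclusion ω ε n :=
    image_sdiff (cellHomeo hε n).injective N ω
  simp only [cellMapInv_cellMap hε] at e1
  rw [e1, e2, e3, mul_left_comm] at hle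
  -- Both energies scale by the same ε²k; cancelling it leaves a constant independent of ε and n.
  refine (ENNReal.mul_le_mul_iff_right ?_ ?_).1 hle
  · exact mul_ne_zero (pow_ne_zero 2 (by simpa using hε.ne')) k0
  · finiteness

/-- Scaled version of the outer correction. -/
theorem IsInclusion.exists_outer_correction_cell (m : ℕ) {ω : Set (E d)} (hω : IsInclusion ω)
    {N : Set (E d)} (hN : IsOpen N) (hωN : closure ω ⊆ N) :
    ∃ C : ℝ≥0∞, C ≠ ∞ ∧ ∀ (ε : ℝ), 0 < ε → ∀ (n : Fin d → ℤ) (u : E d → E m),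
      ContDiff ℝ ((⊤ : ℕ∞) : WithTop ℕ∞) u → HasCompactSupport u →
      ∃ (ψ : E d → E m) (L : NNReal), LipschitzWith L ψ ∧ HasCompactSupport ψ ∧
        tsupport ψ ⊆ cellInclusion N ε n ∧
        (∀ x ∈ cellInclusion ω ε n, fderiv ℝ ψ x = fderiv ℝ u x) ∧
        ∫⁻ x, ‖fderiv ℝ ψ x‖ₑ ^ 2 ≤ C * ∫⁻ x in cellInclusion N ε n, ‖fderiv ℝ u x‖ₑ ^ 2 := by
  obtain ⟨C, hC, H⟩ := hω.exists_outer_correction m hN hωN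
  refine ⟨C, hC, fun ε hε n u hu huc => ?_⟩
  obtain ⟨k, k0, kt, hk⟩ := exists_scale_lintegral (d := d) hε
  have hcs : ContDiff ℝ ((⊤ : ℕ∞) : WithTop ℕ∞) (cellMap ε n) :=
    (contDiff_const.add contDiff_id).const_smul ε
  obtain ⟨ψ, L, hL, hc, hs, hgr, hle⟩ := H (fun y => u (cellMap ε n y)) (hu.comp hcs)
    (huc.comp_homeomorph (cellHomeo hε n))
  obtain ⟨L', hL'⟩ := exists_lipschitz_cellMapInv ε n
  have hback : ∀ y, (fun x => ψ (cellMapInv ε n x)) (cellMap ε n y) = ψ y := fun y => by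
    simp only [cellMapInv_cellMap hε]
  refine ⟨fun x => ψ (cellMapInv ε n x), _, hL.comp hL',
    hc.comp_homeomorph (cellHomeo hε n).symm, ?_, fun x hx => ?_, ?_⟩
  · intro x hx
    rw [mem_cellInclusion hε]
    exact hs (tsupport_comp_subset_preimage ψ (cellHomeo hε n).symm.continuous hx)
  · have h1 := hgr _ ((mem_cellInclusion hε).1 hx)
    have h2 := fderiv_comp_cellMap (fun x => ψ (cellMapInv ε n x)) ε n (cellMapInv ε n x)
    simp only [hback] at h2
    rw [fderiv_comp_cellMap, cellMap_cellMapInv hε] at h1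
    rw [cellMap_cellMapInv hε] at h2
    exact smul_right_injective _ hε.ne' (h2.symm.trans h1)
  · have e1 := lintegral_fderiv_comp_cellMap hk (fun x => ψ (cellMapInv ε n x)) n
      MeasurableSet.univ
    have e2 := lintegral_fderiv_comp_cellMap hk u n hN.measurableSet
    have e3 : cellInclusion univ ε n = univ := image_univ_of_surjective (cellHomeo hε n).surjective
    simp only [hback] at e1
    rw [e3, setLIntegral_univ, setLIntegral_univ] at e1
    rw [e1, e2, mul_left_comm] at hle
    refine (ENNReal.mul_le_mul_iff_right ?_ ?_).1 hle
    · exact mul_ne_zero (pow_ne_zero 2 (by simpa using hε.ne')) k0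
    · finiteness

theorem volume_closure_cellInclusion_diff {ω : Set (E d)} (ho : IsOpen ω)
    (hl : HasLipschitzBoundary ω) {ε : ℝ} (hε : 0 < ε) (n : Fin d → ℤ) :
    volume (closure (cellInclusion ω ε n) \ cellInclusion ω ε n) = 0 := by
  obtain ⟨k, k0, kt, hk⟩ := exists_scale_lintegral (d := d) hε
  have h1 := hk n (frontier ω) isClosed_frontier.measurableSet (fun _ => 1) measurable_const
  have h2 : cellInclusion (frontier ω) ε n =
      closure (cellInclusion ω ε n) \ cellInclusion ω ε n := by
    rw [closure_cellInclusion ω hε, ho.frontier_eq]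
    exact image_sdiff (cellHomeo hε n).injective _ _
  rw [setLIntegral_one, setLIntegral_one, volume_frontier_eq_zero ho hl, h2] at h1
  exact (mul_eq_zero.1 h1.symm).resolve_left k0

/-- A neighbourhood of the inclusion whose scaled copies stay in the cell and in the domain. -/
theorem IsInclusion.exists_neighborhood {Ω ω : Set (E d)} (hΩ : IsOpen Ω) (hω : IsInclusion ω)
    {κ : ℝ} (hκ : 0 < κ) : ∃ N K : Set (E d), IsOpen N ∧ IsCompact K ∧ closure ω ⊆ N ∧ N ⊆ K ∧
      K ⊆ unitCell d ∧ ∀ ε : ℝ, 0 < ε → ∀ n ∈ indexSet Ω ω κ ε, cellInclusion K ε n ⊆ Ω := by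
  have hK : IsCompact (closure ω) := hω.domain.isBounded.isCompact_closure
  obtain ⟨δ, hδ, hδY⟩ := hK.exists_cthickening_subset_open (isOpen_unitCell d) hω.closure_subset
  -- Width δ keeps the neighbourhood in the unit cell. Width κ/2 puts the scaled copy within less
  -- than κε of the inclusion, whose distance to ∂Ω exceeds κε.
  have hρ0 : 0 < min δ (κ / 2) := lt_min hδ (by linarith)
  refine ⟨thickening (min δ (κ / 2)) (closure ω), cthickening (min δ (κ / 2)) (closure ω),
    isOpen_thickening, hK.cthickening, self_subset_thickening hρ0 _,
    thickening_subset_cthickening _ _, (cthickening_mono (min_le_left _ _) _).trans hδY, ?_⟩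
  rintro ε hε n ⟨hn1, hn2⟩ x ⟨y, hy, rfl⟩
  have hy' : y ∈ thickening κ ω := by
    rw [← thickening_closure]
    exact cthickening_subset_thickening' hκ ((min_le_right _ _).trans_lt (by linarith)) _ hy
  obtain ⟨z, hz, hyz⟩ := mem_thickening_iff.1 hy'
  by_contra hx
  have hzΩ : cellMap ε n z ∈ cellInclusion ω ε n := ⟨z, hz, rfl⟩
  obtain ⟨w, hw, hwd⟩ := exists_dist_frontier_of_notMem hΩ (hn1 hzΩ) hx
  have h1 := hn2.trans_le (setDist_le hzΩ hw)
  rw [edist_dist] at h1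
  have h2 := (ENNReal.ofReal_lt_ofReal_iff_of_nonneg (by positivity)).1 h1
  have h3 : dist (cellMap ε n z) (cellMap ε n y) = ε * dist z y := dist_cellMap hε n z y
  have h4 : dist (cellMap ε n z) w ≤ ε * dist z y := hwd.trans h3.le
  rw [dist_comm z y] at h4
  nlinarith

/-- Boundedness of Ω bounds the lattice points. Finiteness allows summation over cells and makes the
closure of D_ε the union of the closures of its inclusions. -/
theorem finite_indexSet {Ω ω : Set (E d)} (hΩ : Bornology.IsBounded Ω) (hω : ω.Nonempty)
    (κ : ℝ) {ε : ℝ} (hε : 0 < ε) : (indexSet Ω ω κ ε).Finite := by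
  obtain ⟨y, hy⟩ := hω
  obtain ⟨R, hR⟩ := hΩ.exists_norm_le
  have hbd : ∀ n ∈ indexSet Ω ω κ ε, ∀ i, |(n i : ℝ)| ≤ ε⁻¹ * R + ‖y‖ := fun n hn i => by
    have h1 : ‖cellMap ε n y‖ ≤ R := hR _ (hn.1 ⟨y, hy, rfl⟩)
    have h2 : latticePoint n = ε⁻¹ • cellMap ε n y - y := by
      rw [cellMap, inv_smul_smul₀ hε.ne', add_sub_cancel_right]
    calc |(n i : ℝ)| = ‖(latticePoint n : E d) i‖ := rfl
      _ ≤ ‖(latticePoint n : E d)‖ := PiLp.norm_apply_le _ i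
      _ ≤ ‖ε⁻¹ • cellMap ε n y‖ + ‖y‖ := by rw [h2]; exact norm_sub_le _ _
      _ ≤ _ := by
        rw [norm_smul, Real.norm_of_nonneg (by positivity)]
        gcongr
  refine (Set.Finite.pi' fun _ : Fin d =>
    Set.finite_Icc (-⌈ε⁻¹ * R + ‖y‖⌉) ⌈ε⁻¹ * R + ‖y‖⌉).subset fun n hn i => ?_
  have h := abs_le.1 ((hbd n hn i).trans (Int.le_ceil _))
  constructor
  · exact_mod_cast h.1
  · exact_mod_cast h.2

end Cells

/-! ### The energy inequality. -/

section Energy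

variable {d m : ℕ}

theorem Coeff.form_sub_left (A : Coeff d m) (y : E d) (ξ ξ' η : Grad d m) :
    A.form y (ξ - ξ') η = A.form y ξ η - A.form y ξ' η := by
  simp only [Coeff.form, ← Finset.sum_sub_distrib, PiLp.sub_apply, mul_sub, sub_mul]

theorem Coeff.abs_form_le {A : Coeff d m} {M : ℝ} (hA : A.IsBoundedBy M) (y : E d)
    (ξ η : Grad d m) : |A.form y ξ η| ≤ (d * d * m * m * |M|) * (‖ξ‖ * ‖η‖) := by
  have h : ∀ i j α β, |A y i j α β * ξ (j, β) * η (i, α)| ≤ |M| * (‖ξ‖ * ‖η‖) := by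
    intro i j α β
    rw [abs_mul, abs_mul, mul_assoc]
    exact mul_le_mul ((hA y i j α β).trans (le_abs_self M))
      (mul_le_mul (PiLp.norm_apply_le ξ (j, β)) (PiLp.norm_apply_le η (i, α)) (abs_nonneg _)
        (norm_nonneg _)) (by positivity) (abs_nonneg _)
  calc |A.form y ξ η| ≤ ∑ _i : Fin d, ∑ _j : Fin d, ∑ _α : Fin m, ∑ _β : Fin m,
        |M| * (‖ξ‖ * ‖η‖) := by
        unfold Coeff.form
        refine (Finset.abs_sum_le_sum_abs _ _).trans (Finset.sum_le_sum fun i _ => ?_)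
        refine (Finset.abs_sum_le_sum_abs _ _).trans (Finset.sum_le_sum fun j _ => ?_)
        refine (Finset.abs_sum_le_sum_abs _ _).trans (Finset.sum_le_sum fun α _ => ?_)
        exact (Finset.abs_sum_le_sum_abs _ _).trans (Finset.sum_le_sum fun β _ => h i j α β)
    _ = _ := by
        simp only [Finset.sum_const, Finset.card_univ, Fintype.card_fin, nsmul_eq_mul]
        ring

theorem Coeff.aestronglyMeasurable_form {A : Coeff d m} (hA : A.IsMeasurable) (t : ℝ)
    {ν : Measure (E d)} {a b : E d → Grad d m} (ha : AEStronglyMeasurable a ν)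
    (hb : AEStronglyMeasurable b ν) :
    AEStronglyMeasurable (fun x => A.form (t • x) (a x) (b x)) ν := by
  unfold Coeff.form
  have hc : ∀ {c : E d → Grad d m}, AEStronglyMeasurable c ν → ∀ p,
      AEStronglyMeasurable (fun x => c x p) ν := fun h p =>
    (EuclideanSpace.proj (𝕜 := ℝ) p).continuous.comp_aestronglyMeasurable h
  have hA' : ∀ i j α β, AEStronglyMeasurable (fun x => A (t • x) i j α β) ν := fun i j α β =>
    ((hA i j α β).comp (measurable_const_smul t)).aestronglyMeasurable
  refine Finset.aestronglyMeasurable_fun_sum _ fun i _ => ?_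
  refine Finset.aestronglyMeasurable_fun_sum _ fun j _ => ?_
  refine Finset.aestronglyMeasurable_fun_sum _ fun α _ => ?_
  refine Finset.aestronglyMeasurable_fun_sum _ fun β _ => ?_
  exact ((hA' i j α β).mul (hc ha _)).mul (hc hb _)

theorem Coeff.integrable_form {A : Coeff d m} {M : ℝ} (hA : A.IsMeasurable)
    (hM : A.IsBoundedBy M) (t : ℝ) {ν : Measure (E d)} {a b : E d → Grad d m} (ha : MemLp a 2 ν)
    (hb : MemLp b 2 ν) : Integrable (fun x => A.form (t • x) (a x) (b x)) ν := by
  refine Integrable.mono' ((ha.norm.integrable_mul hb.norm).const_mul (d * d * m * m * |M|))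
    (Coeff.aestronglyMeasurable_form hA t ha.1 hb.1) (ae_of_all _ fun x => ?_)
  exact Coeff.abs_form_le hM _ _ _

theorem ofReal_integral_mul_norm_sq {F : Type*} [NormedAddCommGroup F] {ν : Measure (E d)}
    {w : E d → ℝ} (h0 : ∀ x, 0 ≤ w x) {a : E d → F}
    (hi : Integrable (fun x => w x * ‖a x‖ ^ 2) ν) :
    ENNReal.ofReal (∫ x, w x * ‖a x‖ ^ 2 ∂ν) = ∫⁻ x, ENNReal.ofReal (w x) * ‖a x‖ₑ ^ 2 ∂ν := by
  rw [ofReal_integral_eq_lintegral_ofReal hi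
    (ae_of_all _ fun x => mul_nonneg (h0 x) (by positivity))]
  refine lintegral_congr fun x => ?_
  rw [ENNReal.ofReal_mul (h0 x), ENNReal.ofReal_pow (norm_nonneg _), ofReal_norm]

/-- Energy inequality: `p` and `φ` play the role of a test function and its gradient, `a` of the
gradient of a solution, and `T` contains the support of the test function. -/
theorem energy_le {A : Coeff d m} {M μ : ℝ} (hA : A.IsMeasurable) (hM : A.IsBoundedBy M)
    (hE : A.IsElliptic μ) (hμ : 0 < μ) (t : ℝ) {ν : Measure (E d)} {w : E d → ℝ} {B : ℝ}
    (hw : Measurable w) (hw0 : ∀ x, 0 ≤ w x) (hwB : ∀ x, w x ≤ B) {T : Set (E d)}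
    (hT : MeasurableSet T) {a p : E d → Grad d m} {f φ : E d → E m} (ha : MemLp a 2 ν)
    (hp : MemLp p 2 ν) (hf : MemLp f 2 ν) (hφ : MemLp φ 2 ν)
    (hpT : ∀ᵐ x ∂ν, x ∉ T → p x = 0) (hφT : ∀ᵐ x ∂ν, x ∉ T → φ x = 0)
    (heq : ∫ x, w x * A.form (t • x) (a x) (p x) ∂ν = ∫ x, inner ℝ (f x) (φ x) ∂ν)
    {P : ℝ} (hP : 0 < P) {R : ℝ≥0∞} (hPoin : ∫⁻ x, ‖φ x‖ₑ ^ 2 ∂ν ≤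
      ENNReal.ofReal P * ((∫⁻ x, ENNReal.ofReal (w x) * ‖p x‖ₑ ^ 2 ∂ν) + R)) :
    ∫⁻ x, ENNReal.ofReal (w x) * ‖p x‖ₑ ^ 2 ∂ν ≤ R +
      (ENNReal.ofReal (4 * P / μ ^ 2) * ∫⁻ x in T, ‖f x‖ₑ ^ 2 ∂ν) +
      ENNReal.ofReal (2 * (d * d * m * m * |M|) ^ 2 / μ ^ 2) *
        ∫⁻ x in T, ENNReal.ofReal (w x) * ‖a x - p x‖ₑ ^ 2 ∂ν := by
  set M' : ℝ := d * d * m * m * |M|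
  have hwi : ∀ {F : Type _} [NormedAddCommGroup F] {b : E d → F} {ν' : Measure (E d)},
      MemLp b 2 ν' → Integrable (fun x => w x * ‖b x‖ ^ 2) ν' := by
    intro F _ b ν' hb
    refine Integrable.bdd_mul (c := B) ((memLp_two_iff_integrable_sq_norm hb.1).1 hb)
      hw.aestronglyMeasurable (ae_of_all _ fun x => ?_)
    rw [Real.norm_of_nonneg (hw0 x)]
    exact hwB x
  have hsq : ∀ {F : Type _} [NormedAddCommGroup F] {b : E d → F} {ν' : Measure (E d)},
      MemLp b 2 ν' → ENNReal.ofReal (∫ x, ‖b x‖ ^ 2 ∂ν') = ∫⁻ x, ‖b x‖ₑ ^ 2 ∂ν' := by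
    intro F _ b ν' hb
    have := ofReal_integral_mul_norm_sq (ν := ν') (w := fun _ => 1) (a := b) (by simp)
      (by simpa using (memLp_two_iff_integrable_sq_norm hb.1).1 hb)
    simpa using this
  have hr := ha.sub hp
  have hX := ofReal_integral_mul_norm_sq hw0 (hwi hp)
  have hZ := ofReal_integral_mul_norm_sq hw0 (hwi (hr.restrict T))
  have hF := hsq (hf.restrict T)
  have hΦ := hsq hφ
  simp only [Pi.sub_apply] at hZ
  set X := ∫ x, w x * ‖p x‖ ^ 2 ∂ν
  set Z := ∫ x in T, w x * ‖a x - p x‖ ^ 2 ∂ν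
  set F := ∫ x in T, ‖f x‖ ^ 2 ∂ν
  set Φ := ∫ x, ‖φ x‖ ^ 2 ∂ν
  have hX0 : 0 ≤ X := integral_nonneg fun x => mul_nonneg (hw0 x) (by positivity)
  have hZ0 : 0 ≤ Z := integral_nonneg fun x => mul_nonneg (hw0 x) (by positivity)
  have hF0 : 0 ≤ F := integral_nonneg fun x => by positivity
  have hwform : Integrable (fun x => w x * A.form (t • x) (a x) (p x)) ν := by
    refine Integrable.bdd_mul (c := B) (Coeff.integrable_form hA hM t ha hp)
      hw.aestronglyMeasurable (ae_of_all _ fun x => ?_)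
    rw [Real.norm_of_nonneg (hw0 x)]
    exact hwB x
  have hZi : Integrable (T.indicator fun x => w x * ‖a x - p x‖ ^ 2) ν :=
    (integrable_indicator_iff hT).2 (hwi (hr.restrict T))
  have hFi : Integrable (T.indicator fun x => ‖f x‖ ^ 2) ν :=
    ((memLp_two_iff_integrable_sq_norm hf.1).1 hf).indicator hT
  have hΦi : Integrable (fun x => ‖φ x‖ ^ 2) ν := (memLp_two_iff_integrable_sq_norm hφ.1).1 hφ
  have eZ : Z = ∫ x, T.indicator (fun x => w x * ‖a x - p x‖ ^ 2) x ∂ν :=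
    (integral_indicator hT).symm
  have eF : F = ∫ x, T.indicator (fun x => ‖f x‖ ^ 2) x ∂ν := (integral_indicator hT).symm
  -- Write form(a, p) = form(p, p) + form(a - p, p). Coercivity bounds the first term below by
  -- μ|p|², and Young's inequality spends half of that on the second.
  have h1 : μ / 2 * X ≤ (∫ x, w x * A.form (t • x) (a x) (p x) ∂ν) + M' ^ 2 / (2 * μ) * Z := by
    rw [eZ, ← integral_const_mul, ← integral_const_mul,
      ← integral_add hwform (hZi.const_mul _)]
    refine integral_mono_ae ((hwi hp).const_mul _) (hwform.add (hZi.const_mul _)) ?_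
    filter_upwards [hpT] with x hx
    by_cases hxT : x ∈ T
    · simp only [indicator_of_mem hxT]
      have e1 := (hE (t • x) (p x)).1
      have e2 := Coeff.form_sub_left A (t • x) (a x) (p x) (p x)
      have e3 := (abs_le.1 (Coeff.abs_form_le hM (t • x) (a x - p x) (p x))).1
      have e4 : M' * (‖a x - p x‖ * ‖p x‖) ≤
          μ / 2 * ‖p x‖ ^ 2 + M' ^ 2 / (2 * μ) * ‖a x - p x‖ ^ 2 := by
        have e5 : μ / 2 * ‖p x‖ ^ 2 + M' ^ 2 / (2 * μ) * ‖a x - p x‖ ^ 2 -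
            M' * (‖a x - p x‖ * ‖p x‖) = (μ * ‖p x‖ - M' * ‖a x - p x‖) ^ 2 / (2 * μ) := by
          field_simp
          ring
        have : 0 ≤ (μ * ‖p x‖ - M' * ‖a x - p x‖) ^ 2 / (2 * μ) := by positivity
        linarith
      have e6 : μ / 2 * ‖p x‖ ^ 2 ≤
          A.form (t • x) (a x) (p x) + M' ^ 2 / (2 * μ) * ‖a x - p x‖ ^ 2 := by
        change -(M' * (‖a x - p x‖ * ‖p x‖)) ≤ _ at e3
        linarith
      have := mul_le_mul_of_nonneg_left e6 (hw0 x)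
      linarith
    · simp [hx hxT, indicator_of_notMem hxT, Coeff.form]
  -- The weight μ/(4P) is chosen so that the Poincaré hypothesis turns the φ term into μ/4 (X + R),
  -- which is absorbed by μ/2 X.
  have h2 : ∫ x, inner ℝ (f x) (φ x) ∂ν ≤ μ / (4 * P) * Φ + P / μ * F := by
    have hinner : Integrable (fun x => (inner ℝ (f x) (φ x) : ℝ)) ν :=
      Integrable.mono' (hf.norm.integrable_mul hφ.norm) (hf.1.inner hφ.1)
        (ae_of_all _ fun x => norm_inner_le_norm _ _)
    rw [eF, ← integral_const_mul, ← integral_const_mul,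
      ← integral_add (hΦi.const_mul _) (hFi.const_mul _)]
    refine integral_mono_ae hinner ((hΦi.const_mul _).add (hFi.const_mul _)) ?_
    filter_upwards [hφT] with x hx
    by_cases hxT : x ∈ T
    · simp only [indicator_of_mem hxT]
      have e1 := real_inner_le_norm (f x) (φ x)
      have e2 : μ / (4 * P) * ‖φ x‖ ^ 2 + P / μ * ‖f x‖ ^ 2 - ‖f x‖ * ‖φ x‖ =
          (μ * ‖φ x‖ - 2 * P * ‖f x‖) ^ 2 / (4 * P * μ) := by
        field_simp
        ring
      have : 0 ≤ (μ * ‖φ x‖ - 2 * P * ‖f x‖) ^ 2 / (4 * P * μ) := by positivity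
      linarith
    · simp [hx hxT, indicator_of_notMem hxT]
  rcases eq_or_ne R ∞ with rfl | hR
  · simp
  rw [← hΦ, ← hX, ← ENNReal.ofReal_toReal hR, ← ENNReal.ofReal_add hX0 (by positivity),
    ← ENNReal.ofReal_mul hP.le, ENNReal.ofReal_le_ofReal_iff (by positivity)] at hPoin
  rw [← hX, ← hF, ← hZ, ← ENNReal.ofReal_toReal hR, ← ENNReal.ofReal_mul (by positivity),
    ← ENNReal.ofReal_mul (by positivity), ← ENNReal.ofReal_add (by positivity) (by positivity),
    ← ENNReal.ofReal_add (by positivity) (by positivity)]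
  refine ENNReal.ofReal_le_ofReal ?_
  have h3 : μ / (4 * P) * Φ ≤ μ / 4 * (X + R.toReal) := by
    calc μ / (4 * P) * Φ ≤ μ / (4 * P) * (P * (X + R.toReal)) := by gcongr
      _ = _ := by field_simp
  have h4 : μ / 4 * X ≤ μ / 4 * R.toReal + P / μ * F + M' ^ 2 / (2 * μ) * Z := by
    rw [heq] at h1
    linarith
  have h5 : μ / 4 * (R.toReal + 4 * P / μ ^ 2 * F + 2 * M' ^ 2 / μ ^ 2 * Z) =
      μ / 4 * R.toReal + P / μ * F + M' ^ 2 / (2 * μ) * Z := by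
    field_simp
    ring
  rw [← h5] at h4
  exact le_of_mul_le_mul_left h4 (by positivity)

end Energy

/-! ### The weight Λ. -/

section Contrast

variable {d m : ℕ}

theorem isOpen_inclusions {Ω ω : Set (E d)} (ho : IsOpen ω) (κ : ℝ) {ε : ℝ} (hε : 0 < ε) :
    IsOpen (inclusions Ω ω κ ε) :=
  isOpen_biUnion fun n _ => isOpen_cellInclusion ho hε n

theorem cellInclusion_subset_inclusions {Ω ω : Set (E d)} {κ ε : ℝ} {n : Fin d → ℤ}
    (hn : n ∈ indexSet Ω ω κ ε) : cellInclusion ω ε n ⊆ inclusions Ω ω κ ε :=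
  subset_biUnion_of_mem (u := fun n => cellInclusion ω ε n) hn

theorem inclusions_subset (Ω ω : Set (E d)) (κ ε : ℝ) : inclusions Ω ω κ ε ⊆ Ω :=
  iUnion₂_subset fun _ hn => hn.1

theorem volume_closure_inclusions_diff {Ω ω : Set (E d)} (hΩ : Bornology.IsBounded Ω)
    (hω : IsInclusion ω) (κ : ℝ) {ε : ℝ} (hε : 0 < ε) :
    volume (closure (inclusions Ω ω κ ε) \ inclusions Ω ω κ ε) = 0 := by
  have hfin := finite_indexSet hΩ hω.domain.isConnected.nonempty κ hε
  refine measure_mono_null (t := ⋃ n ∈ indexSet Ω ω κ ε,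
    closure (cellInclusion ω ε n) \ cellInclusion ω ε n) ?_ ?_
  · rintro x ⟨hx, hx'⟩
    rw [inclusions, hfin.closure_biUnion] at hx
    obtain ⟨n, hn, hxn⟩ := mem_iUnion₂.1 hx
    exact mem_iUnion₂.2 ⟨n, hn, hxn, fun h => hx' (cellInclusion_subset_inclusions hn h)⟩
  · exact (measure_biUnion_null_iff hfin.countable).2 fun n _ =>
      volume_closure_cellInclusion_diff hω.domain.isOpen hω.domain.lipschitz hε n

theorem contrast_of_mem {Ω ω : Set (E d)} {κ ε : ℝ} (δ : ℝ) {x : E d}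
    (hx : x ∈ inclusions Ω ω κ ε) : contrast Ω ω κ ε δ x = δ := by
  have : x ∉ background Ω ω κ ε := fun h => h.2 (subset_closure hx)
  simp [contrast, hx, this]

theorem contrast_of_notMem {Ω ω : Set (E d)} {κ ε : ℝ} (δ : ℝ) {x : E d}
    (hx : x ∉ closure (inclusions Ω ω κ ε)) (hxΩ : x ∈ Ω) : contrast Ω ω κ ε δ x = 1 := by
  have h1 : x ∈ background Ω ω κ ε := ⟨hxΩ, hx⟩
  have h2 : x ∉ inclusions Ω ω κ ε := fun h => hx (subset_closure h)
  simp [contrast, h1, h2]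

theorem contrast_nonneg (Ω ω : Set (E d)) (κ ε : ℝ) {δ : ℝ} (hδ : 0 < δ) (x : E d) :
    0 ≤ contrast Ω ω κ ε δ x := by
  unfold contrast
  refine add_nonneg (mul_nonneg hδ.le ?_) ?_ <;> exact indicator_nonneg (fun _ _ => zero_le_one) _

theorem contrast_le (Ω ω : Set (E d)) (κ ε δ : ℝ) (x : E d) :
    contrast Ω ω κ ε δ x ≤ max 1 δ := by
  by_cases hx : x ∈ inclusions Ω ω κ ε
  · rw [contrast_of_mem δ hx]
    exact le_max_right _ _
  · rw [contrast, indicator_of_notMem hx, mul_zero, zero_add]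
    exact (indicator_le_self' (fun _ _ => zero_le_one) x).trans (le_max_left _ _)

theorem measurable_contrast {Ω ω : Set (E d)} (hΩ : IsOpen Ω) (ho : IsOpen ω) (κ : ℝ) {ε : ℝ}
    (hε : 0 < ε) (δ : ℝ) : Measurable (contrast Ω ω κ ε δ) := by
  refine Measurable.add (Measurable.const_mul ?_ _) ?_
  · exact measurable_const.indicator (isOpen_inclusions ho κ hε).measurableSet
  · exact measurable_const.indicator (hΩ.measurableSet.diff isClosed_closure.measurableSet)

/-- The exceptional set is the boundary of D_ε inside Ω, where both indicators vanish; it is a null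
set. -/
theorem ae_contrast_eq_one {Ω ω : Set (E d)} (hΩo : IsOpen Ω) (hΩ : Bornology.IsBounded Ω)
    (hω : IsInclusion ω) (κ : ℝ) {ε : ℝ} (hε : 0 < ε) (δ : ℝ) :
    ∀ᵐ x ∂volume.restrict Ω, x ∉ inclusions Ω ω κ ε → contrast Ω ω κ ε δ x = 1 := by
  have h := volume_closure_inclusions_diff hΩ hω κ hε
  filter_upwards [ae_restrict_mem hΩo.measurableSet,
    ae_restrict_of_ae (compl_mem_ae_iff.2 h)] with x hx hxc hxD
  exact contrast_of_notMem δ (fun hc => hxc ⟨hc, hxD⟩) hx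

end Contrast

/-! ### The gradient of a solution in a single inclusion. -/

section LocalEstimate

variable {d m : ℕ}

theorem lintegral_enorm_add_sq_le {α F : Type*} [MeasurableSpace α] [NormedAddCommGroup F]
    {ν : Measure α} {a b : α → F} (ha : AEStronglyMeasurable a ν) :
    ∫⁻ x, ‖a x + b x‖ₑ ^ 2 ∂ν ≤ 2 * (∫⁻ x, ‖a x‖ₑ ^ 2 ∂ν) + 2 * ∫⁻ x, ‖b x‖ₑ ^ 2 ∂ν := by
  refine (lintegral_mono fun x => enorm_add_sq_le (a x) (b x)).trans ?_
  rw [lintegral_add_left' ((ha.enorm.pow_const 2).const_mul 2),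
    lintegral_const_mul' _ _ (by finiteness), lintegral_const_mul' _ _ (by finiteness)]

theorem lintegral_enorm_sub_sq_le {α F : Type*} [MeasurableSpace α] [NormedAddCommGroup F]
    {ν : Measure α} {a b : α → F} (ha : AEStronglyMeasurable a ν) :
    ∫⁻ x, ‖a x - b x‖ₑ ^ 2 ∂ν ≤ 2 * (∫⁻ x, ‖a x‖ₑ ^ 2 ∂ν) + 2 * ∫⁻ x, ‖b x‖ₑ ^ 2 ∂ν := by
  have h := lintegral_enorm_add_sq_le (b := fun x => -b x) ha
  simpa only [← sub_eq_add_neg, enorm_neg] using h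

/-- The gradient of a Lipschitz function vanishing outside an inclusion vanishes there, too. -/
theorem ae_gradVec_eq_zero {S : Set (E d)} (hS : volume (closure S \ S) = 0) {φ : E d → E m}
    (h0 : ∀ x ∉ S, φ x = 0) : ∀ᵐ x : E d, x ∉ S → gradVec φ x = 0 := by
  filter_upwards [compl_mem_ae_iff.2 hS] with x hx hxS
  refine gradVec_eq_zero_of_notMem_tsupport fun h => hx ⟨closure_mono (fun y hy => ?_) h, hxS⟩
  by_contra hyS
  exact hy (h0 y hyS)

/-- Estimate of the gradient of a solution in one inclusion. -/
theorem exists_inner_estimate (hd : 0 < d) (m : ℕ) {Ω ω : Set (E d)}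
    (hΩo : IsOpen Ω) (hΩb : Bornology.IsBounded Ω) (hω : IsInclusion ω) {κ μ M : ℝ} (hμ : 0 < μ)
    {N K : Set (E d)} (hN : IsOpen N) (hK : IsCompact K) (hωN : closure ω ⊆ N) (hNK : N ⊆ K)
    (hKΩ : ∀ ε : ℝ, 0 < ε → ∀ n ∈ indexSet Ω ω κ ε, cellInclusion K ε n ⊆ Ω) :
    ∃ C : ℝ≥0∞, C ≠ ∞ ∧ ∀ A : Coeff d m, A.IsMeasurable → A.IsElliptic μ → A.IsBoundedBy M →
      ∀ ε : ℝ, 0 < ε → ∀ δ : ℝ, 0 < δ → ∀ f : E d → E m, MemLp f 2 (volume.restrict Ω) →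
      ∀ (g : HHalf m Ω) (u : H1 m Ω), IsWeakSolution Ω ω κ A ε δ f g u →
      ∀ n ∈ indexSet Ω ω κ ε, ∫⁻ x in cellInclusion ω ε n, ‖H1.grad u x‖ₑ ^ 2 ≤
        C * ((∫⁻ x in cellInclusion N ε n \ cellInclusion ω ε n, ‖H1.grad u x‖ₑ ^ 2) +
          ENNReal.ofReal (ε ^ 2 * δ⁻¹ ^ 2) * ∫⁻ x in cellInclusion ω ε n, ‖f x‖ₑ ^ 2) := by
  obtain ⟨C₁, hC₁, HC⟩ := hω.exists_inner_correction_cell m hN hωN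
  obtain ⟨c, c0, ct, hc⟩ := exists_enorm_bounds d m
  obtain ⟨R, R0, hR⟩ := hω.domain.isBounded.subset_closedBall_lt 0 0
  set k : ℝ := 4 * R ^ 2 * c.toReal
  have hcr : 0 < c.toReal := ENNReal.toReal_pos c0 ct
  have hk : 0 < k := by positivity
  set C₂ := ENNReal.ofReal (4 * k / μ ^ 2)
  set C₃ := ENNReal.ofReal (2 * (d * d * m * m * |M|) ^ 2 / μ ^ 2)
  -- bounds the approximation error
  set C₄ : ℝ≥0∞ := 4 * (c * C₁ * c) + 2
  have hcC₁ : c * C₁ * c ≠ ∞ := by finiteness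
  have hC₄ : C₄ ≠ ∞ := by finiteness
  refine ⟨2 * C₂ + (2 * C₃ + 2) * C₄, by finiteness, fun A hA hE hM ε hε δ hδ f hf g u hu n hn => ?_⟩
  set S := cellInclusion ω ε n
  set a := H1.grad u
  have hSo : IsOpen S := isOpen_cellInclusion hω.domain.isOpen hε n
  have hSD : S ⊆ inclusions Ω ω κ ε := cellInclusion_subset_inclusions hn
  have hSK : S ⊆ cellInclusion K ε n := image_mono (subset_closure.trans (hωN.trans hNK))
  have hclK : closure S ⊆ cellInclusion K ε n := by
    rw [closure_cellInclusion ω hε]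
    exact image_mono (hωN.trans hNK)
  have hKΩ' := hKΩ ε hε n hn
  have hSΩ : S ⊆ Ω := hSK.trans hKΩ'
  have hS0 : volume (closure S \ S) = 0 :=
    volume_closure_cellInclusion_diff hω.domain.isOpen hω.domain.lipschitz hε n
  have ham : ∀ {T : Set (E d)}, T ⊆ Ω → AEStronglyMeasurable a (volume.restrict T) :=
    fun hT => (H1.memLp_grad u).1.mono_measure (Measure.restrict_mono hT le_rfl)
  have hdiffK : cellInclusion N ε n \ S ⊆ cellInclusion K ε n := sdiff_subset.trans (image_mono hNK)
  refine ennreal_le_of_forall_le_add_mul (K := (2 * C₃ + 2) * C₄) (by finiteness) fun η η0 _ => ?_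
  obtain ⟨w, hw, hwc, -, hwa⟩ := (H1.isWeakGradient u).exists_smooth_approx hΩo (H1.memLp_fn u)
    (H1.memLp_grad u) (isCompact_cellInclusion hK hε n) hKΩ' η0
  change ∫⁻ x in cellInclusion K ε n, ‖gradVec w x - a x‖ₑ ^ 2 ≤ η at hwa
  obtain ⟨φ, L, hφ, hφ0, hle⟩ := HC ε hε n w hw (hwc hΩb)
  have hφts : tsupport φ ⊆ closure S := closure_mono fun y hy => by
    by_contra hyS
    exact hy (hφ0 y hyS)
  have hφc : HasCompactSupport φ :=
    (isCompact_cellInclusion hK hε n).of_isClosed_subset (isClosed_tsupport _) (hφts.trans hclK)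
  -- The test function is the correction φ of a smooth approximation w of u. It is supported in the
  -- closure of S, where the closeness of w and u is known.
  obtain ⟨v, hv, hv1, hv2⟩ := exists_H10_of_lipschitz hΩo hφ hφc (hφts.trans (hclK.trans hKΩ'))
  have hgφ0 := ae_gradVec_eq_zero hS0 hφ0
  set Q := ∫⁻ x in S, ‖gradVec φ x‖ₑ ^ 2
  set Z := ∫⁻ x in S, ‖a x - gradVec φ x‖ₑ ^ 2
  set B := ∫⁻ x in cellInclusion N ε n \ S, ‖a x‖ₑ ^ 2
  set F := ∫⁻ x in S, ‖f x‖ₑ ^ 2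
  -- comparison with the corrected approximation
  have hw1 : ∫⁻ x in cellInclusion N ε n \ S, ‖gradVec w x‖ₑ ^ 2 ≤ 2 * B + 2 * η := by
    have h := lintegral_enorm_add_sq_le (b := fun x => gradVec w x - a x)
      (ham (hdiffK.trans hKΩ'))
    simp only [add_sub_cancel] at h
    exact h.trans (add_le_add le_rfl (mul_le_mul' le_rfl ((lintegral_mono_set hdiffK).trans hwa)))
  have hw2 : ∫⁻ x in S, ‖gradVec (fun y => w y - φ y) x‖ₑ ^ 2 ≤ c * C₁ * c * (2 * B + 2 * η) := by
    calc _ ≤ ∫⁻ x in S, c * ‖fderiv ℝ (fun y => w y - φ y) x‖ₑ ^ 2 :=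
          lintegral_mono fun x => (hc _).1
      _ = c * ∫⁻ x in S, ‖fderiv ℝ (fun y => w y - φ y) x‖ₑ ^ 2 := lintegral_const_mul' _ _ ct
      _ ≤ c * (C₁ * ∫⁻ x in cellInclusion N ε n \ S, ‖fderiv ℝ w x‖ₑ ^ 2) :=
          mul_le_mul' le_rfl hle
      _ ≤ c * (C₁ * (c * (2 * B + 2 * η))) := by
          refine mul_le_mul' le_rfl (mul_le_mul' le_rfl ?_)
          refine (lintegral_mono fun x => (hc _).2).trans ?_
          rw [lintegral_const_mul' _ _ ct]
          exact mul_le_mul' le_rfl hw1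
      _ = _ := by ring
  -- Uses ∇u - ∇φ = ∇(w - φ) - (∇w - ∇u): the first part is controlled by the layer around S, the
  -- second by the approximation error.
  have hZ : Z ≤ C₄ * B + C₄ * η := by
    have h1 : Z = ∫⁻ x in S, ‖gradVec (fun y => w y - φ y) x - (gradVec w x - a x)‖ₑ ^ 2 := by
      refine lintegral_congr_ae (ae_restrict_of_ae ?_)
      filter_upwards [hφ.ae_differentiableAt] with x hx
      have : gradVec (fun y => w y - φ y) x = gradVec w x - gradVec φ x := by
        rw [gradVec, fderiv_fun_sub (hw.differentiable (by simp) x) hx, map_sub]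
        rfl
      rw [this, sub_sub_sub_cancel_left]
    have h2 := lintegral_enorm_sub_sq_le (ν := volume.restrict S)
      (b := fun x => gradVec w x - a x)
      (measurable_gradVec (fun y => w y - φ y)).aestronglyMeasurable
    rw [h1]
    refine h2.trans ((add_le_add (mul_le_mul' le_rfl hw2)
      (mul_le_mul' le_rfl ((lintegral_mono_set hSK).trans hwa))).trans ?_)
    calc _ = (4 * (c * C₁ * c)) * B + C₄ * η := by ring
      _ ≤ _ := add_le_add (mul_le_mul' le_self_add le_rfl) le_rfl
  -- weighted integrals of the test function
  have hX : ∫⁻ x in Ω, ENNReal.ofReal (contrast Ω ω κ ε δ x) * ‖H1.grad v x‖ₑ ^ 2 =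
      ENNReal.ofReal δ * Q := by
    rw [← lintegral_const_mul' _ _ ENNReal.ofReal_ne_top, ← lintegral_indicator hSo.measurableSet,
      ← lintegral_indicator hΩo.measurableSet]
    have hv2' := (ae_restrict_iff' hΩo.measurableSet).1 hv2
    refine lintegral_congr_ae ?_
    filter_upwards [hgφ0, hv2'] with x h1 h2
    by_cases hxS : x ∈ S
    · rw [indicator_of_mem hxS, indicator_of_mem (hSΩ hxS), h2 (hSΩ hxS),
        contrast_of_mem δ (hSD hxS)]
    · rw [indicator_of_notMem hxS]
      by_cases hxΩ : x ∈ Ω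
      · rw [indicator_of_mem hxΩ, h2 hxΩ, h1 hxS]
        simp
      · rw [indicator_of_notMem hxΩ]
  have hrr : (volume.restrict Ω).restrict S = volume.restrict S :=
    Measure.restrict_restrict_of_subset hSΩ
  have hZ' : ∫⁻ x in S, ENNReal.ofReal (contrast Ω ω κ ε δ x) * ‖a x - H1.grad v x‖ₑ ^ 2
      ∂(volume.restrict Ω) = ENNReal.ofReal δ * Z := by
    rw [hrr, ← lintegral_const_mul' _ _ ENNReal.ofReal_ne_top]
    refine lintegral_congr_ae ?_
    filter_upwards [ae_restrict_mem hSo.measurableSet,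
      ae_restrict_of_ae_restrict_of_subset hSΩ hv2] with x hx h2
    rw [contrast_of_mem δ (hSD hx), h2]
  -- φ lives in a ball of radius εR, which gives ε²; the weight equals δ on S, so the weighted
  -- energy enters with δ⁻¹.
  have hpoin : ∫⁻ x in Ω, ‖H1.fn v x‖ₑ ^ 2 ≤ ENNReal.ofReal (k * ε ^ 2 * δ⁻¹) *
      ((∫⁻ x in Ω, ENNReal.ofReal (contrast Ω ω κ ε δ x) * ‖H1.grad v x‖ₑ ^ 2) + 0) := by
    obtain ⟨x₀, hx₀⟩ : ∃ x₀, ∀ x, x ∉ closedBall x₀ (ε * R) → φ x = 0 := by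
      refine ⟨cellMap ε n 0, fun x hx => hφ0 x ?_⟩
      rintro ⟨y, hy, rfl⟩
      refine hx ?_
      change dist (cellMap ε n y) (cellMap ε n 0) ≤ _
      rw [dist_cellMap hε]
      exact mul_le_mul_of_nonneg_left (hR hy) hε.le
    have h1 : ∫⁻ x, ‖gradVec φ x‖ₑ ^ 2 = Q := by
      refine Eq.trans ?_ (lintegral_indicator hSo.measurableSet fun x => ‖gradVec φ x‖ₑ ^ 2)
      refine lintegral_congr_ae ?_
      filter_upwards [hgφ0] with x hx
      by_cases hxS : x ∈ S
      · rw [indicator_of_mem hxS]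
      · rw [indicator_of_notMem hxS, hx hxS]
        simp
    calc ∫⁻ x in Ω, ‖H1.fn v x‖ₑ ^ 2 = ∫⁻ x in Ω, ‖φ x‖ₑ ^ 2 :=
          lintegral_congr_ae (hv1.mono fun x hx => by simp only [hx])
      _ ≤ ∫⁻ x, ‖φ x‖ₑ ^ 2 := setLIntegral_le_lintegral _ _
      _ ≤ ENNReal.ofReal (4 * (ε * R) ^ 2) * ∫⁻ x, ‖fderiv ℝ φ x‖ₑ ^ 2 :=
          lintegral_norm_sq_le_of_lipschitz hd hφ hx₀
      _ ≤ ENNReal.ofReal (4 * (ε * R) ^ 2) * (c * Q) := by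
          rw [← h1, ← lintegral_const_mul' _ _ ct]
          exact mul_le_mul' le_rfl (lintegral_mono fun x => (hc _).2)
      _ = _ := by
          rw [add_zero, hX, ← mul_assoc, ← mul_assoc, ← ENNReal.ofReal_toReal ct,
            ← ENNReal.ofReal_mul (by positivity), ← ENNReal.ofReal_mul (by positivity)]
          congr 2
          field_simp
          ring
  have key := energy_le hA hM hE hμ ε⁻¹ (ν := volume.restrict Ω) (w := contrast Ω ω κ ε δ)
    (B := max 1 δ) (measurable_contrast hΩo hω.domain.isOpen κ hε δ)
    (contrast_nonneg Ω ω κ ε hδ) (contrast_le Ω ω κ ε δ) (T := S) hSo.measurableSet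
    (H1.memLp_grad u) (H1.memLp_grad v) hf (H1.memLp_fn v)
    (by filter_upwards [hv2, ae_restrict_of_ae hgφ0] with x h1 h2 h3; rw [h1, h2 h3])
    (by filter_upwards [hv1] with x h1 h3; rw [h1, hφ0 x h3]) (hu.2 v hv)
    (P := k * ε ^ 2 * δ⁻¹) (by positivity) (R := 0) hpoin
  rw [hX, hZ', zero_add, hrr] at key
  change ENNReal.ofReal δ * Q ≤ _ * F + C₃ * (ENNReal.ofReal δ * Z) at key
  -- Both energies carry the factor δ. Dividing by it leaves the Z term free of δ and turns the
  -- source factor ε²δ⁻¹ into ε²δ⁻².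
  have hQ : Q ≤ C₂ * (ENNReal.ofReal (ε ^ 2 * δ⁻¹ ^ 2) * F) + C₃ * Z := by
    refine (ENNReal.mul_le_mul_iff_right (a := ENNReal.ofReal δ) (by simpa using hδ)
      ENNReal.ofReal_ne_top).1 (key.trans_eq ?_)
    have e : ENNReal.ofReal (4 * (k * ε ^ 2 * δ⁻¹) / μ ^ 2) =
        ENNReal.ofReal δ * (C₂ * ENNReal.ofReal (ε ^ 2 * δ⁻¹ ^ 2)) := by
      rw [← ENNReal.ofReal_mul (by positivity), ← ENNReal.ofReal_mul (by positivity)]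
      congr 1
      field_simp
    rw [e]
    ring
  have hfin : ∫⁻ x in S, ‖a x‖ₑ ^ 2 ≤ 2 * Q + 2 * Z := by
    have h := lintegral_enorm_add_sq_le (ν := volume.restrict S)
      (b := fun x => a x - gradVec φ x) (measurable_gradVec φ).aestronglyMeasurable
    simpa only [add_sub_cancel] using h
  clear_value C₄
  set F' := ENNReal.ofReal (ε ^ 2 * δ⁻¹ ^ 2) * F
  calc _ ≤ 2 * Q + 2 * Z := hfin
    _ ≤ 2 * (C₂ * F' + C₃ * Z) + 2 * Z := by gcongr
    _ = 2 * C₂ * F' + (2 * C₃ + 2) * Z := by ring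
    _ ≤ 2 * C₂ * F' + (2 * C₃ + 2) * (C₄ * B + C₄ * η) := by gcongr
    _ = (2 * C₃ + 2) * C₄ * B + 2 * C₂ * F' + (2 * C₃ + 2) * C₄ * η := by ring
    _ ≤ _ := by
      rw [mul_add (2 * C₂ + (2 * C₃ + 2) * C₄) B F']
      gcongr
      · exact le_add_self
      · exact le_self_add

end LocalEstimate

/-! ### Summation over the cells. -/

section GlobalEstimate

variable {d m : ℕ}

theorem lintegral_inclusions {Ω ω : Set (E d)} (hω : IsInclusion ω)
    (κ : ℝ) {ε : ℝ} (hε : 0 < ε) {t : Finset (Fin d → ℤ)}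
    (ht : (t : Set (Fin d → ℤ)) = indexSet Ω ω κ ε) (h : E d → ℝ≥0∞) :
    ∫⁻ x in inclusions Ω ω κ ε, h x = ∑ n ∈ t, ∫⁻ x in cellInclusion ω ε n, h x := by
  have e : inclusions Ω ω κ ε = ⋃ n ∈ t, cellInclusion ω ε n := by
    rw [inclusions, ← ht]
    rfl
  rw [e]
  exact lintegral_biUnion_finset (fun n _ n' _ hn => disjoint_cellInclusion hω.subset hω.subset hε hn)
    (fun n _ => (isOpen_cellInclusion hω.domain.isOpen hε n).measurableSet) _

/-- Distinct cells are disjoint, so local energies add up without an overlap constant. -/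
theorem sum_lintegral_cell_le {S : Set (E d)} (hS : S ⊆ unitCell d) {ε : ℝ}
    (hε : 0 < ε) {t : Finset (Fin d → ℤ)} {T : (Fin d → ℤ) → Set (E d)}
    (hT : ∀ n ∈ t, T n ⊆ cellInclusion S ε n) (hTm : ∀ n ∈ t, MeasurableSet (T n)) {U : Set (E d)}
    (hU : ∀ n ∈ t, T n ⊆ U) (h : E d → ℝ≥0∞) :
    ∑ n ∈ t, ∫⁻ x in T n, h x ≤ ∫⁻ x in U, h x := by
  rw [← lintegral_biUnion_finset (fun n hn n' hn' hnn' =>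
    (disjoint_cellInclusion hS hS hε hnn').mono (hT n hn) (hT n' hn')) hTm]
  exact lintegral_mono_set (iUnion₂_subset hU)

/-- Estimate of the gradient of a solution in all inclusions by its values outside. -/
theorem exists_inclusions_estimate (hd : 0 < d) (m : ℕ) {Ω ω : Set (E d)}
    (hΩo : IsOpen Ω) (hΩb : Bornology.IsBounded Ω) (hω : IsInclusion ω) {κ μ : ℝ} (M : ℝ)
    (hκ : 0 < κ) (hμ : 0 < μ) :
    ∃ C : ℝ≥0∞, C ≠ ∞ ∧ ∀ A : Coeff d m, A.IsMeasurable → A.IsElliptic μ → A.IsBoundedBy M →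
      ∀ ε : ℝ, 0 < ε → ∀ δ : ℝ, 0 < δ → ∀ f : E d → E m, MemLp f 2 (volume.restrict Ω) →
      ∀ (g : HHalf m Ω) (u : H1 m Ω), IsWeakSolution Ω ω κ A ε δ f g u →
      ∫⁻ x in inclusions Ω ω κ ε, ‖H1.grad u x‖ₑ ^ 2 ≤
        C * ((∫⁻ x in Ω \ inclusions Ω ω κ ε, ‖H1.grad u x‖ₑ ^ 2) +
          ENNReal.ofReal (ε ^ 2 * δ⁻¹ ^ 2) * ∫⁻ x in inclusions Ω ω κ ε, ‖f x‖ₑ ^ 2) := by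
  obtain ⟨N, K, hN, hK, hωN, hNK, hKY, hKΩ⟩ := hω.exists_neighborhood hΩo hκ
  obtain ⟨C, hC, H⟩ := exists_inner_estimate hd m hΩo hΩb hω (M := M) hμ hN hK hωN hNK hKΩ
  refine ⟨C, hC, fun A hA hE hM ε hε δ hδ f hf g u hu => ?_⟩
  have hfin := finite_indexSet hΩb hω.domain.isConnected.nonempty κ hε
  have ht : (hfin.toFinset : Set (Fin d → ℤ)) = indexSet Ω ω κ ε := hfin.coe_toFinset
  have hmem : ∀ n ∈ hfin.toFinset, n ∈ indexSet Ω ω κ ε := fun n hn => hfin.mem_toFinset.1 hn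
  rw [lintegral_inclusions hω κ hε ht, lintegral_inclusions hω κ hε ht]
  refine (Finset.sum_le_sum fun n hn => H A hA hE hM ε hε δ hδ f hf g u hu n (hmem n hn)).trans ?_
  rw [← Finset.mul_sum, Finset.sum_add_distrib, ← Finset.mul_sum]
  refine mul_le_mul' le_rfl (add_le_add ?_ le_rfl)
  refine sum_lintegral_cell_le (hNK.trans hKY) hε (fun n _ => sdiff_subset)
    (fun n _ => (isOpen_cellInclusion hN hε n).measurableSet.diff
      (isOpen_cellInclusion hω.domain.isOpen hε n).measurableSet) (fun n hn x hx => ?_) _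
  -- The layer around one inclusion meets no inclusion: its own has been removed, and the others lie
  -- in other cells.
  refine ⟨hKΩ ε hε n (hmem n hn) (image_mono hNK hx.1), fun hxD => ?_⟩
  obtain ⟨n', hn', hxn'⟩ := mem_iUnion₂.1 hxD
  by_cases hnn : n = n'
  · exact hx.2 (hnn ▸ hxn')
  · exact (disjoint_cellInclusion (hNK.trans hKY) hω.subset hε hnn).le_bot ⟨hx.1, hxn'⟩

/-- Correction of a function in `H¹` by an element of `H¹₀` that makes its gradient small on the
inclusions. -/
theorem exists_outer_corrector (m : ℕ) {Ω ω : Set (E d)}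
    (hΩo : IsOpen Ω) (hΩb : Bornology.IsBounded Ω) (hω : IsInclusion ω) {κ : ℝ} (hκ : 0 < κ) :
    ∃ C : ℝ≥0∞, C ≠ ∞ ∧ ∀ ε : ℝ, 0 < ε → ∀ (G : H1 m Ω) (η : ℝ≥0∞), η ≠ 0 →
      ∃ V ∈ H10 m Ω,
        ∫⁻ x in inclusions Ω ω κ ε, ‖H1.grad V x - H1.grad G x‖ₑ ^ 2 ≤ η ∧
        ∫⁻ x in Ω, ‖H1.grad V x‖ₑ ^ 2 ≤ C * ((∫⁻ x in Ω, ‖H1.grad G x‖ₑ ^ 2) + η) := by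
  obtain ⟨N, K, hN, hK, hωN, hNK, hKY, hKΩ⟩ := hω.exists_neighborhood hΩo hκ
  obtain ⟨C, hC, HC⟩ := hω.exists_outer_correction_cell m hN hωN
  obtain ⟨c, c0, ct, hc⟩ := exists_enorm_bounds d m
  refine ⟨c * C * c * 2, by finiteness, fun ε hε G η hη => ?_⟩
  have hfin := finite_indexSet hΩb hω.domain.isConnected.nonempty κ hε
  set t := hfin.toFinset
  have ht : (t : Set (Fin d → ℤ)) = indexSet Ω ω κ ε := hfin.coe_toFinset
  have hmem : ∀ n ∈ t, n ∈ indexSet Ω ω κ ε := fun n hn => hfin.mem_toFinset.1 hn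
  have hKΩ' : ∀ n ∈ t, cellInclusion K ε n ⊆ Ω := fun n hn => hKΩ ε hε n (hmem n hn)
  have hNY := hNK.trans hKY
  -- The errors of all cells then sum to at most η; the 1 avoids a zero denominator when no
  -- inclusion is kept.
  set η' : ℝ≥0∞ := η / (t.card + 1)
  have hη' : η' ≠ 0 := ENNReal.div_ne_zero.2 ⟨hη, by finiteness⟩
  have hsum : ∑ _n ∈ t, η' ≤ η := by
    rw [Finset.sum_const, nsmul_eq_mul]
    calc (t.card : ℝ≥0∞) * η' ≤ (t.card + 1) * η' := by gcongr; exact le_self_add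
      _ = η := ENNReal.mul_div_cancel (by simp) (by finiteness)
  set a := H1.grad G
  have hloc : ∀ n ∈ t, ∃ ψ : E d → E m, (∃ L, LipschitzWith L ψ) ∧ HasCompactSupport ψ ∧
      tsupport ψ ⊆ cellInclusion N ε n ∧
      ∫⁻ x in cellInclusion ω ε n, ‖gradVec ψ x - a x‖ₑ ^ 2 ≤ η' ∧
      ∫⁻ x, ‖gradVec ψ x‖ₑ ^ 2 ≤
        c * C * c * 2 * ((∫⁻ x in cellInclusion N ε n, ‖a x‖ₑ ^ 2) + η') := by
    intro n hn
    obtain ⟨w, hw, hwc, -, hwa⟩ := (H1.isWeakGradient G).exists_smooth_approx hΩo (H1.memLp_fn G)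
      (H1.memLp_grad G) (isCompact_cellInclusion hK hε n) (hKΩ' n hn) hη'
    change ∫⁻ x in cellInclusion K ε n, ‖gradVec w x - a x‖ₑ ^ 2 ≤ η' at hwa
    obtain ⟨ψ, L, hL, hψc, hψs, hψω, hψ⟩ := HC ε hε n w hw (hwc hΩb)
    refine ⟨ψ, ⟨L, hL⟩, hψc, hψs, ?_, ?_⟩
    · refine le_trans ?_ hwa
      refine le_trans (le_of_eq ?_)
        (lintegral_mono_set (image_mono (subset_closure.trans (hωN.trans hNK))))
      refine setLIntegral_congr_fun
        (isOpen_cellInclusion hω.domain.isOpen hε n).measurableSet fun x hx => ?_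
      simp only [gradVec, hψω x hx]
    · have hNm : cellInclusion N ε n ⊆ cellInclusion K ε n := image_mono hNK
      have h1 := lintegral_enorm_add_sq_le (ν := volume.restrict (cellInclusion N ε n))
        (b := fun x => gradVec w x - a x)
        ((H1.memLp_grad G).1.mono_measure
          (Measure.restrict_mono (hNm.trans (hKΩ' n hn)) le_rfl))
      simp only [a, add_sub_cancel] at h1
      have h2 := h1.trans (add_le_add le_rfl
        (mul_le_mul' le_rfl ((lintegral_mono_set hNm).trans hwa)))
      calc _ ≤ ∫⁻ x, c * ‖fderiv ℝ ψ x‖ₑ ^ 2 := lintegral_mono fun x => (hc _).1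
        _ = c * ∫⁻ x, ‖fderiv ℝ ψ x‖ₑ ^ 2 := lintegral_const_mul' _ _ ct
        _ ≤ c * (C * ∫⁻ x in cellInclusion N ε n, ‖fderiv ℝ w x‖ₑ ^ 2) := mul_le_mul' le_rfl hψ
        _ ≤ c * (C * ∫⁻ x in cellInclusion N ε n, c * ‖gradVec w x‖ₑ ^ 2) := by
            refine mul_le_mul' le_rfl (mul_le_mul' le_rfl ?_)
            exact lintegral_mono fun x => (hc _).2
        _ ≤ c * (C * (c * (2 * (∫⁻ x in cellInclusion N ε n, ‖a x‖ₑ ^ 2) + 2 * η'))) := by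
            rw [lintegral_const_mul' _ _ ct]
            exact mul_le_mul' le_rfl (mul_le_mul' le_rfl (mul_le_mul' le_rfl h2))
        _ = _ := by ring
  choose! ψ hψL hψc hψs hψω hψg using hloc
  obtain ⟨L, hL⟩ := exists_lipschitz_finset_sum hψL
  set Ψ : E d → E m := fun x => ∑ n ∈ t, ψ n x with hΨ
  have hts : tsupport Ψ ⊆ ⋃ n ∈ t, tsupport (ψ n) := by
    refine closure_minimal (fun x hx => ?_)
      (isClosed_biUnion_finset fun n _ => isClosed_tsupport _)
    obtain ⟨n, hn, hne⟩ := Finset.exists_ne_zero_of_sum_ne_zero hx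
    exact mem_iUnion₂.2 ⟨n, hn, subset_tsupport _ hne⟩
  have hΨc : HasCompactSupport Ψ :=
    (t.isCompact_biUnion fun n hn => hψc n hn).of_isClosed_subset (isClosed_tsupport _) hts
  have hNΩ : ∀ n ∈ t, cellInclusion N ε n ⊆ Ω := fun n hn => (image_mono hNK).trans (hKΩ' n hn)
  obtain ⟨V, hV, -, hV2⟩ := exists_H10_of_lipschitz hΩo hL hΨc
    (hts.trans (iUnion₂_subset fun n hn => (hψs n hn).trans (hNΩ n hn)))
  -- The local correctors have supports in disjoint cells, so near a point of the n-th neighbourhood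
  -- only `ψ n` contributes.
  have hone : ∀ n ∈ t, ∀ x ∈ cellInclusion N ε n, gradVec Ψ x = gradVec (ψ n) x := by
    intro n hn x hx
    have : Ψ =ᶠ[𝓝 x] ψ n := by
      filter_upwards [(isOpen_cellInclusion hN hε n).mem_nhds hx] with y hy
      refine Finset.sum_eq_single_of_mem n hn fun n' hn' hne => ?_
      by_contra h
      exact (disjoint_cellInclusion hNY hNY hε hne).le_bot
        ⟨hψs n' hn' (subset_tsupport _ h), hy⟩
    rw [gradVec, this.fderiv_eq]
    rfl
  refine ⟨V, hV, ?_, ?_⟩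
  · rw [lintegral_inclusions hω κ hε ht]
    refine le_trans (Finset.sum_le_sum fun n hn => le_trans (le_of_eq ?_) (hψω n hn)) hsum
    refine lintegral_congr_ae ?_
    have hωN' : cellInclusion ω ε n ⊆ cellInclusion N ε n := image_mono (subset_closure.trans hωN)
    filter_upwards [ae_restrict_of_ae_restrict_of_subset (hωN'.trans (hNΩ n hn)) hV2,
      ae_restrict_mem (isOpen_cellInclusion hω.domain.isOpen hε n).measurableSet] with x h1 h2
    rw [h1, hone n hn x (hωN' h2)]
  · calc ∫⁻ x in Ω, ‖H1.grad V x‖ₑ ^ 2 = ∫⁻ x in Ω, ‖gradVec Ψ x‖ₑ ^ 2 :=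
          lintegral_congr_ae (hV2.mono fun x hx => by simp only [hx])
      _ ≤ ∫⁻ x, ‖gradVec Ψ x‖ₑ ^ 2 := setLIntegral_le_lintegral _ _
      _ ≤ ∫⁻ x, ∑ n ∈ t, ‖gradVec (ψ n) x‖ₑ ^ 2 := by
          refine lintegral_mono fun x => ?_
          by_cases hx : x ∈ tsupport Ψ
          · obtain ⟨n, hn, hxn⟩ := mem_iUnion₂.1 (hts hx)
            simp only [hone n hn x (hψs n hn hxn)]
            exact Finset.single_le_sum (f := fun n => ‖gradVec (ψ n) x‖ₑ ^ 2)
              (fun _ _ => zero_le) hn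
          · simp [gradVec_eq_zero_of_notMem_tsupport hx]
      _ = ∑ n ∈ t, ∫⁻ x, ‖gradVec (ψ n) x‖ₑ ^ 2 :=
          lintegral_finsetSum _ fun n _ => (measurable_gradVec _).enorm.pow_const 2
      _ ≤ ∑ n ∈ t, c * C * c * 2 * ((∫⁻ x in cellInclusion N ε n, ‖a x‖ₑ ^ 2) + η') :=
          Finset.sum_le_sum hψg
      _ ≤ _ := by
          rw [← Finset.mul_sum, Finset.sum_add_distrib]
          exact mul_le_mul' le_rfl (add_le_add (sum_lintegral_cell_le hNY hε (fun n _ => subset_rfl)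
            (fun n _ => (isOpen_cellInclusion hN hε n).measurableSet) hNΩ _) hsum)

end GlobalEstimate

/-! ### Small and large contrast, and the final assembly. -/

section MainEstimate

variable {d m : ℕ}

/-- Bound of a solution by a function `G` with the same boundary values. -/
theorem enorm_sq_solution_le {Ω ω : Set (E d)} (hΩo : IsOpen Ω) (hω : IsInclusion ω)
    {κ μ M : ℝ} (hμ : 0 < μ) {A : Coeff d m} (hA : A.IsMeasurable) (hE : A.IsElliptic μ)
    (hM : A.IsBoundedBy M) {ε δ : ℝ} (hε : 0 < ε) (hδ : 0 < δ) {f : E d → E m}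
    (hf : MemLp f 2 (volume.restrict Ω)) {g : HHalf m Ω} {u : H1 m Ω}
    (hu : IsWeakSolution Ω ω κ A ε δ f g u) {G : H1 m Ω} (hG : u - G ∈ H10 m Ω)
    {P Q : ℝ} (hP : 0 < P) (hQ : 0 < Q) {R : ℝ≥0∞}
    (hFr : ∀ v ∈ H10 m Ω,
      ∫⁻ x in Ω, ‖H1.fn v x‖ₑ ^ 2 ≤ ENNReal.ofReal P * ∫⁻ x in Ω, ‖H1.grad v x‖ₑ ^ 2)
    (hV : ∫⁻ x in Ω, ‖H1.grad (u - G) x‖ₑ ^ 2 ≤ ENNReal.ofReal Q *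
      ((∫⁻ x in Ω, ENNReal.ofReal (contrast Ω ω κ ε δ x) * ‖H1.grad (u - G) x‖ₑ ^ 2) + R)) :
    ‖u‖ₑ ^ 2 ≤ 2 * ((ENNReal.ofReal P + 1) * ENNReal.ofReal Q *
      (2 * R + (ENNReal.ofReal (4 * (P * Q) / μ ^ 2) * ∫⁻ x in Ω, ‖f x‖ₑ ^ 2) +
        ENNReal.ofReal (2 * (d * d * m * m * |M|) ^ 2 / μ ^ 2) *
          ∫⁻ x in Ω, ENNReal.ofReal (contrast Ω ω κ ε δ x) * ‖H1.grad G x‖ₑ ^ 2)) +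
      2 * ‖G‖ₑ ^ 2 := by
  -- `hV` records how the weighted energy controls the plain one, with Q and R depending on the
  -- regime. Together with Friedrichs' inequality it gives the Poincaré hypothesis of `energy_le`
  -- with constant PQ.
  have hpoin := (hFr _ hG).trans (mul_le_mul' le_rfl hV)
  rw [← mul_assoc, ← ENNReal.ofReal_mul hP.le] at hpoin
  have key := energy_le hA hM hE hμ ε⁻¹ (ν := volume.restrict Ω) (w := contrast Ω ω κ ε δ)
    (B := max 1 δ) (measurable_contrast hΩo hω.domain.isOpen κ hε δ)
    (contrast_nonneg Ω ω κ ε hδ) (contrast_le Ω ω κ ε δ) (T := univ) MeasurableSet.univ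
    (H1.memLp_grad u) (H1.memLp_grad (u - G)) hf (H1.memLp_fn (u - G)) (by simp) (by simp)
    (hu.2 _ hG) (P := P * Q) (by positivity) (R := R) hpoin
  rw [Measure.restrict_univ] at key
  have hZ : ∫⁻ x in Ω, ENNReal.ofReal (contrast Ω ω κ ε δ x) *
      ‖H1.grad u x - H1.grad (u - G) x‖ₑ ^ 2 =
      ∫⁻ x in Ω, ENNReal.ofReal (contrast Ω ω κ ε δ x) * ‖H1.grad G x‖ₑ ^ 2 := by
    refine lintegral_congr_ae ((H1.grad_sub u G).mono fun x hx => ?_)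
    simp only [hx, sub_sub_cancel]
  rw [hZ] at key
  have h1 : ‖u‖ₑ ^ 2 ≤ 2 * ‖u - G‖ₑ ^ 2 + 2 * ‖G‖ₑ ^ 2 := by
    simpa using enorm_add_sq_le (u - G) G
  have h2 : ‖u - G‖ₑ ^ 2 ≤ (ENNReal.ofReal P + 1) * ∫⁻ x in Ω, ‖H1.grad (u - G) x‖ₑ ^ 2 := by
    rw [H1.enorm_sq, add_mul, one_mul]
    exact add_le_add (hFr _ hG) le_rfl
  refine h1.trans (add_le_add (mul_le_mul' le_rfl (h2.trans ?_)) le_rfl)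
  rw [mul_assoc]
  refine mul_le_mul' le_rfl (hV.trans (mul_le_mul' le_rfl ?_))
  refine (add_le_add key le_rfl).trans (le_of_eq ?_)
  ring

theorem sub_mem_H10_of_trace_eq {U : Set (E d)} {u G : H1 m U} (h : trace u = trace G) :
    u - G ∈ H10 m U := (Submodule.Quotient.eq _).1 h

theorem lintegral_grad_le_enorm_sq {U : Set (E d)} (G : H1 m U) :
    ∫⁻ x in U, ‖H1.grad G x‖ₑ ^ 2 ≤ ‖G‖ₑ ^ 2 := by
  rw [H1.enorm_sq]
  exact le_add_self

theorem lintegral_sdiff_inclusions {Ω ω : Set (E d)} (hΩo : IsOpen Ω)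
    (hΩb : Bornology.IsBounded Ω) (hω : IsInclusion ω) (κ : ℝ) {ε : ℝ} (hε : 0 < ε) (δ : ℝ)
    (h : E d → ℝ≥0∞) : ∫⁻ x in Ω \ inclusions Ω ω κ ε, ENNReal.ofReal (contrast Ω ω κ ε δ x) * h x =
      ∫⁻ x in Ω \ inclusions Ω ω κ ε, h x := by
  refine lintegral_congr_ae ?_
  filter_upwards [ae_restrict_of_ae_restrict_of_subset sdiff_subset
    (ae_contrast_eq_one hΩo hΩb hω κ hε δ), ae_restrict_mem (hΩo.measurableSet.diff
      (isOpen_inclusions hω.domain.isOpen κ hε).measurableSet)] with x h1 h2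
  rw [h1 h2.2]
  simp

theorem lintegral_split_inclusions {Ω ω : Set (E d)} (hω : IsInclusion ω) (κ : ℝ) {ε : ℝ}
    (hε : 0 < ε) (h : E d → ℝ≥0∞) : ∫⁻ x in Ω, h x =
      (∫⁻ x in inclusions Ω ω κ ε, h x) + ∫⁻ x in Ω \ inclusions Ω ω κ ε, h x := by
  rw [← lintegral_inter_add_sdiff h Ω (isOpen_inclusions hω.domain.isOpen κ hε).measurableSet,
    inter_eq_self_of_subset_right (inclusions_subset Ω ω κ ε)]

set_option maxHeartbeats 1000000 in
/-- The energy estimate for small contrast. -/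
theorem exists_estimate_of_le_one (hd : 0 < d) (m : ℕ) {Ω ω : Set (E d)}
    (hΩo : IsOpen Ω) (hΩb : Bornology.IsBounded Ω) (hω : IsInclusion ω) {κ μ : ℝ} (M : ℝ)
    (hκ : 0 < κ) (hμ : 0 < μ) :
    ∃ C : ℝ≥0∞, C ≠ ∞ ∧ ∀ A : Coeff d m, A.IsMeasurable → A.IsElliptic μ → A.IsBoundedBy M →
      ∀ ε : ℝ, 0 < ε → ∀ δ : ℝ, 0 < δ → δ ≤ 1 →
      ∀ f : E d → E m, MemLp f 2 (volume.restrict Ω) →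
      ∀ (G u : H1 m Ω), IsWeakSolution Ω ω κ A ε δ f (trace G) u →
      ‖u‖ₑ ^ 2 ≤ C * ((∫⁻ x in Ω, ‖f x‖ₑ ^ 2) +
        (ENNReal.ofReal (ε ^ 2 * δ⁻¹ ^ 2) * ∫⁻ x in inclusions Ω ω κ ε, ‖f x‖ₑ ^ 2) +
        ‖G‖ₑ ^ 2) := by
  obtain ⟨C, hC, H⟩ := exists_inclusions_estimate hd m hΩo hΩb hω M hκ hμ
  obtain ⟨P, hP, hFr⟩ := exists_friedrichs_H10 hd m hΩo hΩb
  -- Adding the bounds inside and outside D in `hV` gives coefficients 4C + 1, 4C + 2 and 2C for X,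
  -- W and r; Q is the largest. The terms added through `le_self_add` below only fill up the smaller
  -- coefficients.
  set Q := (4 * C + 2).toReal
  have hQt : 4 * C + 2 ≠ ∞ := by finiteness
  have hQ : 0 < Q := ENNReal.toReal_pos (by simp) hQt
  set k₁ := ENNReal.ofReal (4 * (P * Q) / μ ^ 2)
  set k₂ := ENNReal.ofReal (2 * (d * d * m * m * |M|) ^ 2 / μ ^ 2)
  set b := (ENNReal.ofReal P + 1) * ENNReal.ofReal Q
  have hb : b ≠ ∞ := by finiteness
  refine ⟨2 * b * (2 + k₁ + k₂) + 2, by finiteness,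
    fun A hA hE hM ε hε δ hδ hδ1 f hf G u hu => ?_⟩
  have hG : u - G ∈ H10 m Ω := sub_mem_H10_of_trace_eq hu.1
  have hest := H A hA hE hM ε hε δ hδ f hf _ u hu
  set D := inclusions Ω ω κ ε
  set r := ENNReal.ofReal (ε ^ 2 * δ⁻¹ ^ 2) * ∫⁻ x in D, ‖f x‖ₑ ^ 2
  have hDΩ : D ⊆ Ω := inclusions_subset Ω ω κ ε
  have hW := lintegral_grad_le_enorm_sq G
  set W := ‖G‖ₑ ^ 2
  set X := ∫⁻ x in Ω, ENNReal.ofReal (contrast Ω ω κ ε δ x) * ‖H1.grad (u - G) x‖ₑ ^ 2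
  have hmeas : ∀ (v : H1 m Ω) {T : Set (E d)}, T ⊆ Ω →
      AEStronglyMeasurable (H1.grad v) (volume.restrict T) :=
    fun v T hT => (H1.memLp_grad v).1.mono_measure (Measure.restrict_mono hT le_rfl)
  have hWT : ∀ {T : Set (E d)}, T ⊆ Ω → ∫⁻ x in T, ‖H1.grad G x‖ₑ ^ 2 ≤ W :=
    fun hT => (lintegral_mono_set hT).trans hW
  have hX : ∫⁻ x in Ω \ D, ‖H1.grad (u - G) x‖ₑ ^ 2 ≤ X := by
    rw [← lintegral_sdiff_inclusions hΩo hΩb hω κ hε δ]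
    exact lintegral_mono_set sdiff_subset
  have hsub := H1.grad_sub u G
  have hout : ∫⁻ x in Ω \ D, ‖H1.grad u x‖ₑ ^ 2 ≤ 2 * X + 2 * W := by
    refine le_trans (le_of_eq (lintegral_congr_ae ?_)) ((lintegral_enorm_add_sq_le
      (b := H1.grad G) (hmeas (u - G) (sdiff_subset (s := Ω) (t := D)))).trans
      (add_le_add (mul_le_mul' le_rfl hX) (mul_le_mul' le_rfl (hWT sdiff_subset))))
    filter_upwards [ae_restrict_of_ae_restrict_of_subset (sdiff_subset (s := Ω) (t := D)) hsub]
      with x hx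
    rw [hx, sub_add_cancel]
  have hin : ∫⁻ x in D, ‖H1.grad (u - G) x‖ₑ ^ 2 ≤ 2 * (C * (2 * X + 2 * W + r)) + 2 * W := by
    refine le_trans (le_of_eq (lintegral_congr_ae ?_)) ((lintegral_enorm_sub_sq_le
      (b := H1.grad G) (hmeas u hDΩ)).trans (add_le_add (mul_le_mul' le_rfl (hest.trans
        (mul_le_mul' le_rfl (add_le_add hout le_rfl)))) (mul_le_mul' le_rfl (hWT hDΩ))))
    filter_upwards [ae_restrict_of_ae_restrict_of_subset hDΩ hsub] with x hx
    rw [hx]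
  have hV : ∫⁻ x in Ω, ‖H1.grad (u - G) x‖ₑ ^ 2 ≤ ENNReal.ofReal Q * (X + (W + r)) := by
    rw [ENNReal.ofReal_toReal hQt, lintegral_split_inclusions hω κ hε]
    calc _ ≤ 2 * (C * (2 * X + 2 * W + r)) + 2 * W + X := add_le_add hin hX
      _ ≤ 2 * (C * (2 * X + 2 * W + r)) + 2 * W + X + (X + (2 * C + 2) * r) := le_self_add
      _ = _ := by ring
  have key := enorm_sq_solution_le hΩo hω hμ hA hE hM hε hδ hf hu hG hP hQ hFr hV
  have hZ : ∫⁻ x in Ω, ENNReal.ofReal (contrast Ω ω κ ε δ x) * ‖H1.grad G x‖ₑ ^ 2 ≤ W := by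
    refine (lintegral_mono fun x => ?_).trans hW
    refine mul_le_of_le_one_left zero_le (ENNReal.ofReal_le_one.2 ?_)
    exact (contrast_le Ω ω κ ε δ x).trans (max_le le_rfl hδ1)
  set F := ∫⁻ x in Ω, ‖f x‖ₑ ^ 2
  calc _ ≤ 2 * (b * (2 * (W + r) + k₁ * F + k₂ * W)) + 2 * W :=
        key.trans (add_le_add (mul_le_mul' le_rfl (mul_le_mul' le_rfl
          (add_le_add le_rfl (mul_le_mul' le_rfl hZ)))) le_rfl)
    _ ≤ 2 * (b * (2 * (W + r) + k₁ * F + k₂ * W)) + 2 * W +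
        (2 * (b * (2 * F + k₁ * (r + W) + k₂ * (F + r))) + 2 * (F + r)) := le_self_add
    _ = _ := by ring

set_option maxHeartbeats 1000000 in
/-- The energy estimate for large contrast. -/
theorem exists_estimate_of_one_le (hd : 0 < d) (m : ℕ) {Ω ω : Set (E d)}
    (hΩo : IsOpen Ω) (hΩb : Bornology.IsBounded Ω) (hω : IsInclusion ω) {κ μ : ℝ} (M : ℝ)
    (hκ : 0 < κ) (hμ : 0 < μ) :
    ∃ C : ℝ≥0∞, C ≠ ∞ ∧ ∀ A : Coeff d m, A.IsMeasurable → A.IsElliptic μ → A.IsBoundedBy M →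
      ∀ ε : ℝ, 0 < ε → ∀ δ : ℝ, 1 ≤ δ →
      ∀ f : E d → E m, MemLp f 2 (volume.restrict Ω) →
      ∀ (G u : H1 m Ω), IsWeakSolution Ω ω κ A ε δ f (trace G) u →
      ‖u‖ₑ ^ 2 ≤ C * ((∫⁻ x in Ω, ‖f x‖ₑ ^ 2) + ‖G‖ₑ ^ 2) := by
  obtain ⟨C, hC, H⟩ := exists_outer_corrector m hΩo hΩb hω hκ
  obtain ⟨P, hP, hFr⟩ := exists_friedrichs_H10 hd m hΩo hΩb
  set k₁ := ENNReal.ofReal (4 * (P * 1) / μ ^ 2)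
  set k₂ := ENNReal.ofReal (2 * (d * d * m * m * |M|) ^ 2 / μ ^ 2)
  set b := ENNReal.ofReal P + 1
  have hb : b ≠ ∞ := by finiteness
  set C₅ := 2 + 2 * (b * C)
  have hC₅ : C₅ ≠ ∞ := by finiteness
  set C₆ := 2 * b * (k₁ + k₂ * (C₅ + 1)) + 2 * C₅
  have hC₆ : C₆ ≠ ∞ := by finiteness
  refine ⟨C₆, hC₆, fun A hA hE hM ε hε δ hδ1 f hf G u hu => ?_⟩
  have hδ : 0 < δ := by linarith
  refine ennreal_le_of_forall_le_add_mul (K := C₆ * (1 + ENNReal.ofReal δ)) (by finiteness)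
    fun η η0 _ => ?_
  -- G is replaced by G - V, which has the same trace. Its gradient on D has squared norm at most η,
  -- so the large weight δ multiplies only this error.
  obtain ⟨V, hV, hVD, hVΩ⟩ := H ε hε G η η0
  set D := inclusions Ω ω κ ε
  have hDΩ : D ⊆ Ω := inclusions_subset Ω ω κ ε
  have hG : u - (G - V) ∈ H10 m Ω := by
    rw [sub_sub_eq_add_sub, add_sub_right_comm]
    exact (H10 m Ω).add_mem (sub_mem_H10_of_trace_eq hu.1) hV
  -- Dominates both errors η and δη. It is still negligible because δ is fixed while η is arbitrary.
  set η' := (1 + ENNReal.ofReal δ) * η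
  have hηη' : η ≤ η' := by
    calc η = 1 * η := (one_mul η).symm
      _ ≤ _ := mul_le_mul' le_self_add le_rfl
  have hδη' : ENNReal.ofReal δ * η ≤ η' := mul_le_mul' le_add_self le_rfl
  have hW := lintegral_grad_le_enorm_sq G
  set W := ‖G‖ₑ ^ 2
  have hG' : ‖G - V‖ₑ ^ 2 ≤ C₅ * (W + η') := by
    have h1 : ‖V‖ₑ ^ 2 ≤ b * (C * (W + η')) := by
      rw [H1.enorm_sq, add_mul, one_mul]
      have h2 := hVΩ.trans (mul_le_mul' le_rfl (add_le_add hW hηη'))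
      exact add_le_add ((hFr V hV).trans (mul_le_mul' le_rfl h2)) h2
    calc ‖G - V‖ₑ ^ 2 ≤ 2 * W + 2 * ‖V‖ₑ ^ 2 := enorm_sub_sq_le G V
      _ ≤ 2 * W + 2 * (b * (C * (W + η'))) := by gcongr
      _ ≤ 2 * W + 2 * (b * (C * (W + η'))) + 2 * η' := le_self_add
      _ = _ := by ring
  have hZ : ∫⁻ x in Ω, ENNReal.ofReal (contrast Ω ω κ ε δ x) * ‖H1.grad (G - V) x‖ₑ ^ 2 ≤
      (C₅ + 1) * (W + η') := by
    rw [lintegral_split_inclusions hω κ hε, lintegral_sdiff_inclusions hΩo hΩb hω κ hε δ]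
    have h1 : ∫⁻ x in D, ENNReal.ofReal (contrast Ω ω κ ε δ x) * ‖H1.grad (G - V) x‖ₑ ^ 2 ≤
        ENNReal.ofReal δ * η := by
      refine le_trans (le_of_eq ?_) (mul_le_mul' le_rfl hVD)
      rw [← lintegral_const_mul' _ _ ENNReal.ofReal_ne_top]
      refine lintegral_congr_ae ?_
      filter_upwards [ae_restrict_of_ae_restrict_of_subset hDΩ (H1.grad_sub G V),
        ae_restrict_mem (isOpen_inclusions hω.domain.isOpen κ hε).measurableSet] with x h1 h2
      rw [h1, contrast_of_mem δ h2, ← enorm_neg, neg_sub]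
    have h2 : ∫⁻ x in Ω \ D, ‖H1.grad (G - V) x‖ₑ ^ 2 ≤ C₅ * (W + η') :=
      (lintegral_mono_set sdiff_subset).trans ((lintegral_grad_le_enorm_sq _).trans hG')
    calc _ ≤ η' + C₅ * (W + η') := add_le_add (h1.trans hδη') h2
      _ ≤ η' + C₅ * (W + η') + W := le_self_add
      _ = _ := by ring
  -- For δ ≥ 1 the weight is a.e. at least 1, so the weighted energy dominates the plain one with Q
  -- = 1 and R = 0.
  have hX : ∫⁻ x in Ω, ‖H1.grad (u - (G - V)) x‖ₑ ^ 2 ≤ ENNReal.ofReal 1 *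
      ((∫⁻ x in Ω, ENNReal.ofReal (contrast Ω ω κ ε δ x) *
        ‖H1.grad (u - (G - V)) x‖ₑ ^ 2) + 0) := by
    rw [ENNReal.ofReal_one, one_mul, add_zero]
    refine lintegral_mono_ae ?_
    filter_upwards [ae_contrast_eq_one hΩo hΩb hω κ hε δ] with x hx
    refine le_mul_of_one_le_left zero_le (ENNReal.one_le_ofReal.2 ?_)
    by_cases hxD : x ∈ D
    · rwa [contrast_of_mem δ hxD]
    · exact (hx hxD).ge
  have key := enorm_sq_solution_le hΩo hω hμ hA hE hM hε hδ hf hu hG hP one_pos hFr hX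
  rw [ENNReal.ofReal_one, mul_one, mul_zero, zero_add] at key
  set F := ∫⁻ x in Ω, ‖f x‖ₑ ^ 2
  clear_value C₅
  calc _ ≤ 2 * (b * (k₁ * F + k₂ * ((C₅ + 1) * (W + η')))) + 2 * (C₅ * (W + η')) :=
        key.trans (add_le_add (mul_le_mul' le_rfl (mul_le_mul' le_rfl
          (add_le_add le_rfl (mul_le_mul' le_rfl hZ)))) (mul_le_mul' le_rfl hG'))
    _ ≤ 2 * (b * (k₁ * F + k₂ * ((C₅ + 1) * (W + η')))) + 2 * (C₅ * (W + η')) +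
        (2 * (b * (k₁ * (W + η') + k₂ * ((C₅ + 1) * F))) + 2 * (C₅ * F)) := le_self_add
    _ = C₆ * (F + W) + C₆ * η' := by ring
    _ = _ := by rw [mul_assoc]

theorem ofReal_l2Norm_sq {S : Set (E d)} {f : E d → E m} (hf : MemLp f 2 (volume.restrict S)) :
    ENNReal.ofReal (l2Norm S f) ^ 2 = ∫⁻ x in S, ‖f x‖ₑ ^ 2 := by
  rw [l2Norm, ENNReal.ofReal_toReal hf.2.ne, eLpNorm_two_sq]

theorem norm_le_of_enorm_sq_le {F : Type*} [NormedAddCommGroup F] {u : F} {K : ℝ≥0∞} {C s : ℝ}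
    (hC : 0 ≤ C) (hKC : K ≤ ENNReal.ofReal C ^ 2) (hs : 0 ≤ s)
    (h : ‖u‖ₑ ^ 2 ≤ K * ENNReal.ofReal s ^ 2) : ‖u‖ ≤ C * s := by
  have h1 : ‖u‖ₑ ^ 2 ≤ ENNReal.ofReal (C * s) ^ 2 := by
    rw [ENNReal.ofReal_mul hC, mul_pow]
    exact h.trans (mul_le_mul' hKC le_rfl)
  rw [← ofReal_norm] at h1
  exact (ENNReal.ofReal_le_ofReal_iff (by positivity)).1 ((ENNReal.pow_le_pow_left_iff two_ne_zero).1 h1)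

theorem add_sq_ofReal_le {a b : ℝ} (ha : 0 ≤ a) (hb : 0 ≤ b) :
    ENNReal.ofReal a ^ 2 + ENNReal.ofReal b ^ 2 ≤ ENNReal.ofReal (a + b) ^ 2 := by
  rw [ENNReal.ofReal_add ha hb]
  calc _ ≤ ENNReal.ofReal a ^ 2 + ENNReal.ofReal b ^ 2 +
        2 * (ENNReal.ofReal a * ENNReal.ofReal b) := le_self_add
    _ = _ := by ring

/-- It suffices to estimate by the norms of the extensions of the boundary values. -/
theorem le_of_forall_extension {U : Set (E d)} {g : HHalf m U} {x C s : ℝ} (hC : 0 < C)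
    (h : ∀ G : H1 m U, trace G = g → x ≤ C * (s + ‖G‖)) : x ≤ C * (s + ‖g‖) := by
  refine le_of_forall_pos_le_add fun η hη => ?_
  obtain ⟨G, hG, hn⟩ := Submodule.Quotient.norm_mk_lt g (div_pos hη hC)
  calc x ≤ C * (s + ‖G‖) := h G hG
    _ ≤ C * (s + (‖g‖ + η / C)) := by gcongr
    _ = _ := by field_simp; ring

theorem norm_modifiedSource_le (Ω ω : Set (E d)) (κ ε : ℝ) {δ : ℝ} (hδ : 0 < δ) (hδ1 : δ ≤ 1)
    (f : E d → E m) (x : E d) : ‖modifiedSource Ω ω κ ε δ f x‖ ≤ ‖f x‖ := by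
  unfold modifiedSource
  split_ifs
  · exact le_rfl
  · rw [norm_smul, Real.norm_of_nonneg (contrast_nonneg Ω ω κ ε hδ x)]
    exact mul_le_of_le_one_left (norm_nonneg _)
      ((contrast_le Ω ω κ ε δ x).trans (max_le le_rfl hδ1))

theorem norm_modifiedSource_of_mem {Ω ω : Set (E d)} {κ ε δ : ℝ} (hδ : 0 < δ) (hδ1 : δ ≤ 1)
    (f : E d → E m) {x : E d} (hx : x ∈ inclusions Ω ω κ ε) :
    ‖modifiedSource Ω ω κ ε δ f x‖ = δ * ‖f x‖ := by
  unfold modifiedSource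
  split_ifs with h
  · rw [le_antisymm hδ1 h, one_mul]
  · rw [norm_smul, contrast_of_mem δ hx, Real.norm_of_nonneg hδ.le]

theorem memLp_modifiedSource {Ω ω : Set (E d)} (hΩo : IsOpen Ω) (hω : IsInclusion ω) (κ : ℝ)
    {ε δ : ℝ} (hε : 0 < ε) (hδ : 0 < δ) (hδ1 : δ ≤ 1) {f : E d → E m}
    (hf : MemLp f 2 (volume.restrict Ω)) :
    MemLp (modifiedSource Ω ω κ ε δ f) 2 (volume.restrict Ω) := by
  refine hf.mono ?_ (ae_of_all _ fun x => norm_modifiedSource_le Ω ω κ ε hδ hδ1 f x)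
  by_cases h : 1 ≤ δ
  · have : modifiedSource Ω ω κ ε δ f = f := funext fun x => if_pos h
    rw [this]
    exact hf.1
  · have : modifiedSource Ω ω κ ε δ f = fun x => contrast Ω ω κ ε δ x • f x :=
      funext fun x => if_neg h
    rw [this]
    exact (measurable_contrast hΩo hω.domain.isOpen κ hε δ).aestronglyMeasurable.smul hf.1

/-- On D_ε the modified source has size δ|f|, which cancels δ⁻¹, and the remaining ε² is below 1.
Hence (iii) follows from the estimate behind (i). -/
theorem lintegral_modifiedSource_inclusions_le {Ω ω : Set (E d)} (hω : IsInclusion ω) (κ : ℝ)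
    {ε δ : ℝ} (hε : 0 < ε) (hε1 : ε < 1) (hδ : 0 < δ) (hδ1 : δ ≤ 1) (f : E d → E m) :
    ENNReal.ofReal (ε ^ 2 * δ⁻¹ ^ 2) *
      ∫⁻ x in inclusions Ω ω κ ε, ‖modifiedSource Ω ω κ ε δ f x‖ₑ ^ 2 ≤
      ∫⁻ x in Ω, ‖f x‖ₑ ^ 2 := by
  rw [← lintegral_const_mul' _ _ ENNReal.ofReal_ne_top]
  refine le_trans (setLIntegral_mono' (isOpen_inclusions hω.domain.isOpen κ hε).measurableSet
    fun x hx => ?_) (lintegral_mono_set (inclusions_subset Ω ω κ ε))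
  rw [← ofReal_norm, ← ofReal_norm, norm_modifiedSource_of_mem hδ hδ1 f hx,
    ← ENNReal.ofReal_pow (by positivity), ← ENNReal.ofReal_pow (by positivity),
    ← ENNReal.ofReal_mul (by positivity)]
  refine ENNReal.ofReal_le_ofReal ?_
  calc ε ^ 2 * δ⁻¹ ^ 2 * (δ * ‖f x‖) ^ 2 = ε ^ 2 * ‖f x‖ ^ 2 := by field_simp
    _ ≤ 1 * ‖f x‖ ^ 2 := by gcongr; nlinarith
    _ = _ := one_mul _

end MainEstimate

end HighContrast


open HighContrast

theorem theorem4p1 (d m : ℕ) (hd : 2 ≤ d) (hm : 1 ≤ m)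
    (Ω ω : Set (HighContrast.E d))
    (hΩ : HighContrast.IsBoundedLipschitzDomain Ω) (hω : HighContrast.IsInclusion ω)
    (κ μ M : ℝ) (hκ : 0 < κ) (hμ : 0 < μ) :
    ∃ C : ℝ, 0 < C ∧
      ∀ A : HighContrast.Coeff d m, A.IsMeasurable → A.IsElliptic μ → A.IsBoundedBy M →
        A.IsPeriodic →
      ∀ ε : ℝ, 0 < ε → ε < 1 → ∀ δ : ℝ, 0 < δ →
      ∀ f : HighContrast.E d → HighContrast.E m,
        MeasureTheory.MemLp f 2 (MeasureTheory.volume.restrict Ω) →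
      ∀ (g : HighContrast.HHalf m Ω) (u : HighContrast.H1 m Ω),
        (δ ≤ 1 → HighContrast.IsWeakSolution Ω ω κ A ε δ f g u →
          ‖u‖ ≤ C * (HighContrast.l2Norm Ω f +
            ε * δ⁻¹ * HighContrast.l2Norm (HighContrast.inclusions Ω ω κ ε) f + ‖g‖)) ∧
        (1 < δ → HighContrast.IsWeakSolution Ω ω κ A ε δ f g u →
          ‖u‖ ≤ C * (HighContrast.l2Norm Ω f + ‖g‖)) ∧
        (δ ≤ 1 → HighContrast.IsWeakSolution Ω ω κ A ε δ
            (HighContrast.modifiedSource Ω ω κ ε δ f) g u →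
          ‖u‖ ≤ C * (HighContrast.l2Norm Ω f + ‖g‖)) := by
  obtain ⟨K₁, hK₁, H₁⟩ := exists_estimate_of_le_one (by omega : 0 < d) m hΩ.isOpen hΩ.isBounded hω
    M hκ hμ
  obtain ⟨K₂, hK₂, H₂⟩ := exists_estimate_of_one_le (by omega : 0 < d) m hΩ.isOpen hΩ.isBounded hω
    M hκ hμ
  -- One constant for all three parts; the factor 2 serves (iii), where f is counted twice. The
  -- added 1 makes C positive and C² at least 2K₁ + K₂.
  set C : ℝ := (2 * K₁ + K₂).toReal + 1
  have hC : 0 < C := by positivity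
  have hK : 2 * K₁ + K₂ ≤ ENNReal.ofReal C ^ 2 := by
    rw [← ENNReal.ofReal_toReal (show 2 * K₁ + K₂ ≠ ∞ by finiteness),
      ← ENNReal.ofReal_pow hC.le]
    refine ENNReal.ofReal_le_ofReal ?_
    nlinarith [ENNReal.toReal_nonneg (a := 2 * K₁ + K₂)]
  refine ⟨C, hC, fun A hA hE hM _ ε hε hε1 δ hδ f hf g u => ?_⟩
  have hF := ofReal_l2Norm_sq hf
  have hF0 : 0 ≤ l2Norm Ω f := ENNReal.toReal_nonneg
  refine ⟨fun hδ1 hu => ?_, fun hδ1 hu => ?_, fun hδ1 hu => ?_⟩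
  -- The quotient norm of g is an infimum over extensions G, so it suffices to prove the bound with
  -- ‖G‖ for each of them.
  · refine le_of_forall_extension hC fun G hG => ?_
    subst hG
    have hD := ofReal_l2Norm_sq
      (hf.mono_measure (Measure.restrict_mono (inclusions_subset Ω ω κ ε) le_rfl))
    have hD0 : 0 ≤ l2Norm (inclusions Ω ω κ ε) f := ENNReal.toReal_nonneg
    have h1 := H₁ A hA hE hM ε hε δ hδ hδ1 f hf G u hu
    refine norm_le_of_enorm_sq_le hC.le hK (by positivity) (h1.trans (mul_le_mul' ?_ ?_))
    · exact (le_mul_of_one_le_left zero_le one_le_two).trans le_self_add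
    · rw [← hF, ← hD, ← ofReal_norm, ← ENNReal.ofReal_pow hD0,
        ← ENNReal.ofReal_mul (by positivity), ← mul_pow, ← mul_pow,
        ENNReal.ofReal_pow (by positivity)]
      exact (add_le_add (add_sq_ofReal_le hF0 (by positivity)) le_rfl).trans
        (add_sq_ofReal_le (by positivity) (norm_nonneg _))
  · refine le_of_forall_extension hC fun G hG => ?_
    subst hG
    have h1 := H₂ A hA hE hM ε hε δ hδ1.le f hf G u hu
    refine norm_le_of_enorm_sq_le hC.le hK (by positivity) (h1.trans (mul_le_mul' le_add_self ?_))
    rw [← hF, ← ofReal_norm]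
    exact add_sq_ofReal_le hF0 (norm_nonneg _)
  · refine le_of_forall_extension hC fun G hG => ?_
    subst hG
    have h1 := H₁ A hA hE hM ε hε δ hδ hδ1 _
      (memLp_modifiedSource hΩ.isOpen hω κ hε hδ hδ1 hf) G u hu
    have h2 : ∫⁻ x in Ω, ‖modifiedSource Ω ω κ ε δ f x‖ₑ ^ 2 ≤ ∫⁻ x in Ω, ‖f x‖ₑ ^ 2 := by
      refine lintegral_mono fun x => pow_le_pow_left' ?_ 2
      rw [← ofReal_norm, ← ofReal_norm]
      exact ENNReal.ofReal_le_ofReal (norm_modifiedSource_le Ω ω κ ε hδ hδ1 f x)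
    have h3 := lintegral_modifiedSource_inclusions_le (Ω := Ω) hω κ hε hε1 hδ hδ1 f
    refine norm_le_of_enorm_sq_le hC.le (le_self_add.trans hK) (by positivity)
      (h1.trans ?_)
    calc K₁ * _ ≤ K₁ * ((∫⁻ x in Ω, ‖f x‖ₑ ^ 2) + (∫⁻ x in Ω, ‖f x‖ₑ ^ 2) + ‖G‖ₑ ^ 2) :=
          mul_le_mul' le_rfl (add_le_add (add_le_add h2 h3) le_rfl)
      _ ≤ K₁ * ((∫⁻ x in Ω, ‖f x‖ₑ ^ 2) + (∫⁻ x in Ω, ‖f x‖ₑ ^ 2) + ‖G‖ₑ ^ 2) +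
          K₁ * ‖G‖ₑ ^ 2 := le_self_add
      _ = 2 * K₁ * ((∫⁻ x in Ω, ‖f x‖ₑ ^ 2) + ‖G‖ₑ ^ 2) := by ring
      _ ≤ _ := by
        rw [← hF, ← ofReal_norm]
        exact mul_le_mul' le_rfl (add_sq_ofReal_le hF0 (norm_nonneg _))
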